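/- **Theorem (Penrose inequality in AdS with symmetry).** Let $d\ge 2$, $L>0$, $G_N>0$ and $k\in\{1,0,-1\}$. Consider a time-oriented $(d+1)$-dimensional spacetime with spherical ($k=1$), planar ($k=0$) or hyperbolic ($k=-1$) symmetry, that is, with metric $g=h+r^2\,d\Omega_k^2$, where $h$ is a smooth Lorentzian metric and $r>0$ a smooth function on the two-dimensional space $Q$ of orbits, and $d\Omega_k^2$ is the metric of the $(d-1)$-dimensional unit sphere, plane or unit hyperbolic space. Suppose that the Einstein equations $G_{ab}-\frac{d(d-1)}{2L^2}g_{ab}=8\pi G_N T_{ab}$ and the dominant energy condition hold: $T_{ab}u^av^b\ge 0$ for all timelike $u^a,v^a$ at the same point that are both future-directed or both past-directed. Suppose that the spacetime is asymptotically AdS at a connected component of its conformal boundary: near it there are coordinates $(t,\rho)$ on $Q$, with $t$ in an open interval and $\rho\to\infty$ at the boundary, such that, locally uniformly in $t$, $$h_{tt}=-\Big(k+\tfrac{\rho^2}{L^2}\Big)+O(\rho^{2-d}),\quad h_{t\rho}=O(\rho^{-d-1}),\quad h_{\rho\rho}=\Big(k+\tfrac{\rho^2}{L^2}\Big)^{-1}+O(\rho^{-d-2}),$$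 $$r^2=\rho^2+O(\rho^{2-d}),\quad \partial_t(r^2)=O(\rho^{2-d}),\quad \partial_\rho(r^2-\rho^2)=O(\rho^{1-d}).$$ Let $\Omega_k\in(0,\infty)$ be the volume of the sphere, plane or hyperbolic space, or of a part of it (for example, a fundamental domain of a compactification); areas and masses refer to that part. Let the mass of the component at the cut $t=t_0$ be finite and equal to $M$: $$M=\frac{1}{16\pi G_N}\lim_{t\to t_0,\ \rho\to\infty}\oint U^i\,dS_i ,$$ $$U^i=\sqrt{\det\gamma}\,\Big[V\big(\gamma^{ik}\gamma^{jl}-\gamma^{ij}\gamma^{kl}\big)\mathring D_j\gamma_{kl}+\big(\nabla^iV\,\gamma^{jk}-\nabla^jV\,\gamma^{ik}\big)(\gamma_{jk}-\mathring\gamma_{jk})\Big],$$ where $\gamma$ is the metric induced on the hypersurface of constant $t$ (which also raises the indices), $V=\sqrt{k+\rho^2/L^2}$, $\mathring\gamma=V^{-2}d\rho^2+\rho^2d\Omega_k^2$ is its counterpart for pure AdS, with connection $\mathring D$, and the integral is over the orbit at $(t,\rho)$. Thus $M=0$ for pure AdS. Call an orbit, with a choice of an outer side, *marginally trapped* if its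 outwards future null expansion vanishes and its inwards future null expansion is nonpositive, and *past marginally trapped* if the same holds after reversing time. Let $\sigma$ be an orbit that is an outermost marginally trapped surface with respect to the boundary component: there is a symmetric spacelike hypersurface $\Sigma$ from $\sigma$ to the cut $t=t_0$ of the boundary component such that $\sigma$ is marginally trapped and no orbit on $\Sigma$ outside $\sigma$ is marginally trapped or past marginally trapped. Then $$\frac{16\pi G_N}{(d-1)\Omega_k}\,M\ \ge\ k\left(\frac{\mathrm{Area}[\sigma]}{\Omega_k}\right)^{\frac{d-2}{d-1}}+\frac{1}{L^2}\left(\frac{\mathrm{Area}[\sigma]}{\Omega_k}\right)^{\frac{d}{d-1}}.$$ -/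

import Mathlib

open Set Filter Topology Asymptotics MeasureTheory
open scoped Manifold ContDiff

noncomputable section

/-! ### Tensor calculus in coordinates

A metric on a coordinate domain is a matrix-valued function of the coordinates. -/

/-- The partial derivative of `f` in the `i`-th coordinate. -/
def partialD {ι : Type*} [Fintype ι] [DecidableEq ι] (i : ι) (f : (ι → ℝ) → ℝ) (x : ι → ℝ) : ℝ :=
  fderiv ℝ f x (Pi.single i 1)

/-- The Christoffel symbol `Γ^c_{ab}` of the Levi-Civita connection of `g`. -/
def christoffel {ι : Type*} [Fintype ι] [DecidableEq ι] (g : (ι → ℝ) → Matrix ι ι ℝ)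
    (c a b : ι) (x : ι → ℝ) : ℝ :=
  (1 / 2) * ∑ e, (g x)⁻¹ c e *
    (partialD a (fun y => g y e b) x + partialD b (fun y => g y e a) x
      - partialD e (fun y => g y a b) x)

/-- The Ricci tensor
`R_{ab} = ∂_c Γ^c_{ab} - ∂_b Γ^c_{ac} + Γ^c_{ce} Γ^e_{ab} - Γ^c_{be} Γ^e_{ac}`. -/
def ricci {ι : Type*} [Fintype ι] [DecidableEq ι] (g : (ι → ℝ) → Matrix ι ι ℝ)
    (a b : ι) (x : ι → ℝ) : ℝ :=
  ∑ c, (partialD c (christoffel g c a b) x - partialD b (christoffel g c a c) x)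
    + ∑ c, ∑ e, (christoffel g c c e x * christoffel g e a b x
        - christoffel g c b e x * christoffel g e a c x)

/-- The scalar curvature `g^{ab} R_{ab}`. -/
def scalarCurvature {ι : Type*} [Fintype ι] [DecidableEq ι] (g : (ι → ℝ) → Matrix ι ι ℝ)
    (x : ι → ℝ) : ℝ :=
  ∑ a, ∑ b, (g x)⁻¹ a b * ricci g a b x

/-- The Einstein tensor `G_{ab} = R_{ab} - R g_{ab} / 2`. -/
def einstein {ι : Type*} [Fintype ι] [DecidableEq ι] (g : (ι → ℝ) → Matrix ι ι ℝ)
    (a b : ι) (x : ι → ℝ) : ℝ :=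
  ricci g a b x - (1 / 2) * scalarCurvature g x * g x a b

/-- The covariant derivative `D_j g_{kl}` of the symmetric tensor `g` with respect to the
Levi-Civita connection of the background metric `b`. -/
def covDeriv {ι : Type*} [Fintype ι] [DecidableEq ι] (b g : (ι → ℝ) → Matrix ι ι ℝ)
    (j k l : ι) (x : ι → ℝ) : ℝ :=
  partialD j (fun y => g y k l) x
    - ∑ m, christoffel b m j k x * g x m l - ∑ m, christoffel b m j l x * g x k m

/-- The gravitational energy flux density of a Riemannian metric `g` relative to a static background
with spatial metric `b` and lapse `V` (Abbott-Deser, Henneaux-Teitelboim, Chrusciel-Herzlich):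
`U^i = √det g · [ V (g^{ik} g^{jl} - g^{ij} g^{kl}) D_j g_{kl}
  + (∇^i V g^{jk} - ∇^j V g^{ik}) (g_{jk} - b_{jk}) ]`,
where `D` is the connection of `b` and indices are raised with `g`.
For a flat background and `V = 1` it is the integrand of the ADM energy. -/
def energyDensity {ι : Type*} [Fintype ι] [DecidableEq ι] (b g : (ι → ℝ) → Matrix ι ι ℝ)
    (V : (ι → ℝ) → ℝ) (i : ι) (x : ι → ℝ) : ℝ :=
  √(g x).det *
    (V x * (∑ j, ∑ k, ∑ l, ((g x)⁻¹ i k * (g x)⁻¹ j l - (g x)⁻¹ i j * (g x)⁻¹ k l)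
        * covDeriv b g j k l x)
      + ∑ j, ∑ k, ((∑ m, (g x)⁻¹ i m * partialD m V x) * (g x)⁻¹ j k
          - (∑ m, (g x)⁻¹ j m * partialD m V x) * (g x)⁻¹ i k) * (g x j k - b x j k))

/-! ### The orbits: unit sphere, Euclidean space, hyperbolic space

In conformally flat coordinates the metric of constant curvature `k` on the `n`-dimensional orbit is
`δ_{ij} / (1 + k |z|² / 4)²`: the stereographic chart of the unit sphere (which misses
one point) for `k = 1`, Euclidean space for `k = 0`, the Poincaré ball for `k = -1`. -/

/-- The conformal factor `1 + k |z|² / 4`. -/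
def fiberFactor (k : ℝ) {n : ℕ} (z : Fin n → ℝ) : ℝ := 1 + k / 4 * ∑ i, z i ^ 2

/-- The coordinate domain of the orbit. -/
def fiberDomain (k : ℝ) (n : ℕ) : Set (Fin n → ℝ) := {z | 0 < fiberFactor k z}

/-- The metric of constant curvature `k`, in conformally flat coordinates. -/
def fiberMetric (k : ℝ) {n : ℕ} (z : Fin n → ℝ) : Matrix (Fin n) (Fin n) ℝ :=
  (fiberFactor k z ^ 2)⁻¹ • (1 : Matrix (Fin n) (Fin n) ℝ)

/-- The volume density of the metric of constant curvature `k`. -/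
def fiberDensity (k : ℝ) {n : ℕ} (z : Fin n → ℝ) : ℝ := √(fiberMetric k z).det

/-- The volume of a part `D` of the sphere, plane or hyperbolic space. -/
def fiberVolume (k : ℝ) {n : ℕ} (D : Set (Fin n → ℝ)) : ℝ := ∫ z in D, fiberDensity k z

/-! ### Symmetric spacetimes -/

/-- The coordinate vector `∂_i` of the chart `e` of a surface, at the point with coordinates `y`. -/
def coordVec {Q : Type*} [TopologicalSpace Q] [ChartedSpace (Fin 2 → ℝ) Q]
    (e : OpenPartialHomeomorph Q (Fin 2 → ℝ)) (y : Fin 2 → ℝ) (i : Fin 2) :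
    TangentSpace 𝓘(ℝ, Fin 2 → ℝ) (e.symm y) :=
  mfderiv 𝓘(ℝ, Fin 2 → ℝ) 𝓘(ℝ, Fin 2 → ℝ) e.symm y (Pi.single i (1 : ℝ) : Fin 2 → ℝ)

/-- A time-oriented spacetime of dimension `d + 1` with spherical (`k = 1`), planar (`k = 0`) or
hyperbolic (`k = -1`) symmetry, `ds² = h + r² dΩ_k²`: a Lorentzian metric `h` and a positive
function `r`, the areal radius, on the two-dimensional space `Q` of orbits. -/
structure SymmetricSpacetime (d : ℕ) (k : ℝ) (Q : Type*) [TopologicalSpace Q]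
    [ChartedSpace (Fin 2 → ℝ) Q] where
  /-- the metric on the space of orbits -/
  h : ∀ q : Q, TangentSpace 𝓘(ℝ, Fin 2 → ℝ) q →ₗ[ℝ] TangentSpace 𝓘(ℝ, Fin 2 → ℝ) q →ₗ[ℝ] ℝ
  h_symm : ∀ q u v, h q u v = h q v u
  /-- together with `future_timelike`: signature `(-, +)` -/
  exists_spacelike : ∀ q, ∃ u, 0 < h q u u
  h_smooth : ∀ e ∈ IsManifold.maximalAtlas 𝓘(ℝ, Fin 2 → ℝ) ∞ Q, ∀ i j,
    ContDiffOn ℝ ∞ (fun y => h (e.symm y) (coordVec e y i) (coordVec e y j)) e.target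
  /-- the areal radius -/
  r : Q → ℝ
  r_pos : ∀ q, 0 < r q
  r_smooth : ContMDiff 𝓘(ℝ, Fin 2 → ℝ) 𝓘(ℝ, ℝ) ∞ r
  /-- a vector field that defines the time orientation -/
  future : ∀ q : Q, TangentSpace 𝓘(ℝ, Fin 2 → ℝ) q
  future_timelike : ∀ q, h q (future q) (future q) < 0
  /-- continuity of the vector field, through its covariant components -/
  future_continuous : ∀ e ∈ IsManifold.maximalAtlas 𝓘(ℝ, Fin 2 → ℝ) ∞ Q, ∀ i,
    ContinuousOn (fun y => h (e.symm y) (future (e.symm y)) (coordVec e y i)) e.target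

/-- The tangent space of the spacetime at a point of the orbit `q`. -/
abbrev SpacetimeVec {Q : Type*} [TopologicalSpace Q] [ChartedSpace (Fin 2 → ℝ) Q]
    (d : ℕ) (q : Q) : Type :=
  TangentSpace 𝓘(ℝ, Fin 2 → ℝ) q × (Fin (d - 1) → ℝ)

namespace SymmetricSpacetime

/-- The spacetime metric `h + r² dΩ_k²` at the point `z` of the orbit `q`. -/
def metric {d : ℕ} {k : ℝ} {Q : Type*} [TopologicalSpace Q] [ChartedSpace (Fin 2 → ℝ) Q]
    (S : SymmetricSpacetime d k Q) (q : Q) (z : Fin (d - 1) → ℝ) (u v : SpacetimeVec d q) : ℝ :=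
  S.h q u.1 v.1 + S.r q ^ 2 * ∑ i, ∑ j, fiberMetric k z i j * u.2 i * v.2 j

/-- The coordinate frame of the spacetime, for the coordinates `y` in the chart `e` of the space of
orbits and the conformally flat coordinates on the orbit. -/
def frame {Q : Type*} [TopologicalSpace Q] [ChartedSpace (Fin 2 → ℝ) Q] (d : ℕ)
    (e : OpenPartialHomeomorph Q (Fin 2 → ℝ)) (y : Fin 2 → ℝ) :
    Fin 2 ⊕ Fin (d - 1) → SpacetimeVec d (e.symm y) :=
  Sum.elim (fun i => (coordVec e y i, 0)) (fun i => (0, Pi.single i 1))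

/-- The components of the spacetime metric in these coordinates. -/
def metricCoord {d : ℕ} {k : ℝ} {Q : Type*} [TopologicalSpace Q] [ChartedSpace (Fin 2 → ℝ) Q]
    (S : SymmetricSpacetime d k Q) (e : OpenPartialHomeomorph Q (Fin 2 → ℝ))
    (x : Fin 2 ⊕ Fin (d - 1) → ℝ) : Matrix (Fin 2 ⊕ Fin (d - 1)) (Fin 2 ⊕ Fin (d - 1)) ℝ :=
  fun a b => S.metric (e.symm fun i => x (Sum.inl i)) (fun i => x (Sum.inr i))
    (frame d e (fun i => x (Sum.inl i)) a) (frame d e (fun i => x (Sum.inl i)) b)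

/-- The Einstein equations `G_{ab} - d (d - 1) / (2 L²) g_{ab} = 8 π G_N T_{ab}`. -/
def EinsteinEquations {d : ℕ} {k : ℝ} {Q : Type*} [TopologicalSpace Q]
    [ChartedSpace (Fin 2 → ℝ) Q] (S : SymmetricSpacetime d k Q) (L G : ℝ)
    (T : ∀ q : Q, (Fin (d - 1) → ℝ) → SpacetimeVec d q →ₗ[ℝ] SpacetimeVec d q →ₗ[ℝ] ℝ) : Prop :=
  ∀ e ∈ IsManifold.maximalAtlas 𝓘(ℝ, Fin 2 → ℝ) ∞ Q, ∀ y ∈ e.target,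
    ∀ z ∈ fiberDomain k (d - 1), ∀ a b,
      einstein (S.metricCoord e) a b (Sum.elim y z)
          - (d : ℝ) * ((d : ℝ) - 1) / (2 * L ^ 2) * S.metricCoord e (Sum.elim y z) a b
        = 8 * Real.pi * G * T (e.symm y) z (frame d e y a) (frame d e y b)

/-- The dominant energy condition: `T_{ab} u^a v^b ≥ 0` for all timelike `u`, `v` in the same
half of the light cone (that is, with `g(u, v) < 0`). -/
def DominantEnergyCondition {d : ℕ} {k : ℝ} {Q : Type*} [TopologicalSpace Q]
    [ChartedSpace (Fin 2 → ℝ) Q] (S : SymmetricSpacetime d k Q)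
    (T : ∀ q : Q, (Fin (d - 1) → ℝ) → SpacetimeVec d q →ₗ[ℝ] SpacetimeVec d q →ₗ[ℝ] ℝ) : Prop :=
  ∀ q : Q, ∀ z ∈ fiberDomain k (d - 1), ∀ u v : SpacetimeVec d q,
    S.metric q z u u < 0 → S.metric q z v v < 0 → S.metric q z u v < 0 → 0 ≤ T q z u v

/-- The area of the part `D` of the orbit `q`, from the induced metric. -/
def area {d : ℕ} {k : ℝ} {Q : Type*} [TopologicalSpace Q] [ChartedSpace (Fin 2 → ℝ) Q]
    (S : SymmetricSpacetime d k Q) (q : Q) (D : Set (Fin (d - 1) → ℝ)) : ℝ :=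
  ∫ z in D, √(Matrix.of fun i j : Fin (d - 1) =>
    S.metric q z (0, Pi.single i 1) (0, Pi.single j 1)).det

/-! ### Marginally trapped orbits -/

/-- The derivative `l(r)` of the areal radius along the vector `l`. -/
def radiusDeriv {d : ℕ} {k : ℝ} {Q : Type*} [TopologicalSpace Q] [ChartedSpace (Fin 2 → ℝ) Q]
    (S : SymmetricSpacetime d k Q) (q : Q) (l : TangentSpace 𝓘(ℝ, Fin 2 → ℝ) q) : ℝ :=
  mfderiv 𝓘(ℝ, Fin 2 → ℝ) 𝓘(ℝ, ℝ) S.r q l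

/-- The expansion `(d - 1) l(r) / r` of the orbit `q` along the null vector `l`: the
logarithmic derivative of its area element `r ^ (d - 1)`. -/
def expansion {d : ℕ} {k : ℝ} {Q : Type*} [TopologicalSpace Q] [ChartedSpace (Fin 2 → ℝ) Q]
    (S : SymmetricSpacetime d k Q) (q : Q) (l : TangentSpace 𝓘(ℝ, Fin 2 → ℝ) q) : ℝ :=
  ((d : ℝ) - 1) * S.radiusDeriv q l / S.r q

/-- The orbit `q` is marginally trapped towards the time direction of the timelike vector `τ`: the
null expansion vanishes on the outer side and is nonpositive on the inner side. The spacelike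
vector `w` points to the outer side. -/
def IsMarginallyTrappedTowards {d : ℕ} {k : ℝ} {Q : Type*} [TopologicalSpace Q]
    [ChartedSpace (Fin 2 → ℝ) Q] (S : SymmetricSpacetime d k Q) (q : Q)
    (τ w : TangentSpace 𝓘(ℝ, Fin 2 → ℝ) q) : Prop :=
  ∀ l : TangentSpace 𝓘(ℝ, Fin 2 → ℝ) q, S.h q l l = 0 → S.h q l τ < 0 →
    (0 < S.h q l w → S.expansion q l = 0) ∧ (S.h q l w < 0 → S.expansion q l ≤ 0)

/-- Marginally trapped: outwards future null expansion zero, inwards one nonpositive. -/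
def IsMarginallyTrapped {d : ℕ} {k : ℝ} {Q : Type*} [TopologicalSpace Q]
    [ChartedSpace (Fin 2 → ℝ) Q] (S : SymmetricSpacetime d k Q) (q : Q)
    (w : TangentSpace 𝓘(ℝ, Fin 2 → ℝ) q) : Prop :=
  S.IsMarginallyTrappedTowards q (S.future q) w

/-- The time reverse of the notion of a marginally trapped orbit. -/
def IsPastMarginallyTrapped {d : ℕ} {k : ℝ} {Q : Type*} [TopologicalSpace Q]
    [ChartedSpace (Fin 2 → ℝ) Q] (S : SymmetricSpacetime d k Q) (q : Q)
    (w : TangentSpace 𝓘(ℝ, Fin 2 → ℝ) q) : Prop :=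
  S.IsMarginallyTrappedTowards q (-S.future q) w

/-! ### Asymptotically anti-de Sitter ends -/

/-- The component `h_{ij}` in the chart `e`, as a function of the coordinates `p = (t, ρ)`. -/
def hCoord {d : ℕ} {k : ℝ} {Q : Type*} [TopologicalSpace Q] [ChartedSpace (Fin 2 → ℝ) Q]
    (S : SymmetricSpacetime d k Q) (e : OpenPartialHomeomorph Q (Fin 2 → ℝ)) (i j : Fin 2)
    (p : ℝ × ℝ) : ℝ :=
  S.h (e.symm ![p.1, p.2]) (coordVec e ![p.1, p.2] i) (coordVec e ![p.1, p.2] j)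

/-- The difference between `r²` and its background value `ρ²`, in the coordinates `(t, ρ)`. -/
def radiusDefect {d : ℕ} {k : ℝ} {Q : Type*} [TopologicalSpace Q] [ChartedSpace (Fin 2 → ℝ) Q]
    (S : SymmetricSpacetime d k Q) (e : OpenPartialHomeomorph Q (Fin 2 → ℝ)) (t ρ : ℝ) : ℝ :=
  S.r (e.symm ![t, ρ]) ^ 2 - ρ ^ 2

/-- A connected component `times × (orbit)` of the conformal boundary at which the spacetime is
asymptotically AdS: a collar with coordinates `(t, ρ)`, `ρ → ∞` at the boundary, in which the metric
approaches the AdS metric `-(k + ρ²/L²) dt² + dρ² / (k + ρ²/L²) + ρ² dΩ_k²` at the rates of the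
Henneaux-Teitelboim (for `d = 2`, Brown-Henneaux) boundary conditions, locally uniformly in `t`. -/
structure AdSBoundary {d : ℕ} {k : ℝ} {Q : Type*} [TopologicalSpace Q]
    [ChartedSpace (Fin 2 → ℝ) Q] (S : SymmetricSpacetime d k Q) (L : ℝ) where
  /-- the chart with coordinates `(t, ρ)` -/
  chart : OpenPartialHomeomorph Q (Fin 2 → ℝ)
  chart_mem : chart ∈ IsManifold.maximalAtlas 𝓘(ℝ, Fin 2 → ℝ) ∞ Q
  /-- the interval of boundary times -/
  times : Set ℝ
  times_open : IsOpen times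
  times_ordConnected : times.OrdConnected
  times_nonempty : times.Nonempty
  /-- the inner end of the collar -/
  rho₀ : ℝ
  collar : ∀ t ∈ times, ∀ ρ, rho₀ < ρ → ![t, ρ] ∈ chart.target
  decay_tt : ∀ t₀ ∈ times,
    (fun p : ℝ × ℝ => S.hCoord chart 0 0 p + (k + p.2 ^ 2 / L ^ 2))
      =O[𝓝 t₀ ×ˢ atTop] fun p => p.2 ^ (2 - (d : ℤ))
  decay_tρ : ∀ t₀ ∈ times,
    (fun p : ℝ × ℝ => S.hCoord chart 0 1 p) =O[𝓝 t₀ ×ˢ atTop] fun p => p.2 ^ (-1 - (d : ℤ))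
  decay_ρρ : ∀ t₀ ∈ times,
    (fun p : ℝ × ℝ => S.hCoord chart 1 1 p - (k + p.2 ^ 2 / L ^ 2)⁻¹)
      =O[𝓝 t₀ ×ˢ atTop] fun p => p.2 ^ (-2 - (d : ℤ))
  decay_r : ∀ t₀ ∈ times,
    (fun p : ℝ × ℝ => S.radiusDefect chart p.1 p.2)
      =O[𝓝 t₀ ×ˢ atTop] fun p => p.2 ^ (2 - (d : ℤ))
  decay_dt_r : ∀ t₀ ∈ times,
    (fun p : ℝ × ℝ => deriv (fun t => S.radiusDefect chart t p.2) p.1)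
      =O[𝓝 t₀ ×ˢ atTop] fun p => p.2 ^ (2 - (d : ℤ))
  decay_dρ_r : ∀ t₀ ∈ times,
    (fun p : ℝ × ℝ => deriv (fun ρ => S.radiusDefect chart p.1 ρ) p.2)
      =O[𝓝 t₀ ×ˢ atTop] fun p => p.2 ^ (1 - (d : ℤ))

/-- The Riemannian metric induced on the hypersurface of constant first coordinate `t`, in the
coordinates `(ρ, z)`. -/
def sliceMetric {d : ℕ} {k : ℝ} {Q : Type*} [TopologicalSpace Q] [ChartedSpace (Fin 2 → ℝ) Q]
    (S : SymmetricSpacetime d k Q) (e : OpenPartialHomeomorph Q (Fin 2 → ℝ)) (t : ℝ)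
    (x : Unit ⊕ Fin (d - 1) → ℝ) : Matrix (Unit ⊕ Fin (d - 1)) (Unit ⊕ Fin (d - 1)) ℝ :=
  (S.metricCoord e (Sum.elim ![t, x (Sum.inl ())] fun i => x (Sum.inr i))).submatrix
    (Sum.map (fun _ => 1) id) (Sum.map (fun _ => 1) id)

end SymmetricSpacetime

/-- The lapse `√(k + ρ²/L²)` of AdS in the coordinates `(ρ, z)`. -/
def adsLapse (k L : ℝ) {n : ℕ} (x : Unit ⊕ Fin n → ℝ) : ℝ := √(k + x (Sum.inl ()) ^ 2 / L ^ 2)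

/-- The spatial metric `dρ² / (k + ρ²/L²) + ρ² dΩ_k²` of AdS in the coordinates `(ρ, z)`. -/
def adsSliceMetric (k L : ℝ) {n : ℕ} (x : Unit ⊕ Fin n → ℝ) :
    Matrix (Unit ⊕ Fin n) (Unit ⊕ Fin n) ℝ :=
  Matrix.fromBlocks (Matrix.of fun _ _ => (k + x (Sum.inl ()) ^ 2 / L ^ 2)⁻¹) 0 0
    (x (Sum.inl ()) ^ 2 • fiberMetric k fun i => x (Sum.inr i))

namespace SymmetricSpacetime

namespace AdSBoundary

/-- `M` is the mass (over the part `D` of the orbits) at the cut `t₀` of the boundary component: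
the Hamiltonian surface charge conjugate to `∂_t`, normalized to vanish for pure AdS,
`M = (16 π G_N)⁻¹ lim ∫_D U^ρ dz`. In particular, the mass is finite. -/
def HasMassAt {d : ℕ} {k : ℝ} {Q : Type*} [TopologicalSpace Q] [ChartedSpace (Fin 2 → ℝ) Q]
    {S : SymmetricSpacetime d k Q} {L : ℝ} (B : S.AdSBoundary L) (G : ℝ)
    (D : Set (Fin (d - 1) → ℝ)) (t₀ M : ℝ) : Prop :=
  Tendsto
    (fun p : ℝ × ℝ => (16 * Real.pi * G)⁻¹ *
      ∫ z in D, energyDensity (adsSliceMetric k L) (S.sliceMetric B.chart p.1) (adsLapse k L)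
        (Sum.inl ()) (Sum.elim (fun _ => p.2) z))
    (𝓝 t₀ ×ˢ atTop) (𝓝 M)

end AdSBoundary

/-- The outward tangent vector of the curve `γ : [0, ∞) → Q` at the parameter `s`. -/
def velocity {Q : Type*} [TopologicalSpace Q] [ChartedSpace (Fin 2 → ℝ) Q] (γ : ℝ → Q) (s : ℝ) :
    TangentSpace 𝓘(ℝ, Fin 2 → ℝ) (γ s) :=
  mfderivWithin 𝓘(ℝ, ℝ) 𝓘(ℝ, Fin 2 → ℝ) γ (Ici 0) s (1 : ℝ)

/-- The curve `γ : [0, ∞) → Q` is (the projection of) a symmetric spacelike hypersurface that runs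
from the orbit `σ` to the cut `t₀` of the boundary component `B`. -/
structure IsSpacelikeSlice {d : ℕ} {k : ℝ} {Q : Type*} [TopologicalSpace Q]
    [ChartedSpace (Fin 2 → ℝ) Q] (S : SymmetricSpacetime d k Q) {L : ℝ} (B : S.AdSBoundary L)
    (σ : Q) (t₀ : ℝ) (γ : ℝ → Q) : Prop where
  contMDiffOn : ContMDiffOn 𝓘(ℝ, ℝ) 𝓘(ℝ, Fin 2 → ℝ) 1 γ (Ici 0)
  starts : γ 0 = σ
  spacelike : ∀ s, 0 ≤ s → 0 < S.h (γ s) (velocity γ s) (velocity γ s)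
  eventually_mem : ∀ᶠ s in atTop, γ s ∈ B.chart.source
  tendsto_time : Tendsto (fun s => B.chart (γ s) 0) atTop (𝓝 t₀)
  tendsto_rho : Tendsto (fun s => B.chart (γ s) 1) atTop atTop

/-- The orbit `σ` is an outermost marginally trapped surface with respect to the boundary component
`B`: it is marginally trapped, and on some symmetric spacelike hypersurface from `σ` to the cut `t₀`
of `B` no orbit outside `σ` is marginally trapped, to the future or to the past. -/
def IsOutermostMarginallyTrapped {d : ℕ} {k : ℝ} {Q : Type*} [TopologicalSpace Q]
    [ChartedSpace (Fin 2 → ℝ) Q] (S : SymmetricSpacetime d k Q) {L : ℝ} (B : S.AdSBoundary L)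
    (σ : Q) (t₀ : ℝ) : Prop :=
  ∃ γ : ℝ → Q, S.IsSpacelikeSlice B σ t₀ γ ∧
    S.IsMarginallyTrapped (γ 0) (velocity γ 0) ∧
    ∀ s, 0 < s → ¬ S.IsMarginallyTrapped (γ s) (velocity γ s) ∧
      ¬ S.IsPastMarginallyTrapped (γ s) (velocity γ s)

end SymmetricSpacetime

end

noncomputable section

/-! ### Partial derivatives -/

/-! The argument rests on the Misner-Sharp mass `r^(d-2) (k + r²/L² - |∇r|²)` of an orbit,
renormalized by the cosmological constant (`misnerSharp` in coordinates, `orbitMass` on the orbit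
space). Its value at `σ` is the right-hand side of the inequality, its limit at the cut is the
left-hand side, and in between it does not decrease. From here on `d = p + 2`.

Value at `σ`. In a null frame `l`, `m`, the norm `|∇r|²` is a negative multiple of `l(r) m(r)`. It
vanishes when the outward expansion does, so the mass is `k r^(d-2) + r^d/L²`, while the area is
`Ω_k r^(d-1)`.

Monotonicity (`misnerSharp_deriv_nonneg`). The base components of the Einstein tensor of a warped
product involve only `r`, `|∇r|²` and the Hessian of `r`: the curvature of the two-dimensional base
drops out, because its Ricci tensor is pure trace (`einstein_warpedMetric_base`). Hence the `ll`,
`mm` and `lm` components of the matter tensor, nonnegative by the energy condition, control the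
derivative of the mass. Where `l(r) ≥ 0 ≥ m(r)`, that derivative along `l - m` is a sum of
nonnegative products. By symmetry the field equations are needed only at the origin of the fibre
coordinates.

The signs persist along the slice (`orbitMass_le_of_tendsto`). Near the boundary `|∇r|² > 0` and `r`
increases outwards. If this failed further inside, there would be a last failure. The outward
derivative of `r` cannot vanish while `|∇r|² > 0`, since the slice is spacelike; and `|∇r|² = 0`
with `r` nondecreasing outwards makes the orbit future or past marginally trapped
(`isMarginallyTrapped_or_of_gradSq_eq_zero`), which is excluded outside `σ`.

Limit at the boundary (`tendsto_mass_sub_energy`). The surface charge and the Misner-Sharp mass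
agree to first order in the deviation from AdS. The first-order terms stay bounded without having to
tend to zero, the remainder is quadratic, and the decay rates send it to zero. The mass has a joint
limit in `(t, ρ)`, so it can be read off along a slice that is not a level set of `t`. -/

theorem HasFDerivAt.partialD_eq {ι : Type*} [Fintype ι] [DecidableEq ι] {f : (ι → ℝ) → ℝ}
    {f' : (ι → ℝ) →L[ℝ] ℝ} {x : ι → ℝ} (h : HasFDerivAt f f' x) (i : ι) :
    partialD i f x = f' (Pi.single i 1) := by
  rw [partialD, h.fderiv]

theorem partialD_congr {ι : Type*} [Fintype ι] [DecidableEq ι] {f g : (ι → ℝ) → ℝ} {x : ι → ℝ}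
    (h : f =ᶠ[𝓝 x] g) (i : ι) : partialD i f x = partialD i g x := by
  rw [partialD, partialD, h.fderiv_eq]

@[simp]
theorem partialD_const {ι : Type*} [Fintype ι] [DecidableEq ι] (i : ι) (c : ℝ) (x : ι → ℝ) :
    partialD i (fun _ => c) x = 0 := by
  simp [partialD]

theorem partialD_mul {ι : Type*} [Fintype ι] [DecidableEq ι] {f g : (ι → ℝ) → ℝ} {x : ι → ℝ}
    (hf : DifferentiableAt ℝ f x) (hg : DifferentiableAt ℝ g x) (i : ι) :
    partialD i (fun y => f y * g y) x = partialD i f x * g x + f x * partialD i g x := by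
  rw [(hf.hasFDerivAt.fun_mul hg.hasFDerivAt).partialD_eq]
  simp only [partialD, add_apply, smul_apply, smul_eq_mul]
  ring

theorem partialD_add {ι : Type*} [Fintype ι] [DecidableEq ι] {f g : (ι → ℝ) → ℝ} {x : ι → ℝ}
    (hf : DifferentiableAt ℝ f x) (hg : DifferentiableAt ℝ g x) (i : ι) :
    partialD i (fun y => f y + g y) x = partialD i f x + partialD i g x := by
  rw [(hf.hasFDerivAt.fun_add hg.hasFDerivAt).partialD_eq]
  simp [partialD]

theorem partialD_sub {ι : Type*} [Fintype ι] [DecidableEq ι] {f g : (ι → ℝ) → ℝ} {x : ι → ℝ}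
    (hf : DifferentiableAt ℝ f x) (hg : DifferentiableAt ℝ g x) (i : ι) :
    partialD i (fun y => f y - g y) x = partialD i f x - partialD i g x := by
  rw [(hf.hasFDerivAt.fun_sub hg.hasFDerivAt).partialD_eq]
  simp [partialD]

theorem partialD_sum {ι κ : Type*} [Fintype ι] [DecidableEq ι] {s : Finset κ}
    {f : κ → (ι → ℝ) → ℝ} {x : ι → ℝ} (hf : ∀ j ∈ s, DifferentiableAt ℝ (f j) x) (i : ι) :
    partialD i (fun y => ∑ j ∈ s, f j y) x = ∑ j ∈ s, partialD i (f j) x := by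
  rw [(HasFDerivAt.fun_sum fun j hj => (hf j hj).hasFDerivAt).partialD_eq]
  simp [partialD]

theorem partialD_const_mul {ι : Type*} [Fintype ι] [DecidableEq ι] {f : (ι → ℝ) → ℝ} {x : ι → ℝ}
    (hf : DifferentiableAt ℝ f x) (c : ℝ) (i : ι) :
    partialD i (fun y => c * f y) x = c * partialD i f x := by
  rw [partialD_mul (by fun_prop) hf]
  simp

theorem partialD_comp_deriv {ι : Type*} [Fintype ι] [DecidableEq ι] {f : (ι → ℝ) → ℝ} {x : ι → ℝ}
    {φ : ℝ → ℝ} {φ' : ℝ} (hφ : HasDerivAt φ φ' (f x)) (hf : DifferentiableAt ℝ f x) (i : ι) :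
    partialD i (fun y => φ (f y)) x = φ' * partialD i f x := by
  have h : HasFDerivAt (fun y => φ (f y)) (φ' • fderiv ℝ f x) x :=
    hφ.comp_hasFDerivAt x hf.hasFDerivAt
  rw [h.partialD_eq]
  simp [partialD]

/-- The restriction of a function on a disjoint union to the first part. -/
def projLeft (ι κ : Type*) [Fintype ι] [Fintype κ] : (ι ⊕ κ → ℝ) →L[ℝ] (ι → ℝ) :=
  ContinuousLinearMap.pi fun i => ContinuousLinearMap.proj (Sum.inl i)

/-- The restriction of a function on a disjoint union to the second part. -/
def projRight (ι κ : Type*) [Fintype ι] [Fintype κ] : (ι ⊕ κ → ℝ) →L[ℝ] (κ → ℝ) :=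
  ContinuousLinearMap.pi fun i => ContinuousLinearMap.proj (Sum.inr i)

/-- Every component of a warped product metric, and every Christoffel symbol of it that gets
differentiated, is a product of a base function and a fibre function or a sum of such; this covers
all derivatives that are needed. -/
theorem hasFDerivAt_left_mul_right {ι κ : Type*} [Fintype ι] [Fintype κ]
    {F : (ι → ℝ) → ℝ} {φ : (κ → ℝ) → ℝ} {y : ι → ℝ} {z : κ → ℝ}
    (hF : DifferentiableAt ℝ F y) (hφ : DifferentiableAt ℝ φ z) :
    HasFDerivAt
      (fun x : ι ⊕ κ → ℝ => F (fun i => x (Sum.inl i)) * φ (fun i => x (Sum.inr i)))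
      (F y • (fderiv ℝ φ z).comp (projRight ι κ) + φ z • (fderiv ℝ F y).comp (projLeft ι κ))
      (Sum.elim y z) := by
  have h1 : HasFDerivAt (fun x : ι ⊕ κ → ℝ => F (projLeft ι κ x))
      ((fderiv ℝ F y).comp (projLeft ι κ)) (Sum.elim y z) :=
    HasFDerivAt.comp (Sum.elim y z) (f := projLeft ι κ) (g := F) hF.hasFDerivAt
      (projLeft ι κ).hasFDerivAt
  have h2 : HasFDerivAt (fun x : ι ⊕ κ → ℝ => φ (projRight ι κ x))
      ((fderiv ℝ φ z).comp (projRight ι κ)) (Sum.elim y z) :=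
    HasFDerivAt.comp (Sum.elim y z) (f := projRight ι κ) (g := φ) hφ.hasFDerivAt
      (projRight ι κ).hasFDerivAt
  exact h1.mul h2

section Warped

variable {ι κ : Type*} [Fintype ι] [DecidableEq ι] [Fintype κ] [DecidableEq κ]

theorem projLeft_single_inl (a : ι) :
    projLeft ι κ (Pi.single (Sum.inl a) 1) = Pi.single a 1 := by
  ext i
  simp [projLeft, Pi.single_apply]

theorem projLeft_single_inr (a : κ) : projLeft ι κ (Pi.single (Sum.inr a) 1) = 0 := by
  ext i
  simp [projLeft]

theorem projRight_single_inr (a : κ) :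
    projRight ι κ (Pi.single (Sum.inr a) 1) = Pi.single a 1 := by
  ext i
  simp [projRight, Pi.single_apply]

theorem projRight_single_inl (a : ι) : projRight ι κ (Pi.single (Sum.inl a) 1) = 0 := by
  ext i
  simp [projRight]

theorem partialD_inl_left_mul_right {F : (ι → ℝ) → ℝ} {φ : (κ → ℝ) → ℝ} {y : ι → ℝ} {z : κ → ℝ}
    (hF : DifferentiableAt ℝ F y) (hφ : DifferentiableAt ℝ φ z) (a : ι) :
    partialD (Sum.inl a)
      (fun x : ι ⊕ κ → ℝ => F (fun i => x (Sum.inl i)) * φ (fun i => x (Sum.inr i)))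
      (Sum.elim y z) = partialD a F y * φ z := by
  rw [(hasFDerivAt_left_mul_right hF hφ).partialD_eq]
  simp [projLeft_single_inl, projRight_single_inl, partialD, mul_comm]

theorem partialD_inr_left_mul_right {F : (ι → ℝ) → ℝ} {φ : (κ → ℝ) → ℝ} {y : ι → ℝ} {z : κ → ℝ}
    (hF : DifferentiableAt ℝ F y) (hφ : DifferentiableAt ℝ φ z) (a : κ) :
    partialD (Sum.inr a)
      (fun x : ι ⊕ κ → ℝ => F (fun i => x (Sum.inl i)) * φ (fun i => x (Sum.inr i)))
      (Sum.elim y z) = F y * partialD a φ z := by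
  rw [(hasFDerivAt_left_mul_right hF hφ).partialD_eq]
  simp [projLeft_single_inr, projRight_single_inr, partialD]

theorem partialD_inl_left {F : (ι → ℝ) → ℝ} {y : ι → ℝ} (z : κ → ℝ)
    (hF : DifferentiableAt ℝ F y) (a : ι) :
    partialD (Sum.inl a) (fun x : ι ⊕ κ → ℝ => F (fun i => x (Sum.inl i)))
      (Sum.elim y z) = partialD a F y := by
  simpa using partialD_inl_left_mul_right (φ := fun _ => 1) (z := z) hF (by fun_prop) a

theorem partialD_inr_left {F : (ι → ℝ) → ℝ} {y : ι → ℝ} (z : κ → ℝ)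
    (hF : DifferentiableAt ℝ F y) (a : κ) :
    partialD (Sum.inr a) (fun x : ι ⊕ κ → ℝ => F (fun i => x (Sum.inl i)))
      (Sum.elim y z) = 0 := by
  simpa using partialD_inr_left_mul_right (φ := fun _ => 1) (z := z) hF (by fun_prop) a

theorem partialD_inl_right {φ : (κ → ℝ) → ℝ} (y : ι → ℝ) {z : κ → ℝ}
    (hφ : DifferentiableAt ℝ φ z) (a : ι) :
    partialD (Sum.inl a) (fun x : ι ⊕ κ → ℝ => φ (fun i => x (Sum.inr i)))
      (Sum.elim y z) = 0 := by
  simpa using partialD_inl_left_mul_right (F := fun _ => 1) (y := y) (by fun_prop) hφ a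

theorem partialD_inr_right {φ : (κ → ℝ) → ℝ} (y : ι → ℝ) {z : κ → ℝ}
    (hφ : DifferentiableAt ℝ φ z) (a : κ) :
    partialD (Sum.inr a) (fun x : ι ⊕ κ → ℝ => φ (fun i => x (Sum.inr i)))
      (Sum.elim y z) = partialD a φ z := by
  simpa using partialD_inr_left_mul_right (F := fun _ => 1) (y := y) (by fun_prop) hφ a

end Warped

/-! ### Conformally flat coordinates of constant curvature -/

theorem fiberFactor_hasFDerivAt (k : ℝ) {n : ℕ} (z : Fin n → ℝ) :
    HasFDerivAt (fiberFactor k (n := n))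
      ((k / 4) • ∑ i, (2 * z i) • ContinuousLinearMap.proj (R := ℝ) (φ := fun _ : Fin n => ℝ) i)
      z := by
  unfold fiberFactor
  refine HasFDerivAt.const_add _ (HasFDerivAt.const_mul (HasFDerivAt.fun_sum fun i _ => ?_) _)
  have := (hasFDerivAt_apply (𝕜 := ℝ) i z).pow 2
  simpa using this

theorem partialD_fiberFactor (k : ℝ) {n : ℕ} (z : Fin n → ℝ) (l : Fin n) :
    partialD l (fiberFactor k) z = k / 2 * z l := by
  rw [(fiberFactor_hasFDerivAt k z).partialD_eq]
  simp [Pi.single_apply]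
  ring

theorem fiberFactor_differentiableAt (k : ℝ) {n : ℕ} (z : Fin n → ℝ) :
    DifferentiableAt ℝ (fiberFactor k (n := n)) z :=
  (fiberFactor_hasFDerivAt k z).differentiableAt

@[simp]
theorem fiberFactor_zero (k : ℝ) {n : ℕ} : fiberFactor k (0 : Fin n → ℝ) = 1 := by
  simp [fiberFactor]

theorem zero_mem_fiberDomain (k : ℝ) (n : ℕ) : (0 : Fin n → ℝ) ∈ fiberDomain k n := by
  simp [fiberDomain]

theorem isOpen_fiberDomain (k : ℝ) (n : ℕ) : IsOpen (fiberDomain k n) := by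
  unfold fiberDomain fiberFactor
  exact isOpen_lt continuous_const (by fun_prop)

theorem fiberMetric_apply (k : ℝ) {n : ℕ} (z : Fin n → ℝ) (i j : Fin n) :
    fiberMetric k z i j = if i = j then (fiberFactor k z ^ 2)⁻¹ else 0 := by
  simp [fiberMetric, Matrix.one_apply]

theorem conformalFactor_hasDerivAt {f : ℝ} (hf : f ≠ 0) :
    HasDerivAt (fun s : ℝ => (s ^ 2)⁻¹) (-(2 * (f ^ 3)⁻¹)) f := by
  have := (hasDerivAt_pow 2 f).fun_inv (pow_ne_zero 2 hf)
  refine this.congr_deriv ?_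
  norm_num
  field_simp

theorem conformalFactor_differentiableAt (k : ℝ) {n : ℕ} {z : Fin n → ℝ}
    (hz : z ∈ fiberDomain k n) :
    DifferentiableAt ℝ (fun z : Fin n → ℝ => (fiberFactor k z ^ 2)⁻¹) z :=
  ((fiberFactor_differentiableAt k z).pow 2).inv (pow_ne_zero 2 (ne_of_gt hz))

theorem partialD_conformalFactor (k : ℝ) {n : ℕ} {z : Fin n → ℝ} (hz : z ∈ fiberDomain k n)
    (l : Fin n) :
    partialD l (fun z : Fin n → ℝ => (fiberFactor k z ^ 2)⁻¹) z
      = -(k * z l * (fiberFactor k z ^ 3)⁻¹) := by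
  rw [partialD_comp_deriv (conformalFactor_hasDerivAt (ne_of_gt hz))
    (fiberFactor_differentiableAt k z), partialD_fiberFactor]
  ring

/-! ### Warped products -/

/-- The metric `H + R dΩ_k²`. -/
def warpedMetric {ι : Type*} (k : ℝ) {n : ℕ} (H : (ι → ℝ) → Matrix ι ι ℝ) (R : (ι → ℝ) → ℝ)
    (x : ι ⊕ Fin n → ℝ) : Matrix (ι ⊕ Fin n) (ι ⊕ Fin n) ℝ :=
  Matrix.fromBlocks (H fun i => x (Sum.inl i)) 0 0
    (R (fun i => x (Sum.inl i)) • fiberMetric k fun i => x (Sum.inr i))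

section WarpedMetric

variable {ι : Type*} [Fintype ι] [DecidableEq ι] {k : ℝ} {n : ℕ} {H : (ι → ℝ) → Matrix ι ι ℝ}
  {R : (ι → ℝ) → ℝ} {y : ι → ℝ} {z : Fin n → ℝ}


theorem warpedMetric_inv (hH : IsUnit (H y).det) (hR : R y ≠ 0) (hz : z ∈ fiberDomain k n) :
    (warpedMetric k H R (Sum.elim y z))⁻¹ = Matrix.fromBlocks (H y)⁻¹ 0 0
      ((fiberFactor k z ^ 2 / R y) • (1 : Matrix (Fin n) (Fin n) ℝ)) := by
  have hf : fiberFactor k z ≠ 0 := ne_of_gt hz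
  refine Matrix.inv_eq_right_inv ?_
  simp only [warpedMetric, Sum.elim_inl, Sum.elim_inr, Matrix.fromBlocks_multiply, fiberMetric]
  have h1 : (R y * (fiberFactor k z ^ 2)⁻¹) * (fiberFactor k z ^ 2 / R y) = 1 := by field_simp
  simp [Matrix.mul_nonsing_inv _ hH, smul_smul, ← Matrix.fromBlocks_one]
  rw [show (fiberFactor k z ^ 2 / R y * (R y * (fiberFactor k z ^ 2)⁻¹)) = 1 by linarith, one_smul]

theorem partialD_warpedMetric_base (hH : ∀ a b, DifferentiableAt ℝ (fun u => H u a b) y)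
    (e : ι ⊕ Fin n) (a b : ι) :
    partialD e (fun x => warpedMetric k H R x (Sum.inl a) (Sum.inl b)) (Sum.elim y z)
      = Sum.elim (fun c => partialD c (fun u => H u a b) y) 0 e := by
  simp only [warpedMetric, Matrix.fromBlocks_apply₁₁]
  rcases e with c | c
  · exact partialD_inl_left (F := fun u => H u a b) z (hH a b) c
  · exact partialD_inr_left (F := fun u => H u a b) z (hH a b) c

theorem partialD_warpedMetric_inl_inr (e : ι ⊕ Fin n) (a : ι) (j : Fin n) (x : ι ⊕ Fin n → ℝ) :
    partialD e (fun x => warpedMetric k H R x (Sum.inl a) (Sum.inr j)) x = 0 := by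
  simp [warpedMetric]

theorem partialD_warpedMetric_inr_inl (e : ι ⊕ Fin n) (a : ι) (j : Fin n) (x : ι ⊕ Fin n → ℝ) :
    partialD e (fun x => warpedMetric k H R x (Sum.inr j) (Sum.inl a)) x = 0 := by
  simp [warpedMetric]

theorem partialD_warpedMetric_fiber (hR : DifferentiableAt ℝ R y) (hz : z ∈ fiberDomain k n)
    (e : ι ⊕ Fin n) (i j : Fin n) :
    partialD e (fun x => warpedMetric k H R x (Sum.inr i) (Sum.inr j)) (Sum.elim y z)
      = if i = j then
          Sum.elim (fun c => partialD c R y * (fiberFactor k z ^ 2)⁻¹)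
            (fun l => -(R y * (k * z l * (fiberFactor k z ^ 3)⁻¹))) e
        else 0 := by
  simp only [warpedMetric, Matrix.fromBlocks_apply₂₂, Matrix.smul_apply, fiberMetric_apply,
    smul_eq_mul]
  split_ifs with h
  · rcases e with c | c
    · exact partialD_inl_left_mul_right (φ := fun z : Fin n → ℝ => (fiberFactor k z ^ 2)⁻¹) hR
        (conformalFactor_differentiableAt k hz) c
    · refine (partialD_inr_left_mul_right (φ := fun z : Fin n → ℝ => (fiberFactor k z ^ 2)⁻¹) hR
        (conformalFactor_differentiableAt k hz) c).trans ?_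
      rw [partialD_conformalFactor k hz]
      simp
  · simp

theorem christoffel_warpedMetric_base (hH : ∀ a b, DifferentiableAt ℝ (fun u => H u a b) y)
    (hdet : IsUnit (H y).det) (hR0 : R y ≠ 0) (hz : z ∈ fiberDomain k n) (c a b : ι) :
    christoffel (warpedMetric k H R) (Sum.inl c) (Sum.inl a) (Sum.inl b) (Sum.elim y z)
      = christoffel H c a b y := by
  simp [christoffel, warpedMetric_inv hdet hR0 hz, Fintype.sum_sum_type,
    partialD_warpedMetric_base hH]

theorem christoffel_warpedMetric_inl_inl_inr
    (hH : ∀ a b, DifferentiableAt ℝ (fun u => H u a b) y)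
    (hdet : IsUnit (H y).det) (hR0 : R y ≠ 0) (hz : z ∈ fiberDomain k n) (c a : ι) (j : Fin n) :
    christoffel (warpedMetric k H R) (Sum.inl c) (Sum.inl a) (Sum.inr j) (Sum.elim y z) = 0 := by
  simp [christoffel, warpedMetric_inv hdet hR0 hz, Fintype.sum_sum_type,
    partialD_warpedMetric_base hH, partialD_warpedMetric_inl_inr]

theorem christoffel_warpedMetric_inl_inr_inl
    (hH : ∀ a b, DifferentiableAt ℝ (fun u => H u a b) y)
    (hdet : IsUnit (H y).det) (hR0 : R y ≠ 0) (hz : z ∈ fiberDomain k n) (c a : ι) (j : Fin n) :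
    christoffel (warpedMetric k H R) (Sum.inl c) (Sum.inr j) (Sum.inl a) (Sum.elim y z) = 0 := by
  simp [christoffel, warpedMetric_inv hdet hR0 hz, Fintype.sum_sum_type,
    partialD_warpedMetric_base hH, partialD_warpedMetric_inl_inr, partialD_warpedMetric_inr_inl]

theorem christoffel_warpedMetric_inl_inr_inr (hR : DifferentiableAt ℝ R y)
    (hdet : IsUnit (H y).det) (hR0 : R y ≠ 0) (hz : z ∈ fiberDomain k n) (c : ι) (i j : Fin n) :
    christoffel (warpedMetric k H R) (Sum.inl c) (Sum.inr i) (Sum.inr j) (Sum.elim y z)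
      = if i = j then -(1 / 2 * (∑ e, (H y)⁻¹ c e * partialD e R y) * (fiberFactor k z ^ 2)⁻¹)
        else 0 := by
  simp only [christoffel, warpedMetric_inv hdet hR0 hz, Fintype.sum_sum_type,
    partialD_warpedMetric_fiber hR hz, partialD_warpedMetric_inl_inr]
  split_ifs with h
  · simp [Finset.mul_sum, Finset.sum_mul]
    exact Finset.sum_congr rfl fun e _ => by ring
  · simp

theorem christoffel_warpedMetric_inr_inl_inl
    (hdet : IsUnit (H y).det) (hR0 : R y ≠ 0) (hz : z ∈ fiberDomain k n)
    (hH : ∀ a b, DifferentiableAt ℝ (fun u => H u a b) y) (i : Fin n) (a b : ι) :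
    christoffel (warpedMetric k H R) (Sum.inr i) (Sum.inl a) (Sum.inl b) (Sum.elim y z) = 0 := by
  simp [christoffel, warpedMetric_inv hdet hR0 hz, Fintype.sum_sum_type,
    partialD_warpedMetric_base hH, partialD_warpedMetric_inr_inl]

theorem christoffel_warpedMetric_inr_inl_inr (hR : DifferentiableAt ℝ R y)
    (hdet : IsUnit (H y).det) (hR0 : R y ≠ 0) (hz : z ∈ fiberDomain k n) (a : ι) (i j : Fin n) :
    christoffel (warpedMetric k H R) (Sum.inr i) (Sum.inl a) (Sum.inr j) (Sum.elim y z)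
      = if i = j then 1 / 2 * (partialD a R y / R y) else 0 := by
  have hf : fiberFactor k z ≠ 0 := ne_of_gt hz
  simp [christoffel, warpedMetric_inv hdet hR0 hz, Fintype.sum_sum_type,
    partialD_warpedMetric_fiber hR hz, partialD_warpedMetric_inl_inr,
    partialD_warpedMetric_inr_inl, Matrix.one_apply]
  split_ifs <;> field_simp

theorem christoffel_warpedMetric_inr_inr_inl (hR : DifferentiableAt ℝ R y)
    (hdet : IsUnit (H y).det) (hR0 : R y ≠ 0) (hz : z ∈ fiberDomain k n) (a : ι) (i j : Fin n) :
    christoffel (warpedMetric k H R) (Sum.inr i) (Sum.inr j) (Sum.inl a) (Sum.elim y z)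
      = if i = j then 1 / 2 * (partialD a R y / R y) else 0 := by
  have hf : fiberFactor k z ≠ 0 := ne_of_gt hz
  simp [christoffel, warpedMetric_inv hdet hR0 hz, Fintype.sum_sum_type,
    partialD_warpedMetric_fiber hR hz, partialD_warpedMetric_inr_inl, Matrix.one_apply]
  split_ifs <;> field_simp

/-- The warping factor `R` cancels, leaving the symbols of a conformally flat metric, which come
from the logarithmic derivative of the conformal factor. They are linear in `z` up to a factor and
so vanish at the origin. -/
theorem christoffel_warpedMetric_fiber (hR : DifferentiableAt ℝ R y)
    (hdet : IsUnit (H y).det) (hR0 : R y ≠ 0) (hz : z ∈ fiberDomain k n) (i j l : Fin n) :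
    christoffel (warpedMetric k H R) (Sum.inr i) (Sum.inr j) (Sum.inr l) (Sum.elim y z)
      = -(k / 2 * (fiberFactor k z)⁻¹) * ((if i = j then z l else 0) + (if i = l then z j else 0)
        - (if j = l then z i else 0)) := by
  have hf : fiberFactor k z ≠ 0 := ne_of_gt hz
  simp [christoffel, warpedMetric_inv hdet hR0 hz, Fintype.sum_sum_type,
    partialD_warpedMetric_fiber hR hz, Matrix.one_apply]
  split_ifs <;> field_simp <;> ring

end WarpedMetric

/-! ### Two-dimensional geometry in coordinates -/

theorem ContDiffOn.partialD {ι : Type*} [Fintype ι] [DecidableEq ι] {f : (ι → ℝ) → ℝ}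
    {O : Set (ι → ℝ)} (hf : ContDiffOn ℝ ∞ f O) (hO : IsOpen O) (i : ι) :
    ContDiffOn ℝ ∞ (partialD i f) O :=
  (hf.fderiv_of_isOpen hO (by simp)).clm_apply contDiffOn_const

theorem ContDiffOn.differentiableAt_of_isOpen {ι : Type*} [Fintype ι] {f : (ι → ℝ) → ℝ}
    {O : Set (ι → ℝ)} (hf : ContDiffOn ℝ ∞ f O) (hO : IsOpen O) {u : ι → ℝ} (hu : u ∈ O) :
    DifferentiableAt ℝ f u :=
  (hf.contDiffAt (hO.mem_nhds hu)).differentiableAt (by simp)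

theorem partialD_comm {ι : Type*} [Fintype ι] [DecidableEq ι] {f : (ι → ℝ) → ℝ}
    {O : Set (ι → ℝ)} (hf : ContDiffOn ℝ ∞ f O) (hO : IsOpen O) {u : ι → ℝ} (hu : u ∈ O)
    (i j : ι) : partialD i (partialD j f) u = partialD j (partialD i f) u := by
  have hd : DifferentiableAt ℝ (fderiv ℝ f) u :=
    (((hf.fderiv_of_isOpen (m := ∞) hO (by simp)).contDiffAt (hO.mem_nhds hu)).differentiableAt
      (by simp))
  have key : ∀ i j : ι, partialD i (partialD j f) u
      = fderiv ℝ (fderiv ℝ f) u (Pi.single i 1) (Pi.single j 1) := by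
    intro i j
    have h : HasFDerivAt (fun x => fderiv ℝ f x (Pi.single j 1))
        ((fderiv ℝ (fderiv ℝ f) u).flip (Pi.single j 1)) u := by
      have := hd.hasFDerivAt.clm_apply (hasFDerivAt_const (Pi.single j (1 : ℝ) : ι → ℝ) u)
      simpa using this
    exact h.partialD_eq i
  have hsymm : IsSymmSndFDerivAt ℝ f u :=
    (hf.contDiffAt (hO.mem_nhds hu)).isSymmSndFDerivAt
      (by simpa using (WithTop.coe_le_coe.mpr le_top : ((2 : ℕ∞) : ℕ∞ω) ≤ ((⊤ : ℕ∞) : ℕ∞ω)))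
  rw [key, key, hsymm.eq]

/-- A smooth nondegenerate metric `H` and a smooth positive function `r` on an open set of the
coordinate plane. -/
structure IsRadialModel (H : (Fin 2 → ℝ) → Matrix (Fin 2) (Fin 2) ℝ) (r : (Fin 2 → ℝ) → ℝ)
    (O : Set (Fin 2 → ℝ)) : Prop where
  isOpen : IsOpen O
  smooth_metric : ∀ a b, ContDiffOn ℝ ∞ (fun u => H u a b) O
  smooth_radius : ContDiffOn ℝ ∞ r O
  det_ne_zero : ∀ u ∈ O, (H u).det ≠ 0
  symm : ∀ u a b, H u a b = H u b a
  radius_pos : ∀ u ∈ O, 0 < r u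

/-- The gradient of `r` with respect to the metric `H`. -/
def metricGradient {ι : Type*} [Fintype ι] [DecidableEq ι] (H : (ι → ℝ) → Matrix ι ι ℝ)
    (r : (ι → ℝ) → ℝ) (a : ι) (u : ι → ℝ) : ℝ :=
  ∑ b, (H u)⁻¹ a b * partialD b r u

/-- The covariant Hessian of `r` with respect to the metric `H`. -/
def hessian {ι : Type*} [Fintype ι] [DecidableEq ι] (H : (ι → ℝ) → Matrix ι ι ℝ)
    (r : (ι → ℝ) → ℝ) (a b : ι) (u : ι → ℝ) : ℝ :=
  partialD a (partialD b r) u - ∑ c, christoffel H c a b u * partialD c r u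

/-- The squared norm of the gradient of `r` with respect to the metric `H`. -/
def gradNormSq {ι : Type*} [Fintype ι] [DecidableEq ι] (H : (ι → ℝ) → Matrix ι ι ℝ)
    (r : (ι → ℝ) → ℝ) (u : ι → ℝ) : ℝ :=
  ∑ a, metricGradient H r a u * partialD a r u

namespace IsRadialModel

variable {H : (Fin 2 → ℝ) → Matrix (Fin 2) (Fin 2) ℝ} {r : (Fin 2 → ℝ) → ℝ}
  {O : Set (Fin 2 → ℝ)} {u : Fin 2 → ℝ}

theorem isUnit_det (h : IsRadialModel H r O) (hu : u ∈ O) : IsUnit (H u).det :=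
  isUnit_iff_ne_zero.mpr (h.det_ne_zero u hu)

theorem smooth_det (h : IsRadialModel H r O) : ContDiffOn ℝ ∞ (fun u => (H u).det) O := by
  simp only [Matrix.det_fin_two]
  exact ((h.smooth_metric 0 0).mul (h.smooth_metric 1 1)).sub
    ((h.smooth_metric 0 1).mul (h.smooth_metric 1 0))

theorem smooth_inv (h : IsRadialModel H r O) (a b : Fin 2) :
    ContDiffOn ℝ ∞ (fun u => (H u)⁻¹ a b) O := by
  have h1 : ∀ u, (H u)⁻¹ a b = ((H u).det)⁻¹ * (!![H u 1 1, -H u 0 1; -H u 1 0, H u 0 0]) a b := by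
    intro u
    rw [Matrix.inv_def, Matrix.adjugate_fin_two, Ring.inverse_eq_inv']
    rfl
  simp only [h1]
  refine (h.smooth_det.inv h.det_ne_zero).mul ?_
  fin_cases a <;> fin_cases b
  · exact h.smooth_metric 1 1
  · exact (h.smooth_metric 0 1).neg
  · exact (h.smooth_metric 1 0).neg
  · exact h.smooth_metric 0 0

theorem smooth_christoffel (h : IsRadialModel H r O) (c a b : Fin 2) :
    ContDiffOn ℝ ∞ (christoffel H c a b) O := by
  unfold christoffel
  refine contDiffOn_const.mul (ContDiffOn.sum fun e _ => (h.smooth_inv c e).mul ?_)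
  exact (((h.smooth_metric e b).partialD h.isOpen a).add
    ((h.smooth_metric e a).partialD h.isOpen b)).sub ((h.smooth_metric a b).partialD h.isOpen e)

theorem smooth_gradient (h : IsRadialModel H r O) (a : Fin 2) :
    ContDiffOn ℝ ∞ (metricGradient H r a) O := by
  unfold metricGradient
  exact ContDiffOn.sum fun e _ => (h.smooth_inv a e).mul (h.smooth_radius.partialD h.isOpen e)

theorem smooth_gradNormSq (h : IsRadialModel H r O) : ContDiffOn ℝ ∞ (gradNormSq H r) O := by
  unfold gradNormSq
  exact ContDiffOn.sum fun e _ => (h.smooth_gradient e).mul (h.smooth_radius.partialD h.isOpen e)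

theorem metric_mul_inv (h : IsRadialModel H r O) (hu : u ∈ O) (a b : Fin 2) :
    H u a 0 * (H u)⁻¹ 0 b + H u a 1 * (H u)⁻¹ 1 b = if a = b then 1 else 0 := by
  have := congrFun (congrFun (Matrix.mul_nonsing_inv _ (h.isUnit_det hu)) a) b
  simpa [Matrix.mul_apply, Matrix.one_apply] using this

theorem christoffel_symm (h : IsRadialModel H r O) (c a b : Fin 2) (u : Fin 2 → ℝ) :
    christoffel H c a b u = christoffel H c b a u := by
  have : (fun y => H y a b) = fun y => H y b a := funext fun y => h.symm y a b
  simp only [christoffel, this]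
  congr 1
  exact Finset.sum_congr rfl fun e _ => by ring

theorem metric_mul_christoffel (h : IsRadialModel H r O) (hu : u ∈ O) (a b c : Fin 2) :
    ∑ f, H u a f * christoffel H f b c u = 1 / 2 * (partialD b (fun y => H y a c) u
      + partialD c (fun y => H y a b) u - partialD a (fun y => H y b c) u) := by
  simp only [christoffel, Fin.sum_univ_two]
  have h0 := h.metric_mul_inv hu a 0
  have h1 := h.metric_mul_inv hu a 1
  set X : Fin 2 → ℝ := fun e => partialD b (fun y => H y e c) u
      + partialD c (fun y => H y e b) u - partialD e (fun y => H y b c) u with hX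
  have e0 : partialD b (fun y => H y 0 c) u
      + partialD c (fun y => H y 0 b) u - partialD 0 (fun y => H y b c) u = X 0 := rfl
  have e1 : partialD b (fun y => H y 1 c) u
      + partialD c (fun y => H y 1 b) u - partialD 1 (fun y => H y b c) u = X 1 := rfl
  have ea : partialD b (fun y => H y a c) u
      + partialD c (fun y => H y a b) u - partialD a (fun y => H y b c) u = X a := rfl
  rw [e0, e1, ea]
  have hXa : X a = (if a = 0 then 1 else 0) * X 0 + (if a = 1 then 1 else 0) * X 1 := by
    fin_cases a <;> simp
  rw [hXa, ← h0, ← h1]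
  ring

/-- Metric compatibility of the Levi-Civita connection; the source of all the tensor identities
below. -/
theorem partialD_metric (h : IsRadialModel H r O) (hu : u ∈ O) (a b c : Fin 2) :
    partialD c (fun y => H y a b) u
      = ∑ f, (H u a f * christoffel H f c b u + H u b f * christoffel H f c a u) := by
  rw [Finset.sum_add_distrib, h.metric_mul_christoffel hu, h.metric_mul_christoffel hu]
  have hs : ∀ a b, (fun y => H y a b) = fun y => H y b a := fun a b => funext fun y => h.symm y a b
  rw [hs b a, hs b c, hs c a]
  ring

/-- The component `R^c_{a01}` of the Riemann tensor of a metric on the plane. -/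
def riemann (H : (Fin 2 → ℝ) → Matrix (Fin 2) (Fin 2) ℝ) (c a : Fin 2) (u : Fin 2 → ℝ) : ℝ :=
  partialD 0 (christoffel H c 1 a) u - partialD 1 (christoffel H c 0 a) u
    + ∑ f, (christoffel H c 0 f u * christoffel H f 1 a u
      - christoffel H c 1 f u * christoffel H f 0 a u)

theorem partialD_partialD_metric (h : IsRadialModel H r O) (hu : u ∈ O) (a b c e : Fin 2) :
    partialD e (partialD c (fun y => H y a b)) u
      = ∑ f, (partialD e (fun y => H y a f) u * christoffel H f c b u
        + H u a f * partialD e (christoffel H f c b) u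
        + (partialD e (fun y => H y b f) u * christoffel H f c a u
        + H u b f * partialD e (christoffel H f c a) u)) := by
  have heq : partialD c (fun y => H y a b) =ᶠ[𝓝 u] fun u =>
      ∑ f, (H u a f * christoffel H f c b u + H u b f * christoffel H f c a u) := by
    filter_upwards [h.isOpen.mem_nhds hu] with x hx using h.partialD_metric hx a b c
  have hH : ∀ a b, DifferentiableAt ℝ (fun u => H u a b) u := fun a b =>
    (h.smooth_metric a b).differentiableAt_of_isOpen h.isOpen hu
  have hΓ : ∀ a b c, DifferentiableAt ℝ (christoffel H a b c) u := fun a b c =>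
    (h.smooth_christoffel a b c).differentiableAt_of_isOpen h.isOpen hu
  rw [partialD_congr heq]
  refine (partialD_sum (f := fun f u => H u a f * christoffel H f c b u
    + H u b f * christoffel H f c a u) (fun f _ => ((hH a f).mul (hΓ f c b)).add
    ((hH b f).mul (hΓ f c a))) e).trans ?_
  refine Finset.sum_congr rfl fun f _ => ?_
  refine (partialD_add ((hH a f).mul (hΓ f c b)) ((hH b f).mul (hΓ f c a)) e).trans ?_
  rw [← partialD_mul (hH a f) (hΓ f c b), ← partialD_mul (hH b f) (hΓ f c a)]
  rfl

/-- Differentiating metric compatibility once more and commuting the partial derivatives of `H`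
gives the antisymmetry of the lowered Riemann tensor in its first pair of indices. -/
theorem riemann_antisymm (h : IsRadialModel H r O) (hu : u ∈ O) (a d : Fin 2) :
    ∑ c, (H u d c * riemann H c a u + H u a c * riemann H c d u) = 0 := by
  have hcomm := partialD_comm (h.smooth_metric a d) h.isOpen hu 0 1
  rw [h.partialD_partialD_metric hu, h.partialD_partialD_metric hu] at hcomm
  simp only [h.partialD_metric hu, Fin.sum_univ_two] at hcomm
  simp only [riemann, Fin.sum_univ_two]
  have s1 := h.symm u 1 0
  have g0 := h.christoffel_symm 0 1 0 u
  have g1 := h.christoffel_symm 1 1 0 u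
  fin_cases a <;> fin_cases d <;> simp only [Fin.zero_eta, Fin.mk_one, Fin.isValue] at hcomm ⊢ <;>
    rw [s1] at * <;> linear_combination hcomm

/-- In dimension two the antisymmetries leave a single curvature component, so the Ricci tensor is
the Gaussian curvature times the metric. -/
theorem ricci_eq_smul (h : IsRadialModel H r O) (hu : u ∈ O) :
    ∃ K, ∀ a b, ricci H a b u = K * H u a b := by
  have h00 := h.riemann_antisymm hu 0 0
  have h01 := h.riemann_antisymm hu 0 1
  have h11 := h.riemann_antisymm hu 1 1
  have e00 : ricci H 0 0 u = -riemann H 1 0 u := by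
    have : christoffel H 1 1 0 = christoffel H 1 0 1 := funext (h.christoffel_symm 1 1 0)
    simp only [ricci, riemann, Fin.sum_univ_two, this, h.christoffel_symm 0 1 0]
    ring
  have e01 : ricci H 0 1 u = riemann H 0 0 u := by
    have : christoffel H 1 1 0 = christoffel H 1 0 1 := funext (h.christoffel_symm 1 1 0)
    have h0 : christoffel H 0 1 0 = christoffel H 0 0 1 := funext (h.christoffel_symm 0 1 0)
    simp only [ricci, riemann, Fin.sum_univ_two, this, h0]
    ring
  have e10 : ricci H 1 0 u = -riemann H 1 1 u := by
    have : christoffel H 1 1 0 = christoffel H 1 0 1 := funext (h.christoffel_symm 1 1 0)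
    have h0 : christoffel H 0 1 0 = christoffel H 0 0 1 := funext (h.christoffel_symm 0 1 0)
    simp only [ricci, riemann, Fin.sum_univ_two, this, h0]
    ring
  have e11 : ricci H 1 1 u = riemann H 0 1 u := by
    have : christoffel H 1 1 0 = christoffel H 1 0 1 := funext (h.christoffel_symm 1 1 0)
    have h0 : christoffel H 0 1 0 = christoffel H 0 0 1 := funext (h.christoffel_symm 0 1 0)
    simp only [ricci, riemann, Fin.sum_univ_two, this, h0]
    ring
  have hdet := h.det_ne_zero u hu
  rw [Matrix.det_fin_two] at hdet
  simp only [Fin.sum_univ_two] at h00 h01 h11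
  have hs := h.symm u 1 0
  simp only [hs] at h00 h01 h11 hdet
  -- The witness is the Gaussian curvature `R_{0101} / det H`.
  refine ⟨(H u 0 0 * riemann H 0 1 u + H u 0 1 * riemann H 1 1 u)
    / (H u 0 0 * H u 1 1 - H u 0 1 * H u 0 1), fun a b => ?_⟩
  rw [div_mul_eq_mul_div, eq_div_iff hdet]
  fin_cases a <;> fin_cases b <;> simp only [Fin.zero_eta, Fin.mk_one, Fin.isValue]
  · rw [e00]; linear_combination -H u 0 0 * h01 + H u 0 1 / 2 * h00
  · rw [e01]; linear_combination H u 1 1 / 2 * h00 - H u 0 1 * h01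
  · rw [e10, hs]; linear_combination -H u 0 0 / 2 * h11
  · rw [e11]; linear_combination -H u 0 1 / 2 * h11

theorem sum_metric_mul_metricGradient (h : IsRadialModel H r O) (hu : u ∈ O) (a : Fin 2) :
    ∑ b, H u a b * metricGradient H r b u = partialD a r u := by
  simp only [metricGradient, Fin.sum_univ_two]
  have h0 := h.metric_mul_inv hu a 0
  have h1 := h.metric_mul_inv hu a 1
  have ha : partialD a r u
      = (if a = 0 then 1 else 0) * partialD 0 r u + (if a = 1 then 1 else 0) * partialD 1 r u := by
    fin_cases a <;> simp
  rw [ha, ← h0, ← h1]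
  ring

theorem hessian_symm (h : IsRadialModel H r O) (hu : u ∈ O) (a b : Fin 2) :
    hessian H r a b u = hessian H r b a u := by
  simp only [hessian, partialD_comm h.smooth_radius h.isOpen hu a b, h.christoffel_symm _ a b]

/-- Since `H` is parallel, lowering an index commutes with covariant differentiation: the covariant
derivative of the gradient is the Hessian with one index raised. -/
theorem sum_metric_mul_covDeriv_metricGradient (h : IsRadialModel H r O) (hu : u ∈ O)
    (a c : Fin 2) :
    ∑ b, H u a b * (partialD c (metricGradient H r b) u
      + ∑ e, christoffel H b c e u * metricGradient H r e u) = hessian H r c a u := by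
  have heq : partialD a r =ᶠ[𝓝 u] fun u => ∑ b, H u a b * metricGradient H r b u := by
    filter_upwards [h.isOpen.mem_nhds hu] with x hx
      using (h.sum_metric_mul_metricGradient hx a).symm
  have hH : ∀ a b, DifferentiableAt ℝ (fun u => H u a b) u := fun a b =>
    (h.smooth_metric a b).differentiableAt_of_isOpen h.isOpen hu
  have hv : ∀ a, DifferentiableAt ℝ (metricGradient H r a) u := fun a =>
    (h.smooth_gradient a).differentiableAt_of_isOpen h.isOpen hu
  have hsum := partialD_sum (s := Finset.univ) (f := fun b u => H u a b * metricGradient H r b u)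
    (fun b _ => (hH a b).mul (hv b)) c
  have hmul := fun b => partialD_mul (hH a b) (hv b) c
  simp only [hmul] at hsum
  rw [hessian, partialD_congr heq, hsum]
  have hr := fun b => h.sum_metric_mul_metricGradient hu b
  simp only [← hr, h.partialD_metric hu, Fin.sum_univ_two]
  have hs := h.symm u 1 0
  fin_cases a <;> simp only [Fin.zero_eta, Fin.mk_one, Fin.isValue, hs] <;>
    simp only [h.christoffel_symm _ c _] <;> ring

theorem partialD_gradNormSq (h : IsRadialModel H r O) (hu : u ∈ O) (c : Fin 2) :
    partialD c (gradNormSq H r) u = 2 * ∑ a, metricGradient H r a u * hessian H r c a u := by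
  have hr : ∀ a, DifferentiableAt ℝ (partialD a r) u := fun a =>
    (h.smooth_radius.partialD h.isOpen a).differentiableAt_of_isOpen h.isOpen hu
  have hv : ∀ a, DifferentiableAt ℝ (metricGradient H r a) u := fun a =>
    (h.smooth_gradient a).differentiableAt_of_isOpen h.isOpen hu
  have hsum := partialD_sum (s := Finset.univ) (f := fun a u => metricGradient H r a u
    * partialD a r u) (fun b _ => (hv b).mul (hr b)) c
  have hmul := fun b => partialD_mul (hv b) (hr b) c
  simp only [hmul] at hsum
  have hcov := fun a => h.sum_metric_mul_covDeriv_metricGradient hu a c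
  have hgrad := fun b => h.sum_metric_mul_metricGradient hu b
  refine hsum.trans ?_
  have h0 := hcov 0
  have h1 := hcov 1
  have g0 := hgrad 0
  have g1 := hgrad 1
  simp only [hessian, Fin.sum_univ_two] at h0 h1 g0 g1 ⊢
  rw [h.symm u 1 0] at h1 g1
  -- The coefficients of `g0` and `g1` are the components of the covariant derivative of the
  -- gradient: these equations trade `∂_a r` for the lowered gradient.
  linear_combination metricGradient H r 0 u * h0 + metricGradient H r 1 u * h1
    - (partialD c (metricGradient H r 0) u + christoffel H 0 c 0 u * metricGradient H r 0 u
        + christoffel H 0 c 1 u * metricGradient H r 1 u) * g0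
    - (partialD c (metricGradient H r 1) u + christoffel H 1 c 0 u * metricGradient H r 0 u
        + christoffel H 1 c 1 u * metricGradient H r 1 u) * g1

/-- The two usual forms of the d'Alembertian. The divergence form is what the fibre components of
the Ricci tensor produce; the trace form is what the null frame evaluates. -/
theorem divergence_metricGradient (h : IsRadialModel H r O) (hu : u ∈ O) :
    ∑ c, (partialD c (metricGradient H r c) u
      + ∑ e, christoffel H c c e u * metricGradient H r e u)
      = ∑ a, ∑ b, (H u)⁻¹ a b * hessian H r a b u := by
  have hcov := fun a c => h.sum_metric_mul_covDeriv_metricGradient hu a c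
  have hinv := fun a b => congrFun (congrFun (Matrix.nonsing_inv_mul _ (h.isUnit_det hu)) a) b
  simp only [Matrix.mul_apply, Matrix.one_apply, Fin.sum_univ_two] at hinv
  set Y : Fin 2 → Fin 2 → ℝ := fun b c => partialD c (metricGradient H r b) u
      + ∑ e, christoffel H b c e u * metricGradient H r e u with hY
  have hcov' : ∀ a c, H u a 0 * Y 0 c + H u a 1 * Y 1 c = hessian H r c a u := by
    intro a c
    rw [← hcov, Fin.sum_univ_two]
  change ∑ c, Y c c = _
  have h00 := hinv 0 0
  have h01 := hinv 0 1
  have h10 := hinv 1 0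
  have h11 := hinv 1 1
  simp only [Fin.sum_univ_two, ← hcov']
  simp at h00 h01 h10 h11
  linear_combination -Y 0 0 * h00 - Y 1 0 * h01 - Y 0 1 * h10 - Y 1 1 * h11

end IsRadialModel

/-! ### The curvature of a warped product -/

namespace IsRadialModel

variable {H : (Fin 2 → ℝ) → Matrix (Fin 2) (Fin 2) ℝ} {r : (Fin 2 → ℝ) → ℝ}
  {O : Set (Fin 2 → ℝ)} {u : Fin 2 → ℝ} {k : ℝ} {n : ℕ} {z : Fin n → ℝ}

theorem differentiableAt_metric (h : IsRadialModel H r O) (hu : u ∈ O) (a b : Fin 2) :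
    DifferentiableAt ℝ (fun u => H u a b) u :=
  (h.smooth_metric a b).differentiableAt_of_isOpen h.isOpen hu

theorem differentiableAt_radius (h : IsRadialModel H r O) (hu : u ∈ O) : DifferentiableAt ℝ r u :=
  h.smooth_radius.differentiableAt_of_isOpen h.isOpen hu

theorem partialD_radius_sq (h : IsRadialModel H r O) (hu : u ∈ O) (a : Fin 2) :
    partialD a (fun u => r u ^ 2) u = 2 * r u * partialD a r u := by
  have h1 := partialD_comp_deriv (φ := fun s => s ^ 2) (hasDerivAt_pow 2 (r u))
    (h.differentiableAt_radius hu) a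
  simpa using h1

theorem christoffel_inl_inr_inr (h : IsRadialModel H r O) (hu : u ∈ O) (hz : z ∈ fiberDomain k n)
    (c : Fin 2) (i j : Fin n) :
    christoffel (warpedMetric k H fun u => r u ^ 2) (Sum.inl c) (Sum.inr i) (Sum.inr j)
      (Sum.elim u z)
      = if i = j then -(r u * metricGradient H r c u) * (fiberFactor k z ^ 2)⁻¹ else 0 := by
  have hr := h.radius_pos u hu
  rw [christoffel_warpedMetric_inl_inr_inr ((h.differentiableAt_radius hu).fun_pow 2)
    (h.isUnit_det hu) (by positivity) hz]
  simp only [h.partialD_radius_sq hu, metricGradient, Fin.sum_univ_two]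
  split_ifs <;> ring

theorem christoffel_inr_inl_inr (h : IsRadialModel H r O) (hu : u ∈ O) (hz : z ∈ fiberDomain k n)
    (a : Fin 2) (i j : Fin n) :
    christoffel (warpedMetric k H fun u => r u ^ 2) (Sum.inr i) (Sum.inl a) (Sum.inr j)
      (Sum.elim u z) = if i = j then partialD a r u / r u else 0 := by
  have hr := h.radius_pos u hu
  rw [christoffel_warpedMetric_inr_inl_inr ((h.differentiableAt_radius hu).fun_pow 2)
    (h.isUnit_det hu) (by positivity) hz]
  simp only [h.partialD_radius_sq hu]
  split_ifs <;> field_simp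

theorem christoffel_inr_inr_inl (h : IsRadialModel H r O) (hu : u ∈ O) (hz : z ∈ fiberDomain k n)
    (a : Fin 2) (i j : Fin n) :
    christoffel (warpedMetric k H fun u => r u ^ 2) (Sum.inr i) (Sum.inr j) (Sum.inl a)
      (Sum.elim u z) = if i = j then partialD a r u / r u else 0 := by
  have hr := h.radius_pos u hu
  rw [christoffel_warpedMetric_inr_inr_inl ((h.differentiableAt_radius hu).fun_pow 2)
    (h.isUnit_det hu) (by positivity) hz]
  simp only [h.partialD_radius_sq hu]
  split_ifs <;> field_simp

/-- Both domains are open, so closed formulas for the Christoffel symbols that hold on their product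
may be differentiated there. -/
theorem partialD_congr_of_eqOn (h : IsRadialModel H r O) (hu : u ∈ O) (hz : z ∈ fiberDomain k n)
    {f g : (Fin 2 ⊕ Fin n → ℝ) → ℝ}
    (hfg : ∀ u ∈ O, ∀ z ∈ fiberDomain k n, f (Sum.elim u z) = g (Sum.elim u z))
    (e : Fin 2 ⊕ Fin n) :
    partialD e f (Sum.elim u z) = partialD e g (Sum.elim u z) := by
  refine partialD_congr ?_ e
  have h1 : ∀ᶠ x in 𝓝 (Sum.elim u z : Fin 2 ⊕ Fin n → ℝ), projLeft (Fin 2) (Fin n) x ∈ O :=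
    (projLeft (Fin 2) (Fin n)).continuous.continuousAt.eventually_mem (h.isOpen.mem_nhds hu)
  have h2 : ∀ᶠ x in 𝓝 (Sum.elim u z : Fin 2 ⊕ Fin n → ℝ),
      projRight (Fin 2) (Fin n) x ∈ fiberDomain k n :=
    (projRight (Fin 2) (Fin n)).continuous.continuousAt.eventually_mem
      ((isOpen_fiberDomain k n).mem_nhds hz)
  filter_upwards [h1, h2] with x hx1 hx2
  have hx : x = Sum.elim (projLeft (Fin 2) (Fin n) x) (projRight (Fin 2) (Fin n) x) := by
    ext i
    rcases i with i | i <;> rfl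
  rw [hx]
  exact hfg _ hx1 _ hx2

theorem partialD_christoffel_base (h : IsRadialModel H r O) (hu : u ∈ O)
    (hz : z ∈ fiberDomain k n) (e : Fin 2 ⊕ Fin n) (c a b : Fin 2) :
    partialD e (christoffel (warpedMetric k H fun u => r u ^ 2) (Sum.inl c) (Sum.inl a)
      (Sum.inl b)) (Sum.elim u z)
      = Sum.elim (fun f => partialD f (christoffel H c a b) u) 0 e := by
  rw [h.partialD_congr_of_eqOn hu hz
    (g := fun x => christoffel H c a b fun i => x (Sum.inl i)) fun u hu z hz => by
      simpa using christoffel_warpedMetric_base (h.differentiableAt_metric hu) (h.isUnit_det hu)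
        (pow_pos (h.radius_pos u hu) 2).ne' hz c a b]
  have hd := (h.smooth_christoffel c a b).differentiableAt_of_isOpen h.isOpen hu
  rcases e with f | f
  · exact partialD_inl_left z hd f
  · exact partialD_inr_left z hd f

theorem partialD_christoffel_inl_inr_inl (h : IsRadialModel H r O) (hu : u ∈ O)
    (hz : z ∈ fiberDomain k n) (e : Fin 2 ⊕ Fin n) (c a : Fin 2) (j : Fin n) :
    partialD e (christoffel (warpedMetric k H fun u => r u ^ 2) (Sum.inl c) (Sum.inr j)
      (Sum.inl a)) (Sum.elim u z) = 0 := by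
  rw [h.partialD_congr_of_eqOn hu hz (g := fun x => 0) fun u hu z hz =>
    christoffel_warpedMetric_inl_inr_inl (h.differentiableAt_metric hu) (h.isUnit_det hu)
        (pow_pos (h.radius_pos u hu) 2).ne' hz c a j]
  simp

theorem partialD_christoffel_inr_inl_inl (h : IsRadialModel H r O) (hu : u ∈ O)
    (hz : z ∈ fiberDomain k n) (e : Fin 2 ⊕ Fin n) (a b : Fin 2) (j : Fin n) :
    partialD e (christoffel (warpedMetric k H fun u => r u ^ 2) (Sum.inr j) (Sum.inl a)
      (Sum.inl b)) (Sum.elim u z) = 0 := by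
  rw [h.partialD_congr_of_eqOn hu hz (g := fun x => 0) fun u hu z hz =>
    christoffel_warpedMetric_inr_inl_inl (h.isUnit_det hu)
        (pow_pos (h.radius_pos u hu) 2).ne' hz (h.differentiableAt_metric hu) j a b]
  simp

theorem partialD_christoffel_inl_inr_inr (h : IsRadialModel H r O) (hu : u ∈ O)
    (e : Fin 2 ⊕ Fin n) (c : Fin 2) (i j : Fin n) :
    partialD e (christoffel (warpedMetric k H fun u => r u ^ 2) (Sum.inl c) (Sum.inr i)
      (Sum.inr j)) (Sum.elim u 0)
      = if i = j then
          Sum.elim (fun f => -(partialD f r u * metricGradient H r c u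
            + r u * partialD f (metricGradient H r c) u)) 0 e
        else 0 := by
  have hz := zero_mem_fiberDomain k n
  have hv := (h.smooth_gradient c).differentiableAt_of_isOpen h.isOpen hu
  have hr := h.differentiableAt_radius hu
  split_ifs with hij
  · rw [h.partialD_congr_of_eqOn hu hz (g := fun x =>
      (fun u => -(r u * metricGradient H r c u)) (fun i => x (Sum.inl i))
        * (fun z : Fin n → ℝ => (fiberFactor k z ^ 2)⁻¹) (fun i => x (Sum.inr i)))
      fun u hu z hz => by
        rw [h.christoffel_inl_inr_inr hu hz, if_pos hij]
        simp only [Sum.elim_inl, Sum.elim_inr]]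
    have hd : DifferentiableAt ℝ (fun u => -(r u * metricGradient H r c u)) u := (hr.mul hv).neg
    have hφ := conformalFactor_differentiableAt k hz
    rcases e with f | f
    · rw [partialD_inl_left_mul_right hd hφ, Sum.elim_inl, ← partialD_mul hr hv]
      simp [partialD, fderiv_fun_neg]
    · rw [partialD_inr_left_mul_right hd hφ, partialD_conformalFactor k hz]
      simp
  · rw [h.partialD_congr_of_eqOn hu hz (g := fun x => 0) fun u hu z hz => by
        rw [h.christoffel_inl_inr_inr hu hz, if_neg hij]]
    simp

theorem partialD_christoffel_inr_inl_inr (h : IsRadialModel H r O) (hu : u ∈ O)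
    (hz : z ∈ fiberDomain k n) (e : Fin 2 ⊕ Fin n) (a : Fin 2) (i j : Fin n) :
    partialD e (christoffel (warpedMetric k H fun u => r u ^ 2) (Sum.inr i) (Sum.inl a)
      (Sum.inr j)) (Sum.elim u z)
      = if i = j then
          Sum.elim (fun f => partialD f (partialD a r) u / r u
            - partialD a r u * partialD f r u / r u ^ 2) 0 e
        else 0 := by
  have hv := (h.smooth_radius.partialD h.isOpen a).differentiableAt_of_isOpen h.isOpen hu
  have hr := h.differentiableAt_radius hu
  have hr0 := (h.radius_pos u hu).ne'
  split_ifs with hij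
  · rw [h.partialD_congr_of_eqOn hu hz (g := fun x =>
      (fun u => partialD a r u * (r u)⁻¹) (fun i => x (Sum.inl i)))
      fun u hu z hz => by
        rw [h.christoffel_inr_inl_inr hu hz, if_pos hij]
        simp only [Sum.elim_inl, div_eq_mul_inv]]
    have hd : DifferentiableAt ℝ (fun u => partialD a r u * (r u)⁻¹) u := hv.mul (hr.inv hr0)
    rcases e with f | f
    · rw [partialD_inl_left z hd, Sum.elim_inl]
      refine (partialD_mul hv (hr.inv hr0) f).trans ?_
      refine (congrArg _ (congrArg _ (partialD_comp_deriv (hasDerivAt_inv hr0) hr f))).trans ?_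
      simp only [Pi.inv_apply]
      field_simp
      ring
    · rw [partialD_inr_left z hd]
      simp
  · rw [h.partialD_congr_of_eqOn hu hz (g := fun x => 0) fun u hu z hz => by
        rw [h.christoffel_inr_inl_inr hu hz, if_neg hij]]
    simp

theorem partialD_christoffel_fiber (h : IsRadialModel H r O) (hu : u ∈ O)
    (e : Fin 2 ⊕ Fin n) (i j l : Fin n) :
    partialD e (christoffel (warpedMetric k H fun u => r u ^ 2) (Sum.inr i) (Sum.inr j)
      (Sum.inr l)) (Sum.elim u 0)
      = Sum.elim (fun _ => 0) (fun m => -(k / 2) * ((if i = j ∧ m = l then 1 else 0)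
          + (if i = l ∧ m = j then 1 else 0) - (if j = l ∧ m = i then 1 else 0))) e := by
  have hz := zero_mem_fiberDomain k n
  set A : (Fin n → ℝ) → ℝ := fun z => (fiberFactor k z)⁻¹ with hA
  set P : (Fin n → ℝ) → ℝ := fun z => (if i = j then z l else 0) + (if i = l then z j else 0)
    - (if j = l then z i else 0) with hP
  have hAd : DifferentiableAt ℝ A 0 := (fiberFactor_differentiableAt k 0).inv (by simp)
  have hPd : HasFDerivAt P
      ((if i = j then ContinuousLinearMap.proj (R := ℝ) (φ := fun _ : Fin n => ℝ) l else 0)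
      + (if i = l then ContinuousLinearMap.proj (R := ℝ) (φ := fun _ : Fin n => ℝ) j else 0)
      - (if j = l then ContinuousLinearMap.proj (R := ℝ) (φ := fun _ : Fin n => ℝ) i else 0))
      (0 : Fin n → ℝ) := by
    refine (HasFDerivAt.fun_add ?_ ?_).fun_sub ?_
    · split_ifs
      · exact hasFDerivAt_apply _ _
      · exact hasFDerivAt_const _ _
    · split_ifs
      · exact hasFDerivAt_apply _ _
      · exact hasFDerivAt_const _ _
    · split_ifs
      · exact hasFDerivAt_apply _ _
      · exact hasFDerivAt_const _ _
  rw [h.partialD_congr_of_eqOn hu hz (g := fun x =>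
      (fun z => -(k / 2) * (A z * P z)) (fun i => x (Sum.inr i)))
      fun u hu z hz => by
        rw [christoffel_warpedMetric_fiber ((h.differentiableAt_radius hu).fun_pow 2)
          (h.isUnit_det hu) (pow_pos (h.radius_pos u hu) 2).ne' hz]
        simp only [Sum.elim_inr, hA, hP]
        ring]
  have hd : DifferentiableAt ℝ (fun z => -(k / 2) * (A z * P z)) 0 :=
    (hAd.mul hPd.differentiableAt).const_mul _
  rcases e with f | f
  · rw [partialD_inl_right u hd]
    simp
  · rw [partialD_inr_right u hd, Sum.elim_inr]
    refine (partialD_const_mul (hAd.mul hPd.differentiableAt) _ f).trans ?_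
    refine (congrArg _ (partialD_mul hAd hPd.differentiableAt f)).trans ?_
    -- The linear factor vanishes at the origin, so the derivative of the conformal factor does not
    -- contribute.
    have hP0 : P 0 = 0 := by simp [hP]
    have hA0 : A 0 = 1 := by simp [hA]
    have hsingle : ∀ (c : Prop) [Decidable c] (a : Fin n),
        (if c then (ContinuousLinearMap.proj (R := ℝ) a : (Fin n → ℝ) →L[ℝ] ℝ) else 0)
          (Pi.single f 1) = if c ∧ f = a then 1 else 0 := by
      intro c _ a
      by_cases hc : c <;> simp [hc, Pi.single_apply, eq_comm]
    rw [hP0, hA0, hPd.partialD_eq]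
    simp only [sub_apply, add_apply, hsingle]
    ring

end IsRadialModel

namespace IsRadialModel

variable {H : (Fin 2 → ℝ) → Matrix (Fin 2) (Fin 2) ℝ} {r : (Fin 2 → ℝ) → ℝ}
  {O : Set (Fin 2 → ℝ)} {u : Fin 2 → ℝ}

/-- Each of the `n` fibre directions contributes one copy of `-Hess r / r` to the base Ricci tensor.
-/
theorem ricci_warpedMetric_base (h : IsRadialModel H r O) (hu : u ∈ O) (k : ℝ) (n : ℕ)
    (a b : Fin 2) :
    ricci (warpedMetric (n := n) k H fun u => r u ^ 2) (Sum.inl a) (Sum.inl b) (Sum.elim u 0)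
      = ricci H a b u - n / r u * hessian H r a b u := by
  have hz := zero_mem_fiberDomain k n
  have hr := (h.radius_pos u hu).ne'
  have hH := h.differentiableAt_metric hu
  have hdet := h.isUnit_det hu
  have hR : r u ^ 2 ≠ 0 := (pow_pos (h.radius_pos u hu) 2).ne'
  simp only [ricci, Fintype.sum_sum_type, h.partialD_christoffel_base hu hz,
    h.partialD_christoffel_inr_inl_inl hu hz, h.partialD_christoffel_inr_inl_inr hu hz,
    christoffel_warpedMetric_base (R := fun u => r u ^ 2) hH hdet hR hz,
    christoffel_warpedMetric_inr_inl_inl (R := fun u => r u ^ 2) hdet hR hz hH,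
    christoffel_warpedMetric_inl_inl_inr (R := fun u => r u ^ 2) hH hdet hR hz,
    h.christoffel_inr_inl_inr hu hz, h.christoffel_inr_inr_inl hu hz]
  simp only [Sum.elim_inl, if_true, ite_mul, zero_mul, mul_ite, mul_zero, Finset.sum_ite_eq',
    Finset.mem_univ, Finset.sum_const, Finset.card_univ, Fintype.card_fin,
    nsmul_eq_mul, hessian, partialD_comm h.smooth_radius h.isOpen hu a b, Fin.sum_univ_two,
    Finset.sum_sub_distrib, Finset.sum_add_distrib]
  field_simp
  ring

/-- At the origin the purely fibre Christoffel symbols vanish and their first derivatives supply the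
intrinsic curvature `k (n - 1)`; the mixed symbols give the terms in `r`. -/
theorem ricci_warpedMetric_fiber (h : IsRadialModel H r O) (hu : u ∈ O) (k : ℝ) (n : ℕ)
    (i : Fin n) :
    ricci (warpedMetric (n := n) k H fun u => r u ^ 2) (Sum.inr i) (Sum.inr i) (Sum.elim u 0)
      = k * (n - 1) - r u * ∑ a, ∑ b, (H u)⁻¹ a b * hessian H r a b u
        - (n - 1) * gradNormSq H r u := by
  have hz := zero_mem_fiberDomain k n
  have hr := (h.radius_pos u hu).ne'
  have hH := h.differentiableAt_metric hu
  have hdet := h.isUnit_det hu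
  have hR : r u ^ 2 ≠ 0 := (pow_pos (h.radius_pos u hu) 2).ne'
  have hf : ∀ i j l : Fin n, christoffel (warpedMetric k H fun u => r u ^ 2) (Sum.inr i)
      (Sum.inr j) (Sum.inr l) (Sum.elim u 0) = 0 := fun i j l => by
    rw [christoffel_warpedMetric_fiber ((h.differentiableAt_radius hu).fun_pow 2) hdet hR hz]
    simp
  have hii : ∀ x : Fin n, (x = i ∧ i = x) = (x = i) := fun x => by
    simp only [eq_comm (a := i), and_self]
  rw [← h.divergence_metricGradient hu]
  simp only [ricci, Fintype.sum_sum_type, h.partialD_christoffel_inl_inr_inr hu,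
    h.partialD_christoffel_inl_inr_inl hu hz, h.partialD_christoffel_fiber hu, hf,
    christoffel_warpedMetric_base (R := fun u => r u ^ 2) hH hdet hR hz,
    christoffel_warpedMetric_inl_inl_inr (R := fun u => r u ^ 2) hH hdet hR hz,
    christoffel_warpedMetric_inl_inr_inl (R := fun u => r u ^ 2) hH hdet hR hz,
    h.christoffel_inr_inr_inl hu hz, h.christoffel_inl_inr_inr hu hz]
  simp only [Sum.elim_inl, Sum.elim_inr, if_true, ite_mul, zero_mul, mul_ite, mul_zero,
    Finset.sum_ite_eq', true_and, and_self,
    Finset.sum_ite_eq, Finset.mem_univ, Finset.sum_const, Finset.card_univ, Fintype.card_fin,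
    nsmul_eq_mul, sub_zero, add_zero, fiberFactor_zero, inv_one, one_pow, mul_one,
    hii, Fin.sum_univ_two, gradNormSq, Finset.sum_sub_distrib,
    Finset.sum_add_distrib, ← Finset.mul_sum]
  field_simp
  ring

theorem scalarCurvature_warpedMetric (h : IsRadialModel H r O) (hu : u ∈ O) (k : ℝ) (n : ℕ) :
    scalarCurvature (warpedMetric (n := n) k H fun u => r u ^ 2) (Sum.elim u 0)
      = ∑ a, ∑ b, (H u)⁻¹ a b * (ricci H a b u - n / r u * hessian H r a b u)
        + n / r u ^ 2 * (k * (n - 1) - r u * ∑ a, ∑ b, (H u)⁻¹ a b * hessian H r a b u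
          - (n - 1) * gradNormSq H r u) := by
  have hz := zero_mem_fiberDomain k n
  have hR : r u ^ 2 ≠ 0 := (pow_pos (h.radius_pos u hu) 2).ne'
  simp only [scalarCurvature, Fintype.sum_sum_type,
    warpedMetric_inv (R := fun u => r u ^ 2) (h.isUnit_det hu) hR hz,
    Matrix.fromBlocks_apply₁₁, Matrix.fromBlocks_apply₁₂, Matrix.fromBlocks_apply₂₁,
    Matrix.fromBlocks_apply₂₂, Matrix.zero_apply, zero_mul, Finset.sum_const_zero, add_zero,
    zero_add, h.ricci_warpedMetric_base hu, Matrix.smul_apply, Matrix.one_apply, smul_eq_mul,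
    mul_ite, mul_one, mul_zero, ite_mul, Finset.sum_ite_eq, Finset.mem_univ, if_true,
    h.ricci_warpedMetric_fiber hu, Finset.sum_const, Finset.card_univ, Fintype.card_fin,
    nsmul_eq_mul, fiberFactor_zero, one_pow]
  ring

/-- The curvature `K` of the base cancels between the Ricci tensor and half the scalar curvature,
because the trace of `K H` is `2 K`. No second derivative of the base metric remains. -/
theorem einstein_warpedMetric_base (h : IsRadialModel H r O) (hu : u ∈ O) (k : ℝ) (n : ℕ)
    (a b : Fin 2) :
    einstein (warpedMetric (n := n) k H fun u => r u ^ 2) (Sum.inl a) (Sum.inl b) (Sum.elim u 0)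
      = -(n / r u) * hessian H r a b u
        + H u a b * (n / r u * ∑ a, ∑ b, (H u)⁻¹ a b * hessian H r a b u
          - n * (n - 1) * (k - gradNormSq H r u) / (2 * r u ^ 2)) := by
  obtain ⟨K, hK⟩ := h.ricci_eq_smul hu
  have hr := (h.radius_pos u hu).ne'
  have htr : ∑ a, ∑ b, (H u)⁻¹ a b * (K * H u a b) = 2 * K := by
    have h0 := h.metric_mul_inv hu 0 0
    have h1 := h.metric_mul_inv hu 1 1
    simp only [if_true] at h0 h1
    simp only [Fin.sum_univ_two]
    rw [h.symm u 0 1] at h0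
    rw [h.symm u 1 0] at h1
    linear_combination K * h0 + K * h1
  rw [einstein, h.ricci_warpedMetric_base hu, h.scalarCurvature_warpedMetric hu]
  simp only [mul_sub, Finset.sum_sub_distrib, hK, htr]
  have hg : (warpedMetric k H fun u => r u ^ 2) (Sum.elim u (0 : Fin n → ℝ)) (Sum.inl a)
    (Sum.inl b) = H u a b := rfl
  have hs : ∑ a, ∑ b, (H u)⁻¹ a b * (n / r u * hessian H r a b u)
      = n / r u * ∑ a, ∑ b, (H u)⁻¹ a b * hessian H r a b u := by
    simp only [Finset.mul_sum]
    exact Finset.sum_congr rfl fun _ _ => Finset.sum_congr rfl fun _ _ => by ring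
  rw [hg, hs]
  field_simp
  ring

end IsRadialModel

/-! ### The Misner-Sharp mass -/

/-- The Misner-Sharp mass `r^p (k + r²/L² - |∇r|²)` of a warped product of dimension `p + 3`,
renormalized by the cosmological constant. -/
def misnerSharp (k L : ℝ) (p : ℕ) (H : (Fin 2 → ℝ) → Matrix (Fin 2) (Fin 2) ℝ)
    (r : (Fin 2 → ℝ) → ℝ) (u : Fin 2 → ℝ) : ℝ :=
  r u ^ p * (k + r u ^ 2 / L ^ 2 - gradNormSq H r u)

/-- With `P` having columns `l, m` and `Q` having rows `m, l`, the frame relations say `Q A P =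
-2c`. Inverse matrices commute, so `P Q` is the inverse of `A` up to that factor. -/
theorem inv_eq_of_null_frame {A : Matrix (Fin 2) (Fin 2) ℝ} {l m : Fin 2 → ℝ} {c : ℝ} (hc : 0 < c)
    (hsymm : A 0 1 = A 1 0) (hll : ∑ a, ∑ b, A a b * l a * l b = 0)
    (hmm : ∑ a, ∑ b, A a b * m a * m b = 0) (hlm : ∑ a, ∑ b, A a b * l a * m b = -(2 * c))
    (a b : Fin 2) : A⁻¹ a b = -(l a * m b + m a * l b) / (2 * c) := by
  simp only [Fin.sum_univ_two] at hll hmm hlm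
  set P : Matrix (Fin 2) (Fin 2) ℝ := !![l 0, m 0; l 1, m 1] with hP
  set Q : Matrix (Fin 2) (Fin 2) ℝ := !![m 0, m 1; l 0, l 1] with hQ
  have h1 : ((-(1 / (2 * c))) • (Q * A)) * P = 1 := by
    ext i j
    fin_cases i <;> fin_cases j <;>
      simp [hP, hQ, Matrix.mul_apply, Fin.sum_univ_two, Matrix.vecMul, dotProduct] <;> field_simp
    · linear_combination -hlm - (m 0 * l 1 - m 1 * l 0) * hsymm
    · linear_combination -hmm
    · linear_combination -hll
    · linear_combination -hlm
  have h2 := mul_eq_one_comm.mp h1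
  have h3 : (P * (-(1 / (2 * c)) • Q)) * A = 1 := by
    rw [← h2, Matrix.mul_assoc, Matrix.smul_mul]
  rw [Matrix.inv_eq_left_inv h3]
  fin_cases a <;> fin_cases b <;> simp [hP, hQ, Matrix.mul_apply, Fin.sum_univ_two] <;>
    field_simp <;> ring

namespace IsRadialModel

variable {H : (Fin 2 → ℝ) → Matrix (Fin 2) (Fin 2) ℝ} {r : (Fin 2 → ℝ) → ℝ}
  {O : Set (Fin 2 → ℝ)} {u : Fin 2 → ℝ}

theorem smooth_misnerSharp (h : IsRadialModel H r O) (k L : ℝ) (p : ℕ) :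
    ContDiffOn ℝ ∞ (misnerSharp k L p H r) O := by
  unfold misnerSharp
  exact (h.smooth_radius.pow p).mul ((contDiffOn_const.add
    ((h.smooth_radius.pow 2).div_const _)).sub h.smooth_gradNormSq)

theorem partialD_misnerSharp (h : IsRadialModel H r O) (hu : u ∈ O) (k L : ℝ) (p : ℕ)
    (a : Fin 2) :
    partialD a (misnerSharp k L p H r) u
      = r u ^ p * (p / r u * partialD a r u * (k + r u ^ 2 / L ^ 2 - gradNormSq H r u)
        + (2 * r u * partialD a r u / L ^ 2
          - 2 * ∑ b, metricGradient H r b u * hessian H r a b u)) := by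
  have hr := h.differentiableAt_radius hu
  have hr0 := (h.radius_pos u hu).ne'
  have hN := h.smooth_gradNormSq.differentiableAt_of_isOpen h.isOpen hu
  have h1 : partialD a (fun u => r u ^ p) u = p * r u ^ (p - 1) * partialD a r u :=
    partialD_comp_deriv (φ := fun s => s ^ p) (hasDerivAt_pow p (r u)) hr a
  have h2 : partialD a (fun u => k + r u ^ 2 / L ^ 2) u = 2 * r u / L ^ 2 * partialD a r u := by
    refine partialD_comp_deriv (φ := fun s => k + s ^ 2 / L ^ 2) ?_ hr a
    simpa using ((hasDerivAt_pow 2 (r u)).div_const (L ^ 2)).const_add k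
  have hd : DifferentiableAt ℝ (fun u => k + r u ^ 2 / L ^ 2) u := by fun_prop
  -- At `p = 0` the exponent `p - 1` truncates to zero, but the prefactor `p` kills the term.
  have hp : (p : ℝ) * r u ^ (p - 1) = p * r u ^ p / r u := by
    rcases p with _ | p
    · simp
    · simp only [Nat.add_sub_cancel]
      field_simp
      ring
  refine (partialD_mul (hr.fun_pow p) (hd.fun_sub hN) a).trans ?_
  rw [partialD_sub hd hN, h1, h2, hp, h.partialD_gradNormSq hu]
  ring

/-- Monotonicity of the Misner-Sharp mass in untrapped regions: `l` and `m` are future null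
vectors pointing to the outer and to the inner side. -/
theorem misnerSharp_deriv_nonneg (h : IsRadialModel H r O) (hu : u ∈ O) (k L : ℝ) (p : ℕ)
    {l m : Fin 2 → ℝ} {c : ℝ} (hc : 0 < c)
    (hll : ∑ a, ∑ b, H u a b * l a * l b = 0) (hmm : ∑ a, ∑ b, H u a b * m a * m b = 0)
    (hlm : ∑ a, ∑ b, H u a b * l a * m b = -(2 * c))
    (hl : 0 ≤ ∑ a, l a * partialD a r u) (hm : ∑ a, m a * partialD a r u ≤ 0)
    {E : Fin 2 → Fin 2 → ℝ}
    (hE : ∀ a b, E a b = einstein (warpedMetric (n := p + 1) k H fun u => r u ^ 2) (Sum.inl a)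
      (Sum.inl b) (Sum.elim u 0) - (p + 1) * (p + 2) / (2 * L ^ 2) * H u a b)
    (hEll : 0 ≤ ∑ a, ∑ b, E a b * l a * l b) (hEmm : 0 ≤ ∑ a, ∑ b, E a b * m a * m b)
    (hElm : 0 ≤ ∑ a, ∑ b, E a b * l a * m b) :
    0 ≤ ∑ a, (l a - m a) * partialD a (misnerSharp k L p H r) u := by
  have hr := h.radius_pos u hu
  have hI := inv_eq_of_null_frame hc (h.symm u 0 1) hll hmm hlm
  set α := ∑ a, l a * partialD a r u with hα
  set β := ∑ a, m a * partialD a r u with hβ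
  set N := gradNormSq H r u with hN
  have hgrad : ∀ a, metricGradient H r a u = -(β * l a + α * m a) / (2 * c) := by
    intro a
    simp only [metricGradient, hI, hα, hβ, Fin.sum_univ_two]
    ring
  set F := fun x y : Fin 2 → ℝ => ∑ a, ∑ b, hessian H r a b u * x a * y b with hF
  have hbox : ∑ a, ∑ b, (H u)⁻¹ a b * hessian H r a b u = -F l m / c := by
    simp only [hI, hF, Fin.sum_univ_two]
    rw [h.hessian_symm hu 1 0]
    field_simp
    ring
  -- On `l, l` and `m, m` the metric term disappears, so the energy condition fixes the sign of the
  -- Hessian in null directions, as in the Raychaudhuri equation. On `l, m` the full bracket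
  -- survives.
  have hEF : ∀ x y, ∑ a, ∑ b, E a b * x a * y b = -((p + 1) / r u) * F x y
      + (∑ a, ∑ b, H u a b * x a * y b) * ((p + 1) / r u * (-F l m / c)
        - (p + 1) * p * (k - N) / (2 * r u ^ 2) - (p + 1) * (p + 2) / (2 * L ^ 2)) := by
    intro x y
    have hE' := fun a b => (hE a b).trans (by rw [h.einstein_warpedMetric_base hu, hbox, ← hN])
    simp only [hE']
    set X := F l m
    simp only [hF, Fin.sum_univ_two]
    push_cast
    ring
  have hder : ∑ a, (l a - m a) * partialD a (misnerSharp k L p H r) u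
      = r u ^ p * ((α - β) * (p / r u * (k + r u ^ 2 / L ^ 2 - N) + 2 * r u / L ^ 2)
        + (β * F l l + α * F l m - β * F l m - α * F m m) / c) := by
    simp only [h.partialD_misnerSharp hu, hgrad, hF, hα, hβ, Fin.sum_univ_two]
    rw [h.hessian_symm hu 1 0]
    field_simp
    ring
  rw [hEF, hll] at hEll
  rw [hEF, hmm] at hEmm
  rw [hEF, hlm] at hElm
  have hll' : F l l ≤ 0 := by
    have h1 : 0 < (p + 1) / r u := by positivity
    nlinarith
  have hmm' : F m m ≤ 0 := by
    have h1 : 0 < (p + 1) / r u := by positivity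
    nlinarith
  have hlm' : 0 ≤ p / r u * (k + r u ^ 2 / L ^ 2 - N) + 2 * r u / L ^ 2 + F l m / c := by
    have h1 : -((p + 1) / r u) * F l m + -(2 * c) * ((p + 1) / r u * (-F l m / c)
        - (p + 1) * p * (k - N) / (2 * r u ^ 2) - (p + 1) * (p + 2) / (2 * L ^ 2))
        = (c * (p + 1) / r u) * (p / r u * (k + r u ^ 2 / L ^ 2 - N) + 2 * r u / L ^ 2
          + F l m / c) := by
      -- `L ≠ 0` is not assumed here. For `L = 0` division by zero makes every cosmological term
      -- vanish, and the identity still holds.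
      rcases eq_or_ne L 0 with rfl | hL
      · simp only [ne_eq, OfNat.ofNat_ne_zero, not_false_eq_true, zero_pow, mul_zero, div_zero]
        field_simp
        ring
      · field_simp
        ring
    rw [h1] at hElm
    exact nonneg_of_mul_nonneg_right hElm (by positivity)
  rw [hder]
  -- The terms in `F l m` join the bracket bounded by the `lm` component of the energy condition.
  -- Every factor then has a sign: `α ≥ 0 ≥ β`, and `F l l`, `F m m` are nonpositive.
  have h3 : (α - β) * (p / r u * (k + r u ^ 2 / L ^ 2 - N) + 2 * r u / L ^ 2)
        + (β * F l l + α * F l m - β * F l m - α * F m m) / c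
      = (α - β) * (p / r u * (k + r u ^ 2 / L ^ 2 - N) + 2 * r u / L ^ 2 + F l m / c)
        + ((-β) * (-F l l) + α * (-F m m)) / c := by
    ring
  rw [h3]
  refine mul_nonneg (by positivity) (add_nonneg (mul_nonneg (by linarith) hlm')
    (div_nonneg (add_nonneg (mul_nonneg (by linarith) (by linarith))
      (mul_nonneg hl (by linarith))) hc.le))

end IsRadialModel

/-! ### Lorentzian planes -/

/-- The squared norm of the linear form `f` with respect to the symmetric bilinear form `B` on a
plane, computed in the basis `x, y`. -/
def dualNormSq {V : Type*} [AddCommGroup V] [Module ℝ V] (B : V →ₗ[ℝ] V →ₗ[ℝ] ℝ) (f : V →ₗ[ℝ] ℝ)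
    (x y : V) : ℝ :=
  (B y y * f x ^ 2 - 2 * B x y * f x * f y + B x x * f y ^ 2) / (B x x * B y y - B x y ^ 2)

section Plane

variable {V : Type*} [AddCommGroup V] [Module ℝ V] {B : V →ₗ[ℝ] V →ₗ[ℝ] ℝ}

theorem gram_change_basis (hB : ∀ u v, B u v = B v u) (x y : V) (p q s t : ℝ) :
    B (p • x + q • y) (p • x + q • y) * B (s • x + t • y) (s • x + t • y)
        - B (p • x + q • y) (s • x + t • y) ^ 2
      = (p * t - q * s) ^ 2 * (B x x * B y y - B x y ^ 2) := by
  simp only [map_add, map_smul, LinearMap.add_apply, LinearMap.smul_apply, smul_eq_mul, hB y x]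
  ring

/-- Numerator and Gram determinant both scale by the squared determinant of the base change. This
lets one quantity be computed in a chart and in a null frame. -/
theorem dualNormSq_change_basis (hB : ∀ u v, B u v = B v u) (f : V →ₗ[ℝ] ℝ) {x y : V}
    {p q s t : ℝ} (h : p * t - q * s ≠ 0) :
    dualNormSq B f (p • x + q • y) (s • x + t • y) = dualNormSq B f x y := by
  rw [dualNormSq, gram_change_basis hB, dualNormSq,
    ← mul_div_mul_left _ (B x x * B y y - B x y ^ 2) (pow_ne_zero 2 h)]
  congr 1
  simp only [map_add, map_smul, LinearMap.add_apply, LinearMap.smul_apply, smul_eq_mul, hB y x]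
  ring

/-- A future null frame `l = τ' + w`, `m = τ' - w` adapted to a spacelike vector `w`; it points to
the outer side (the side of `w`) and to the inner side. -/
structure IsNullFrame (B : V →ₗ[ℝ] V →ₗ[ℝ] ℝ) (τ w l m : V) : Prop where
  sub_eq : l - m = (2 : ℝ) • w
  left_null : B l l = 0
  right_null : B m m = 0
  left_right : B l m = -(2 * B w w)
  left_future : B l τ < 0
  right_future : B m τ < 0

/-- Remove from `τ` its component along `w` and rescale the rest to squared norm `-B w w`; its sum
with `w` and its difference from `w` are null. -/
theorem exists_isNullFrame (hB : ∀ u v, B u v = B v u) {τ w : V} (hτ : B τ τ < 0) (hw : 0 < B w w) :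
    ∃ l m, IsNullFrame B τ w l m := by
  set c := B w w with hc
  set τ₀ : V := τ - (B τ w / c) • w with hτ₀
  have h0w : B τ₀ w = 0 := by
    simp only [hτ₀, map_sub, map_smul, LinearMap.sub_apply, LinearMap.smul_apply, smul_eq_mul, ← hc]
    field_simp
    ring
  have h0τ : B τ₀ τ = B τ τ - B τ w ^ 2 / c := by
    simp only [hτ₀, map_sub, map_smul, LinearMap.sub_apply, LinearMap.smul_apply, smul_eq_mul,
      hB w τ]
    ring
  have h00 : B τ₀ τ₀ = B τ τ - B τ w ^ 2 / c := by
    rw [← h0τ]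
    nth_rewrite 2 [hτ₀]
    simp [h0w]
  have hneg : B τ τ - B τ w ^ 2 / c < 0 := by
    have : 0 ≤ B τ w ^ 2 / c := by positivity
    linarith
  set D := -(B τ τ - B τ w ^ 2 / c) with hD
  have hDpos : 0 < D := by linarith
  set μ := √(c / D) with hμ
  have hμpos : 0 < μ := Real.sqrt_pos.mpr (by positivity)
  have hμsq : μ ^ 2 * D = c := by
    rw [hμ, Real.sq_sqrt (by positivity)]
    field_simp
  have h00' : B τ₀ τ₀ = -D := by rw [h00, hD]; ring
  have h0τ' : B τ₀ τ = -D := by rw [h0τ, hD]; ring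
  have hw0 : B w τ₀ = 0 := by rw [hB, h0w]
  -- This makes both null vectors future-directed: `B · τ` equals `-μ D` plus or minus `B w τ`.
  have hlt : |B w τ| < μ * D := by
    refine abs_lt_of_sq_lt_sq ?_ (by positivity)
    have h1 : (μ * D) ^ 2 = c * D := by rw [← hμsq]; ring
    have h2 : c * D = B τ w ^ 2 - c * B τ τ := by
      rw [hD]
      field_simp
      ring
    rw [h1, h2, hB w τ]
    nlinarith
  obtain ⟨hlt1, hlt2⟩ := abs_lt.mp hlt
  refine ⟨μ • τ₀ + w, μ • τ₀ - w, ?_, ?_, ?_, ?_, ?_, ?_⟩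
  · rw [two_smul]
    abel
  all_goals
    simp only [map_add, map_sub, map_smul, LinearMap.add_apply, LinearMap.sub_apply,
      LinearMap.smul_apply, smul_eq_mul, h00', h0w, hw0, h0τ', ← hc]
    nlinarith

namespace IsNullFrame

variable {τ w l m : V}

theorem eq_smul_add (h : IsNullFrame B τ w l m) (hB : ∀ u v, B u v = B v u) (hw : 0 < B w w)
    (hV : Module.finrank ℝ V = 2) (x : V) : ∃ a b : ℝ, a • l + b • m = x := by
  have hli : LinearIndependent ℝ ![l, m] := by
    rw [LinearIndependent.pair_iff]
    intro s t hst
    have h1 := congrArg (fun v => B v m) hst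
    have h2 := congrArg (fun v => B v l) hst
    simp only [map_add, map_smul, LinearMap.add_apply, LinearMap.smul_apply, smul_eq_mul, map_zero,
      LinearMap.zero_apply, h.right_null, h.left_null, h.left_right, hB m l] at h1 h2
    constructor <;> nlinarith
  have htop := hli.span_eq_top_of_card_eq_finrank (by simp [hV])
  have hx : x ∈ Submodule.span ℝ (Set.range ![l, m]) := htop ▸ Submodule.mem_top
  rw [Matrix.range_cons, Matrix.range_cons, Matrix.range_empty, union_empty] at hx
  exact Submodule.mem_span_pair.mp hx

theorem left_outer (h : IsNullFrame B τ w l m) : B l w = B w w := by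
  have := congrArg (B l) h.sub_eq
  simp only [map_sub, map_smul, smul_eq_mul, h.left_null, h.left_right] at this
  linarith

theorem right_outer (h : IsNullFrame B τ w l m) (hB : ∀ u v, B u v = B v u) :
    B m w = -B w w := by
  have := congrArg (B m) h.sub_eq
  simp only [map_sub, map_smul, smul_eq_mul, h.right_null, hB m l, h.left_right] at this
  linarith

/-- A null vector of the plane lies on one of the two lines of the frame. The side of `w` selects
the line and the time orientation makes the factor positive, so conditions on all null vectors
reduce to `l` and `m`. -/
theorem eq_smul_of_null (h : IsNullFrame B τ w l m) (hB : ∀ u v, B u v = B v u) (hw : 0 < B w w)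
    (hV : Module.finrank ℝ V = 2) {x : V} (hx : B x x = 0) (hxτ : B x τ < 0) :
    (0 < B x w → ∃ a : ℝ, 0 < a ∧ x = a • l) ∧ (B x w < 0 → ∃ a : ℝ, 0 < a ∧ x = a • m) := by
  obtain ⟨a, b, rfl⟩ := h.eq_smul_add hB hw hV x
  have hl := h.left_future
  have hm := h.right_future
  simp only [map_add, map_smul, LinearMap.add_apply, LinearMap.smul_apply, smul_eq_mul,
    h.right_null, h.left_null, h.left_right, hB m l, h.left_outer, h.right_outer hB] at hx hxτ ⊢
  have hab : a * b = 0 := by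
    have : (a * b) * B w w = 0 := by linarith
    exact (mul_eq_zero.mp this).resolve_right hw.ne'
  rcases mul_eq_zero.mp hab with rfl | rfl
  · have hb : 0 < b := by nlinarith
    exact ⟨fun h1 => by nlinarith, fun _ => ⟨b, hb, by simp⟩⟩
  · have ha : 0 < a := by nlinarith
    exact ⟨fun _ => ⟨a, ha, by simp⟩, fun h1 => by nlinarith⟩

theorem dualNormSq_eq (h : IsNullFrame B τ w l m) (f : V →ₗ[ℝ] ℝ) (hw : 0 < B w w) :
    dualNormSq B f l m = -(f l * f m) / B w w := by
  rw [dualNormSq, h.left_null, h.right_null, h.left_right]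
  field_simp
  ring

theorem apply_eq (h : IsNullFrame B τ w l m) (f : V →ₗ[ℝ] ℝ) : f w = (f l - f m) / 2 := by
  have := congrArg f h.sub_eq
  simp only [map_sub, map_smul, smul_eq_mul] at this
  linarith

/-- A bilinear form that is nonnegative on pairs of timelike vectors in the same half of the light
cone is nonnegative on the vectors of a future null frame. -/
theorem nonneg_of_nonneg_on_timelike (h : IsNullFrame B τ w l m) (hB : ∀ u v, B u v = B v u)
    (hw : 0 < B w w) {A : V →ₗ[ℝ] V →ₗ[ℝ] ℝ}
    (hA : ∀ u v, B u u < 0 → B v v < 0 → B u v < 0 → 0 ≤ A u v) :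
    0 ≤ A l l ∧ 0 ≤ A m m ∧ 0 ≤ A l m := by
  -- The null vectors are limits of the timelike vectors `l + ε m` and `m + ε l`; the form evaluated
  -- on these is a polynomial in `ε`.
  have key : ∀ a b x : ℝ, (∀ ε : ℝ, 0 < ε → 0 ≤ a + ε * b + ε ^ 2 * x) → 0 ≤ a := by
    intro a b x hε
    have hlim : Tendsto (fun ε : ℝ => a + ε * b + ε ^ 2 * x) (𝓝[>] 0) (𝓝 a) := by
      have : Continuous fun ε : ℝ => a + ε * b + ε ^ 2 * x := by fun_prop
      have h1 := this.tendsto 0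
      simp only [zero_mul, add_zero, ne_eq, OfNat.ofNat_ne_zero, not_false_eq_true, zero_pow] at h1
      exact h1.mono_left nhdsWithin_le_nhds
    exact ge_of_tendsto hlim (eventually_nhdsWithin_of_forall fun ε hε' => hε ε hε')
  have hml : B m l = -(2 * B w w) := by rw [hB, h.left_right]
  refine ⟨key _ (A l m + A m l) (A m m) fun ε hε => ?_,
    key _ (A l m + A m l) (A l l) fun ε hε => ?_,
    key _ (A l l + A m m) (A m l) fun ε hε => ?_⟩
  · have := hA (l + ε • m) (l + ε • m)
    simp only [map_add, map_smul, LinearMap.add_apply, LinearMap.smul_apply, smul_eq_mul,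
      h.right_null, h.left_null, h.left_right, hml] at this
    have h1 := this (by nlinarith) (by nlinarith) (by nlinarith)
    linarith
  · have := hA (m + ε • l) (m + ε • l)
    simp only [map_add, map_smul, LinearMap.add_apply, LinearMap.smul_apply, smul_eq_mul,
      h.right_null, h.left_null, h.left_right, hml] at this
    have h1 := this (by nlinarith) (by nlinarith) (by nlinarith)
    linarith
  · have := hA (l + ε • m) (m + ε • l)
    simp only [map_add, map_smul, LinearMap.add_apply, LinearMap.smul_apply, smul_eq_mul,
      h.right_null, h.left_null, h.left_right, hml] at this
    have h1 := this (by nlinarith) (by nlinarith) (by nlinarith [mul_pos hε hε])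
    linarith

end IsNullFrame

end Plane

/-! ### Symmetric spacetimes in coordinates -/

section Chart

variable {Q : Type*} [TopologicalSpace Q] [ChartedSpace (Fin 2 → ℝ) Q]
  {e : OpenPartialHomeomorph Q (Fin 2 → ℝ)} {y : Fin 2 → ℝ}

theorem mdifferentiable_of_mem_maximalAtlas
    (he : e ∈ IsManifold.maximalAtlas 𝓘(ℝ, Fin 2 → ℝ) ∞ Q) :
    e.MDifferentiable 𝓘(ℝ, Fin 2 → ℝ) 𝓘(ℝ, Fin 2 → ℝ) :=
  ⟨(contMDiffOn_of_mem_maximalAtlas he).mdifferentiableOn (by simp),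
    (contMDiffOn_symm_of_mem_maximalAtlas he).mdifferentiableOn (by simp)⟩

theorem mfderiv_symm_eq_sum_coordVec (x : Fin 2 → ℝ) :
    mfderiv 𝓘(ℝ, Fin 2 → ℝ) 𝓘(ℝ, Fin 2 → ℝ) e.symm y x = ∑ a, x a • coordVec e y a := by
  set A : (Fin 2 → ℝ) →L[ℝ] TangentSpace 𝓘(ℝ, Fin 2 → ℝ) (e.symm y) :=
    mfderiv 𝓘(ℝ, Fin 2 → ℝ) 𝓘(ℝ, Fin 2 → ℝ) e.symm y with hA
  have hx : x = ∑ a, x a • (Pi.single a (1 : ℝ) : Fin 2 → ℝ) := by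
    ext i
    simp [Finset.sum_apply, Pi.single_apply]
  change A x = ∑ a, x a • A (Pi.single a (1 : ℝ) : Fin 2 → ℝ)
  conv_lhs => rw [hx]
  rw [map_sum]
  simp only [map_smul]

/-- The components of a tangent vector in a chart. -/
def components (e : OpenPartialHomeomorph Q (Fin 2 → ℝ)) (q : Q)
    (v : TangentSpace 𝓘(ℝ, Fin 2 → ℝ) q) : Fin 2 → ℝ :=
  mfderiv 𝓘(ℝ, Fin 2 → ℝ) 𝓘(ℝ, Fin 2 → ℝ) e q v

theorem sum_components_smul_coordVec (he : e ∈ IsManifold.maximalAtlas 𝓘(ℝ, Fin 2 → ℝ) ∞ Q)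
    (hy : y ∈ e.target) (v : TangentSpace 𝓘(ℝ, Fin 2 → ℝ) (e.symm y)) :
    ∑ a, components e (e.symm y) v a • coordVec e y a = v := by
  rw [← mfderiv_symm_eq_sum_coordVec]
  have h := (mdifferentiable_of_mem_maximalAtlas he).symm_comp_deriv (e.map_target hy)
  rw [e.right_inv hy] at h
  exact congrArg (fun A : TangentSpace 𝓘(ℝ, Fin 2 → ℝ) (e.symm y) →L[ℝ]
    TangentSpace 𝓘(ℝ, Fin 2 → ℝ) (e.symm y) => A v) h

end Chart

namespace SymmetricSpacetime

variable {d : ℕ} {k : ℝ} {Q : Type*} [TopologicalSpace Q] [ChartedSpace (Fin 2 → ℝ) Q]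
  (S : SymmetricSpacetime d k Q) {e : OpenPartialHomeomorph Q (Fin 2 → ℝ)} {y : Fin 2 → ℝ}

/-- The components of the metric on the space of orbits in the chart `e`. -/
def orbitMetric (e : OpenPartialHomeomorph Q (Fin 2 → ℝ)) (y : Fin 2 → ℝ) :
    Matrix (Fin 2) (Fin 2) ℝ :=
  fun a b => S.h (e.symm y) (coordVec e y a) (coordVec e y b)

theorem metricCoord_eq_warpedMetric (e : OpenPartialHomeomorph Q (Fin 2 → ℝ)) :
    S.metricCoord e = warpedMetric k (S.orbitMetric e) fun y => S.r (e.symm y) ^ 2 := by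
  ext x a b
  rcases a with a | a <;> rcases b with b | b <;>
    simp [metricCoord, metric, frame, warpedMetric, orbitMetric, Pi.single_apply]

/-- The differential of the areal radius. -/
def radiusForm (q : Q) : TangentSpace 𝓘(ℝ, Fin 2 → ℝ) q →ₗ[ℝ] ℝ where
  toFun := S.radiusDeriv q
  map_add' u v := map_add (mfderiv 𝓘(ℝ, Fin 2 → ℝ) 𝓘(ℝ, ℝ) S.r q) u v
  map_smul' c u := map_smul (mfderiv 𝓘(ℝ, Fin 2 → ℝ) 𝓘(ℝ, ℝ) S.r q) c u

theorem partialD_radius (he : e ∈ IsManifold.maximalAtlas 𝓘(ℝ, Fin 2 → ℝ) ∞ Q)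
    (hy : y ∈ e.target) (a : Fin 2) :
    partialD a (fun y => S.r (e.symm y)) y = S.radiusForm (e.symm y) (coordVec e y a) := by
  have h1 : MDifferentiableAt 𝓘(ℝ, Fin 2 → ℝ) 𝓘(ℝ, ℝ) S.r (e.symm y) :=
    (S.r_smooth _).mdifferentiableAt (by simp)
  have h2 : MDifferentiableAt 𝓘(ℝ, Fin 2 → ℝ) 𝓘(ℝ, Fin 2 → ℝ) e.symm y :=
    (mdifferentiable_of_mem_maximalAtlas he).mdifferentiableAt_symm hy
  have h3 := mfderiv_comp y h1 h2
  rw [mfderiv_eq_fderiv] at h3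
  exact congrArg (fun A : (Fin 2 → ℝ) →L[ℝ] ℝ => A (Pi.single a 1)) h3

theorem finrank_tangentSpace (q : Q) : Module.finrank ℝ (TangentSpace 𝓘(ℝ, Fin 2 → ℝ) q) = 2 := by
  change Module.finrank ℝ (Fin 2 → ℝ) = 2
  simp

theorem exists_isNullFrame (q : Q) {w : TangentSpace 𝓘(ℝ, Fin 2 → ℝ) q} (hw : 0 < S.h q w w) :
    ∃ l m, IsNullFrame (S.h q) (S.future q) w l m :=
  _root_.exists_isNullFrame (S.h_symm q) (S.future_timelike q) hw

/-- A null frame has nonzero Gram determinant, and any spanning pair reproduces it up to a square;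
hence the metric is nondegenerate in every frame. -/
theorem gram_ne_zero {q : Q} {x₀ x₁ : TangentSpace 𝓘(ℝ, Fin 2 → ℝ) q}
    (hspan : ∀ v, ∃ a b : ℝ, v = a • x₀ + b • x₁) :
    S.h q x₀ x₀ * S.h q x₁ x₁ - S.h q x₀ x₁ ^ 2 ≠ 0 := by
  obtain ⟨w, hw⟩ := S.exists_spacelike q
  obtain ⟨l, m, hlm⟩ := S.exists_isNullFrame q hw
  obtain ⟨a, b, hl⟩ := hspan l
  obtain ⟨a', b', hm⟩ := hspan m
  intro h0
  have h := gram_change_basis (S.h_symm q) x₀ x₁ a b a' b'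
  rw [← hl, ← hm, h0, hlm.left_null, hlm.right_null, hlm.left_right] at h
  nlinarith

theorem span_coordVec (he : e ∈ IsManifold.maximalAtlas 𝓘(ℝ, Fin 2 → ℝ) ∞ Q)
    (hy : y ∈ e.target) (v : TangentSpace 𝓘(ℝ, Fin 2 → ℝ) (e.symm y)) :
    ∃ a b : ℝ, v = a • coordVec e y 0 + b • coordVec e y 1 := by
  refine ⟨components e _ v 0, components e _ v 1,
    (sum_components_smul_coordVec he hy v).symm.trans ?_⟩
  rw [Fin.sum_univ_two]

theorem isRadialModel (he : e ∈ IsManifold.maximalAtlas 𝓘(ℝ, Fin 2 → ℝ) ∞ Q) :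
    IsRadialModel (S.orbitMetric e) (fun y => S.r (e.symm y)) e.target where
  isOpen := e.open_target
  smooth_metric a b := S.h_smooth e he a b
  smooth_radius := by
    rw [← contMDiffOn_iff_contDiffOn]
    exact S.r_smooth.comp_contMDiffOn (contMDiffOn_symm_of_mem_maximalAtlas he)
  det_ne_zero y hy := by
    rw [Matrix.det_fin_two]
    have h := S.gram_ne_zero (span_coordVec he hy)
    have h1 : S.orbitMetric e y 1 0 = S.orbitMetric e y 0 1 := S.h_symm _ _ _
    rw [h1, ← pow_two]
    exact h
  symm y a b := S.h_symm _ _ _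
  radius_pos y _ := S.r_pos _

/-- The squared norm `|∇r|²` of the gradient of the areal radius. -/
def gradSq (q : Q) : ℝ :=
  dualNormSq (S.h q) (S.radiusForm q) (Pi.single 0 1 : Fin 2 → ℝ) (Pi.single 1 1 : Fin 2 → ℝ)

/-- The definition uses the standard basis of the model space underlying the tangent space; by
invariance any basis gives the same value. -/
theorem gradSq_eq_dualNormSq {q : Q} {x₀ x₁ : TangentSpace 𝓘(ℝ, Fin 2 → ℝ) q}
    (h : S.h q x₀ x₀ * S.h q x₁ x₁ - S.h q x₀ x₁ ^ 2 ≠ 0) :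
    S.gradSq q = dualNormSq (S.h q) (S.radiusForm q) x₀ x₁ := by
  have hx : ∀ x : TangentSpace 𝓘(ℝ, Fin 2 → ℝ) q, ∃ a b : ℝ,
      x = a • (show TangentSpace 𝓘(ℝ, Fin 2 → ℝ) q from (Pi.single 0 1 : Fin 2 → ℝ))
        + b • (show TangentSpace 𝓘(ℝ, Fin 2 → ℝ) q from (Pi.single 1 1 : Fin 2 → ℝ)) := by
    intro x
    refine ⟨(show Fin 2 → ℝ from x) 0, (show Fin 2 → ℝ from x) 1, ?_⟩
    change (show Fin 2 → ℝ from x) = (show Fin 2 → ℝ from x) 0 • (Pi.single 0 1 : Fin 2 → ℝ)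
      + (show Fin 2 → ℝ from x) 1 • (Pi.single 1 1 : Fin 2 → ℝ)
    ext i
    fin_cases i <;> simp
  obtain ⟨a, b, ha⟩ := hx x₀
  obtain ⟨a', b', hb⟩ := hx x₁
  rw [ha, hb, gram_change_basis (S.h_symm q)] at h
  rw [ha, hb, dualNormSq_change_basis (S.h_symm q)]
  · rfl
  · intro h0
    rw [h0] at h
    simp at h

theorem gradSq_symm_apply (he : e ∈ IsManifold.maximalAtlas 𝓘(ℝ, Fin 2 → ℝ) ∞ Q)
    (hy : y ∈ e.target) :
    S.gradSq (e.symm y) = gradNormSq (S.orbitMetric e) (fun y => S.r (e.symm y)) y := by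
  have h := S.gram_ne_zero (span_coordVec he hy)
  have hdet := (S.isRadialModel he).det_ne_zero y hy
  rw [S.gradSq_eq_dualNormSq h, dualNormSq]
  simp only [gradNormSq, metricGradient, S.partialD_radius he hy, Matrix.inv_def,
    Matrix.adjugate_fin_two, Ring.inverse_eq_inv', Fin.sum_univ_two, Matrix.smul_apply]
  have hd : (S.orbitMetric e y).det = S.h (e.symm y) (coordVec e y 0) (coordVec e y 0)
      * S.h (e.symm y) (coordVec e y 1) (coordVec e y 1)
      - S.h (e.symm y) (coordVec e y 0) (coordVec e y 1) ^ 2 := by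
    rw [Matrix.det_fin_two]
    simp only [orbitMetric, S.h_symm _ (coordVec e y 1) (coordVec e y 0)]
    ring
  rw [hd]
  simp only [orbitMetric, S.h_symm _ (coordVec e y 1) (coordVec e y 0)]
  simp
  field_simp
  ring

end SymmetricSpacetime

/-! ### The mass of an orbit and marginally trapped orbits -/

namespace SymmetricSpacetime

variable {p : ℕ} {k : ℝ} {Q : Type*} [TopologicalSpace Q] [ChartedSpace (Fin 2 → ℝ) Q]
  (S : SymmetricSpacetime (p + 2) k Q) {e : OpenPartialHomeomorph Q (Fin 2 → ℝ)} {y : Fin 2 → ℝ}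

/-- The renormalized Misner-Sharp mass of an orbit. -/
def orbitMass (L : ℝ) (q : Q) : ℝ := S.r q ^ p * (k + S.r q ^ 2 / L ^ 2 - S.gradSq q)

theorem orbitMass_symm_apply (he : e ∈ IsManifold.maximalAtlas 𝓘(ℝ, Fin 2 → ℝ) ∞ Q)
    (hy : y ∈ e.target) (L : ℝ) :
    S.orbitMass L (e.symm y)
      = misnerSharp k L p (S.orbitMetric e) (fun y => S.r (e.symm y)) y := by
  rw [orbitMass, misnerSharp, S.gradSq_symm_apply he hy]

theorem bilinear_eq_sum_components (he : e ∈ IsManifold.maximalAtlas 𝓘(ℝ, Fin 2 → ℝ) ∞ Q)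
    (hy : y ∈ e.target)
    (A : TangentSpace 𝓘(ℝ, Fin 2 → ℝ) (e.symm y) →ₗ[ℝ]
      TangentSpace 𝓘(ℝ, Fin 2 → ℝ) (e.symm y) →ₗ[ℝ] ℝ)
    (u v : TangentSpace 𝓘(ℝ, Fin 2 → ℝ) (e.symm y)) :
    A u v = ∑ a, ∑ b, A (coordVec e y a) (coordVec e y b)
      * components e (e.symm y) u a * components e (e.symm y) v b := by
  conv_lhs => rw [← sum_components_smul_coordVec he hy u, ← sum_components_smul_coordVec he hy v]
  simp only [Fin.sum_univ_two, map_add, map_smul, LinearMap.add_apply, LinearMap.smul_apply,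
    smul_eq_mul]
  ring

theorem radiusForm_eq_sum_components (he : e ∈ IsManifold.maximalAtlas 𝓘(ℝ, Fin 2 → ℝ) ∞ Q)
    (hy : y ∈ e.target) (u : TangentSpace 𝓘(ℝ, Fin 2 → ℝ) (e.symm y)) :
    S.radiusForm (e.symm y) u
      = ∑ a, components e (e.symm y) u a * partialD a (fun y => S.r (e.symm y)) y := by
  conv_lhs => rw [← sum_components_smul_coordVec he hy u]
  simp only [Fin.sum_univ_two, map_add, map_smul, smul_eq_mul, S.partialD_radius he hy]

theorem orbitMass_deriv_nonneg {L G : ℝ} (hG : 0 < G)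
    {T : ∀ q : Q, (Fin (p + 2 - 1) → ℝ) → SpacetimeVec (p + 2) q →ₗ[ℝ]
      SpacetimeVec (p + 2) q →ₗ[ℝ] ℝ}
    (hEinstein : S.EinsteinEquations L G T) (hDEC : S.DominantEnergyCondition T)
    (he : e ∈ IsManifold.maximalAtlas 𝓘(ℝ, Fin 2 → ℝ) ∞ Q) (hy : y ∈ e.target)
    {τ w l m : TangentSpace 𝓘(ℝ, Fin 2 → ℝ) (e.symm y)}
    (hlm : IsNullFrame (S.h (e.symm y)) τ w l m) (hw : 0 < S.h (e.symm y) w w)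
    (hl : 0 ≤ S.radiusForm _ l) (hm : S.radiusForm _ m ≤ 0) :
    0 ≤ ∑ a, components e (e.symm y) w a
      * partialD a (misnerSharp k L p (S.orbitMetric e) (fun y => S.r (e.symm y))) y := by
  have hB := S.h_symm (e.symm y)
  -- Only the matter tensor at the fibre origin, restricted to vectors orthogonal to the orbit,
  -- enters.
  set ι := LinearMap.inl ℝ (TangentSpace 𝓘(ℝ, Fin 2 → ℝ) (e.symm y)) (Fin (p + 2 - 1) → ℝ) with hι
  set A := (T (e.symm y) 0).compl₁₂ ι ι with hA
  obtain ⟨hA1, hA2, hA3⟩ := hlm.nonneg_of_nonneg_on_timelike hB hw (A := A) fun u v hu hv huv => by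
    have hS : ∀ u v : TangentSpace 𝓘(ℝ, Fin 2 → ℝ) (e.symm y),
        S.metric (e.symm y) 0 (ι u) (ι v) = S.h (e.symm y) u v := by
      intro u v
      simp [metric, hι]
    exact hDEC (e.symm y) 0 (zero_mem_fiberDomain k _) (ι u) (ι v) (by rwa [hS]) (by rwa [hS])
      (by rwa [hS])
  set E : Fin 2 → Fin 2 → ℝ := fun a b => 8 * Real.pi * G * A (coordVec e y a) (coordVec e y b)
    with hE
  have hEsum : ∀ u v, ∑ a, ∑ b, E a b * components e (e.symm y) u a * components e (e.symm y) v b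
      = 8 * Real.pi * G * A u v := by
    intro u v
    rw [bilinear_eq_sum_components he hy A u v]
    simp only [hE, Fin.sum_univ_two]
    ring
  have hHsum : ∀ u v, ∑ a, ∑ b, S.orbitMetric e y a b * components e (e.symm y) u a
      * components e (e.symm y) v b = S.h (e.symm y) u v :=
    fun u v => (bilinear_eq_sum_components he hy (S.h (e.symm y)) u v).symm
  have hEeq : ∀ a b, E a b = einstein (warpedMetric (n := p + 1) k (S.orbitMetric e)
      fun u => S.r (e.symm u) ^ 2) (Sum.inl a) (Sum.inl b) (Sum.elim y 0)
      - (p + 1) * (p + 2) / (2 * L ^ 2) * S.orbitMetric e y a b := by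
    intro a b
    have h := hEinstein e he y hy 0 (zero_mem_fiberDomain k _) (Sum.inl a) (Sum.inl b)
    rw [S.metricCoord_eq_warpedMetric e] at h
    refine (Eq.trans ?_ h.symm).trans ?_
    · rfl
    · have hc : ((p + 2 : ℕ) : ℝ) * (((p + 2 : ℕ) : ℝ) - 1) / (2 * L ^ 2)
          = (p + 1) * (p + 2) / (2 * L ^ 2) := by
        push_cast
        ring
      rw [hc]
      rfl
  have hfac : 0 ≤ 8 * Real.pi * G := by positivity
  have hmain := (S.isRadialModel he).misnerSharp_deriv_nonneg hy k L p (c := S.h (e.symm y) w w)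
    (l := components e (e.symm y) l) (m := components e (e.symm y) m) (E := E) hw
    (by rw [hHsum, hlm.left_null]) (by rw [hHsum, hlm.right_null])
    (by rw [hHsum, hlm.left_right]) (by rwa [← S.radiusForm_eq_sum_components he hy])
    (by rwa [← S.radiusForm_eq_sum_components he hy]) hEeq
    (by rw [hEsum]; exact mul_nonneg hfac hA1) (by rw [hEsum]; exact mul_nonneg hfac hA2)
    (by rw [hEsum]; exact mul_nonneg hfac hA3)
  have hcomp : ∀ a, components e (e.symm y) l a - components e (e.symm y) m a
      = 2 * components e (e.symm y) w a := by
    intro a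
    have h1 : components e (e.symm y) (l - m) = components e (e.symm y) l
        - components e (e.symm y) m :=
      map_sub (mfderiv 𝓘(ℝ, Fin 2 → ℝ) 𝓘(ℝ, Fin 2 → ℝ) e (e.symm y)) l m
    have h2 : components e (e.symm y) ((2 : ℝ) • w) = (2 : ℝ) • components e (e.symm y) w :=
      map_smul (mfderiv 𝓘(ℝ, Fin 2 → ℝ) 𝓘(ℝ, Fin 2 → ℝ) e (e.symm y)) 2 w
    rw [hlm.sub_eq, h2] at h1
    exact (congrFun h1 a).symm
  simp only [hcomp, mul_assoc, ← Finset.mul_sum] at hmain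
  linarith

/-- An orbit is marginally trapped, to the future or to the past, when `|∇r|² = 0` and the areal
radius does not decrease to the outside. -/
theorem isMarginallyTrapped_or_of_gradSq_eq_zero {q : Q}
    {w : TangentSpace 𝓘(ℝ, Fin 2 → ℝ) q} (hw : 0 < S.h q w w) (h0 : S.gradSq q = 0)
    (hr : 0 ≤ S.radiusForm q w) :
    S.IsMarginallyTrapped q w ∨ S.IsPastMarginallyTrapped q w := by
  obtain ⟨l, m, hlm⟩ := S.exists_isNullFrame q hw
  have hB := S.h_symm q
  have hV := finrank_tangentSpace q
  have hgram : S.h q l l * S.h q m m - S.h q l m ^ 2 ≠ 0 := by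
    rw [hlm.left_null, hlm.right_null, hlm.left_right]
    nlinarith
  rw [S.gradSq_eq_dualNormSq hgram, hlm.dualNormSq_eq _ hw] at h0
  rw [hlm.apply_eq] at hr
  have hrpos := S.r_pos q
  have hprod : S.radiusForm q l * S.radiusForm q m = 0 := by
    rcases div_eq_zero_iff.mp h0 with h | h
    · linarith
    · exact absurd h hw.ne'
  have hexp : ∀ x, S.expansion q x = ((p : ℝ) + 1) * S.radiusForm q x / S.r q := by
    intro x
    change (((p + 2 : ℕ) : ℝ) - 1) * S.radiusForm q x / S.r q = _
    push_cast
    ring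
  -- Since `l(r) ≥ m(r)` and one of them vanishes, either `l(r) = 0 ≥ m(r)`, the future case, or
  -- `m(r) = 0 ≤ l(r)`, the past case.
  rcases mul_eq_zero.mp hprod with hl | hm
  · left
    intro x hx hxτ
    obtain ⟨h1, h2⟩ := hlm.eq_smul_of_null hB hw hV hx hxτ
    refine ⟨fun h => ?_, fun h => ?_⟩
    · obtain ⟨a, -, rfl⟩ := h1 h
      rw [hexp, map_smul, hl]
      simp
    · obtain ⟨a, ha, rfl⟩ := h2 h
      rw [hexp, map_smul, smul_eq_mul]
      refine div_nonpos_of_nonpos_of_nonneg (mul_nonpos_of_nonneg_of_nonpos (by positivity) ?_)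
        hrpos.le
      exact mul_nonpos_of_nonneg_of_nonpos ha.le (by linarith)
  · right
    intro x hx hxτ
    -- Negation turns the past null vector `x` into a future one but exchanges the sides: an outward
    -- `x` is a negative multiple of `m`.
    have hx' : S.h q (-x) (-x) = 0 := by simpa using hx
    have hxτ' : S.h q (-x) (S.future q) < 0 := by simpa using hxτ
    obtain ⟨h1, h2⟩ := hlm.eq_smul_of_null hB hw hV hx' hxτ'
    refine ⟨fun h => ?_, fun h => ?_⟩
    · obtain ⟨a, -, h3⟩ := h2 (by simpa using h)
      rw [neg_eq_iff_eq_neg.mp h3, hexp, map_neg, map_smul, hm]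
      simp
    · obtain ⟨a, ha, h3⟩ := h1 (by simpa using h)
      rw [neg_eq_iff_eq_neg.mp h3, hexp, map_neg, map_smul, smul_eq_mul]
      refine div_nonpos_of_nonpos_of_nonneg (mul_nonpos_of_nonneg_of_nonpos (by positivity) ?_)
        hrpos.le
      exact neg_nonpos.mpr (mul_nonneg ha.le (by linarith))

theorem gradSq_eq_neg_mul_div {q : Q} {w l m : TangentSpace 𝓘(ℝ, Fin 2 → ℝ) q}
    {τ : TangentSpace 𝓘(ℝ, Fin 2 → ℝ) q}
    (hlm : IsNullFrame (S.h q) τ w l m) (hw : 0 < S.h q w w) :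
    S.gradSq q = -(S.radiusForm q l * S.radiusForm q m) / S.h q w w := by
  have hgram : S.h q l l * S.h q m m - S.h q l m ^ 2 ≠ 0 := by
    rw [hlm.left_null, hlm.right_null, hlm.left_right]
    nlinarith
  rw [S.gradSq_eq_dualNormSq hgram, hlm.dualNormSq_eq _ hw]

theorem gradSq_eq_zero_of_isMarginallyTrapped {q : Q} {w : TangentSpace 𝓘(ℝ, Fin 2 → ℝ) q}
    (hw : 0 < S.h q w w) (h : S.IsMarginallyTrapped q w) : S.gradSq q = 0 := by
  obtain ⟨l, m, hlm⟩ := S.exists_isNullFrame q hw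
  have h1 := (h l hlm.left_null hlm.left_future).1 (by rwa [hlm.left_outer])
  have h2 : (((p + 2 : ℕ) : ℝ) - 1) * S.radiusForm q l / S.r q = 0 := h1
  have h3 : (((p + 2 : ℕ) : ℝ) - 1) ≠ 0 := by
    push_cast
    have : (0 : ℝ) ≤ p := p.cast_nonneg
    linarith
  have h4 : S.radiusForm q l = 0 := by
    rcases div_eq_zero_iff.mp h2 with h5 | h5
    · exact (mul_eq_zero.mp h5).resolve_left h3
    · exact absurd h5 (S.r_pos q).ne'
  rw [S.gradSq_eq_neg_mul_div hlm hw, h4]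
  simp

/-- If `w(r) = 0` then `l(r) = m(r)`, and `|∇r|²` would be minus a square over `B w w`. -/
theorem radiusForm_ne_zero_of_gradSq_pos {q : Q} {w : TangentSpace 𝓘(ℝ, Fin 2 → ℝ) q}
    (hw : 0 < S.h q w w) (h : 0 < S.gradSq q) : S.radiusForm q w ≠ 0 := by
  obtain ⟨l, m, hlm⟩ := S.exists_isNullFrame q hw
  rw [S.gradSq_eq_neg_mul_div hlm hw] at h
  rw [hlm.apply_eq]
  intro h0
  have h1 : S.radiusForm q l = S.radiusForm q m := by linarith
  have h2 := (div_pos_iff_of_pos_right hw).mp h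
  rw [h1] at h2
  nlinarith [sq_nonneg (S.radiusForm q m)]

end SymmetricSpacetime

/-! ### Continuity arguments on the half-line -/

/-- The set where both functions are positive is nonempty, open and relatively closed in the
connected `(0, ∞)`. It is applied to `|∇r|²` and the derivative of `r` along the slice. -/
theorem pos_of_continuousOn_of_eventually_pos {f g : ℝ → ℝ} (hf : ContinuousOn f (Ioi 0))
    (hg : ContinuousOn g (Ioi 0)) (hev : ∀ᶠ s in atTop, 0 < f s ∧ 0 < g s)
    (hclosed : ∀ s, 0 < s → 0 ≤ f s → 0 ≤ g s → 0 < f s ∧ 0 < g s) {s : ℝ} (hs : 0 < s) :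
    0 < f s ∧ 0 < g s := by
  set u := (Ioi 0 ∩ f ⁻¹' Ioi 0) ∩ (Ioi 0 ∩ g ⁻¹' Ioi 0) with hu
  have huo : IsOpen u := (hf.isOpen_inter_preimage isOpen_Ioi isOpen_Ioi).inter
    (hg.isOpen_inter_preimage isOpen_Ioi isOpen_Ioi)
  have hsub : Ioi (0 : ℝ) ⊆ u := by
    refine isPreconnected_Ioi.subset_of_closure_inter_subset huo ?_ ?_
    · obtain ⟨s, hs1, hs2⟩ := (hev.and (eventually_gt_atTop 0)).exists
      exact ⟨s, hs2, ⟨hs2, hs1.1⟩, ⟨hs2, hs1.2⟩⟩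
    · rintro x ⟨hxu, hx⟩
      have h0 : ∀ {f : ℝ → ℝ}, ContinuousOn f (Ioi 0) → (∀ y ∈ u, 0 < f y) → 0 ≤ f x := by
        intro f hf hfu
        have hfx : ContinuousAt f x := hf.continuousAt (Ioi_mem_nhds hx)
        have : (𝓝[u] x).NeBot := mem_closure_iff_nhdsWithin_neBot.mp hxu
        exact ge_of_tendsto (hfx.mono_left nhdsWithin_le_nhds)
          (eventually_nhdsWithin_of_forall fun y hy => (hfu y hy).le)
      obtain ⟨h1, h2⟩ := hclosed x hx (h0 hf fun y hy => hy.1.2) (h0 hg fun y hy => hy.2.2)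
      exact ⟨⟨hx, h1⟩, ⟨hx, h2⟩⟩
  exact ⟨(hsub hs).1.2, (hsub hs).2.2⟩

/-- A continuous derivative without zeros keeps its sign, and the negative sign is incompatible with
divergence to `+∞`. -/
theorem eventually_deriv_pos_of_tendsto_atTop {f : ℝ → ℝ} {a : ℝ}
    (hf : ∀ s, a < s → DifferentiableAt ℝ f s) (hf' : ContinuousOn (deriv f) (Ioi a))
    (hne : ∀ᶠ s in atTop, deriv f s ≠ 0) (hlim : Tendsto f atTop atTop) :
    ∀ᶠ s in atTop, 0 < deriv f s := by
  obtain ⟨b, hb⟩ := eventually_atTop.mp (hne.and (eventually_gt_atTop a))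
  have hba : a < b := (hb b le_rfl).2
  have hIci : Ici b ⊆ Ioi a := fun x hx => hba.trans_le hx
  have hcont : ContinuousOn (deriv f) (Ici b) := hf'.mono hIci
  by_cases hpos : ∃ c, b ≤ c ∧ 0 < deriv f c
  · obtain ⟨c, hbc, hc⟩ := hpos
    filter_upwards [eventually_ge_atTop b] with s hs
    by_contra hneg
    obtain ⟨x, hx, hx0⟩ := isPreconnected_Ici.intermediate_value (a := s) (b := c) hs hbc hcont
      ⟨not_lt.mp hneg, hc.le⟩
    exact (hb x hx).1 hx0
  · push Not at hpos
    have hanti : AntitoneOn f (Ici b) := by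
      refine antitoneOn_of_deriv_nonpos (convex_Ici b)
        (fun x hx => (hf x (hIci hx)).continuousAt.continuousWithinAt)
        (fun x hx => (hf x (hIci (interior_subset hx))).differentiableWithinAt) fun x hx => ?_
      exact hpos x (interior_subset hx)
    obtain ⟨s, hs1, hs2⟩ := ((hlim.eventually_gt_atTop (f b)).and (eventually_ge_atTop b)).exists
    exact absurd (hanti (mem_Ici.mpr le_rfl) hs2 hs2) (not_le.mpr hs1)

/-! ### Monotonicity of the mass along a spacelike slice -/

namespace SymmetricSpacetime

section Slice

variable {d : ℕ} {k : ℝ} {Q : Type*} [TopologicalSpace Q] [ChartedSpace (Fin 2 → ℝ) Q]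
  {S : SymmetricSpacetime d k Q} {L : ℝ} {B : S.AdSBoundary L} {σ : Q} {t₀ : ℝ} {γ : ℝ → Q}

theorem velocity_eq (γ : ℝ → Q) {s : ℝ} (hs : 0 < s) :
    velocity γ s = mfderiv 𝓘(ℝ, ℝ) 𝓘(ℝ, Fin 2 → ℝ) γ s (1 : ℝ) := by
  rw [velocity, mfderivWithin_of_mem_nhds (Ici_mem_nhds hs)]

theorem IsSpacelikeSlice.contDiffOn_radius (h : S.IsSpacelikeSlice B σ t₀ γ) :
    ContDiffOn ℝ 1 (fun s => S.r (γ s)) (Ici 0) := by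
  rw [← contMDiffOn_iff_contDiffOn]
  exact (S.r_smooth.of_le (by simp)).comp_contMDiffOn h.contMDiffOn

theorem IsSpacelikeSlice.mdifferentiableAt (h : S.IsSpacelikeSlice B σ t₀ γ) {s : ℝ} (hs : 0 < s) :
    MDifferentiableAt 𝓘(ℝ, ℝ) 𝓘(ℝ, Fin 2 → ℝ) γ s :=
  (h.contMDiffOn.contMDiffAt (Ici_mem_nhds hs)).mdifferentiableAt (by simp)

theorem IsSpacelikeSlice.deriv_radius (h : S.IsSpacelikeSlice B σ t₀ γ) {s : ℝ} (hs : 0 < s) :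
    deriv (fun s => S.r (γ s)) s = S.radiusForm (γ s) (velocity γ s) := by
  have h1 : MDifferentiableAt 𝓘(ℝ, Fin 2 → ℝ) 𝓘(ℝ, ℝ) S.r (γ s) :=
    (S.r_smooth _).mdifferentiableAt (by simp)
  have h3 := mfderiv_comp s h1 (h.mdifferentiableAt hs)
  rw [mfderiv_eq_fderiv] at h3
  rw [velocity_eq γ hs, ← fderiv_apply_one_eq_deriv]
  exact congrArg (fun A : ℝ →L[ℝ] ℝ => A 1) h3

theorem IsSpacelikeSlice.hasDerivAt_chart (h : S.IsSpacelikeSlice B σ t₀ γ) {s : ℝ} (hs : 0 < s)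
    {e : OpenPartialHomeomorph Q (Fin 2 → ℝ)}
    (he : e ∈ IsManifold.maximalAtlas 𝓘(ℝ, Fin 2 → ℝ) ∞ Q) (hse : γ s ∈ e.source) :
    HasDerivAt (fun s => e (γ s)) (components e (γ s) (velocity γ s)) s := by
  have h1 : MDifferentiableAt 𝓘(ℝ, Fin 2 → ℝ) 𝓘(ℝ, Fin 2 → ℝ) e (γ s) :=
    (mdifferentiable_of_mem_maximalAtlas he).mdifferentiableAt hse
  have h2 := h1.comp s (h.mdifferentiableAt hs)
  have h3 := mfderiv_comp s h1 (h.mdifferentiableAt hs)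
  rw [mfderiv_eq_fderiv] at h3
  have h4 : DifferentiableAt ℝ (fun s => e (γ s)) s := mdifferentiableAt_iff_differentiableAt.mp h2
  have h5 := h4.hasDerivAt
  rw [← fderiv_apply_one_eq_deriv] at h5
  rw [velocity_eq γ hs]
  exact h5.congr_deriv (congrArg (fun A : ℝ →L[ℝ] (Fin 2 → ℝ) => A 1) h3)

theorem IsSpacelikeSlice.hasDerivAt_orbitMass {p : ℕ}
    {S : SymmetricSpacetime (p + 2) k Q} {B : S.AdSBoundary L} (h : S.IsSpacelikeSlice B σ t₀ γ)
    {s : ℝ} (hs : 0 < s)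
    {e : OpenPartialHomeomorph Q (Fin 2 → ℝ)}
    (he : e ∈ IsManifold.maximalAtlas 𝓘(ℝ, Fin 2 → ℝ) ∞ Q) (hse : γ s ∈ e.source) (L : ℝ) :
    HasDerivAt (fun s => S.orbitMass L (γ s)) (∑ a, components e (γ s) (velocity γ s) a
      * partialD a (misnerSharp k L p (S.orbitMetric e) (fun y => S.r (e.symm y)))
        (e (γ s))) s := by
  set F := misnerSharp k L p (S.orbitMetric e) (fun y => S.r (e.symm y)) with hF
  have hd : DifferentiableAt ℝ F (e (γ s)) :=
    ((S.isRadialModel he).smooth_misnerSharp k L p).differentiableAt_of_isOpen e.open_target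
      (e.map_source hse)
  have h1 := hd.hasFDerivAt.comp_hasDerivAt s (h.hasDerivAt_chart hs he hse)
  have h2 : (fun s => S.orbitMass L (γ s)) =ᶠ[𝓝 s] F ∘ fun s => e (γ s) := by
    filter_upwards [(h.mdifferentiableAt hs).continuousAt.eventually_mem
      (e.open_source.mem_nhds hse)] with x hx
    simp only [Function.comp_apply, hF]
    rw [← S.orbitMass_symm_apply he (e.map_source hx), e.left_inv hx]
  refine (h1.congr_of_eventuallyEq h2).congr_deriv ?_
  set v := components e (γ s) (velocity γ s) with hv
  have hx : v = ∑ a, v a • (Pi.single a (1 : ℝ) : Fin 2 → ℝ) := by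
    ext i
    simp [Finset.sum_apply, Pi.single_apply]
  conv_lhs => rw [hx]
  rw [map_sum]
  simp only [map_smul, smul_eq_mul, partialD]

end Slice

variable {p : ℕ} {k : ℝ} {Q : Type*} [TopologicalSpace Q] [ChartedSpace (Fin 2 → ℝ) Q]
  [IsManifold 𝓘(ℝ, Fin 2 → ℝ) ∞ Q]
  (S : SymmetricSpacetime (p + 2) k Q)

theorem continuous_gradSq : Continuous S.gradSq := by
  rw [continuous_iff_continuousAt]
  intro q
  set e := chartAt (Fin 2 → ℝ) q with he
  have hmem : e ∈ IsManifold.maximalAtlas 𝓘(ℝ, Fin 2 → ℝ) ∞ Q :=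
    IsManifold.chart_mem_maximalAtlas q
  have hq : q ∈ e.source := mem_chart_source _ q
  have hcont : ContinuousAt (gradNormSq (S.orbitMetric e) fun y => S.r (e.symm y)) (e q) :=
    ((S.isRadialModel hmem).smooth_gradNormSq.continuousOn).continuousAt
      (e.open_target.mem_nhds (e.map_source hq))
  refine (hcont.comp (e.continuousAt hq)).congr ?_
  filter_upwards [e.open_source.mem_nhds hq] with x hx
  simp only [Function.comp_apply]
  rw [← S.gradSq_symm_apply hmem (e.map_source hx), e.left_inv hx]

theorem continuous_orbitMass (L : ℝ) : Continuous (S.orbitMass L) := by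
  have hr := S.r_smooth.continuous
  have hg := S.continuous_gradSq
  unfold orbitMass
  fun_prop

variable {S} {L : ℝ} {B : S.AdSBoundary L} {σ : Q} {t₀ : ℝ} {γ : ℝ → Q}

namespace IsSpacelikeSlice

theorem deriv_orbitMass_nonneg {G : ℝ} (hG : 0 < G)
    {T : ∀ q : Q, (Fin (p + 2 - 1) → ℝ) → SpacetimeVec (p + 2) q →ₗ[ℝ]
      SpacetimeVec (p + 2) q →ₗ[ℝ] ℝ}
    (hEinstein : S.EinsteinEquations L G T) (hDEC : S.DominantEnergyCondition T)
    (h : S.IsSpacelikeSlice B σ t₀ γ) {s : ℝ} (hs : 0 < s) (hN : 0 < S.gradSq (γ s))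
    (hr : 0 < S.radiusForm (γ s) (velocity γ s)) :
    0 ≤ deriv (fun s => S.orbitMass L (γ s)) s := by
  set e := chartAt (Fin 2 → ℝ) (γ s) with he
  have hmem : e ∈ IsManifold.maximalAtlas 𝓘(ℝ, Fin 2 → ℝ) ∞ Q :=
    IsManifold.chart_mem_maximalAtlas (γ s)
  have hq : γ s ∈ e.source := mem_chart_source _ (γ s)
  rw [(h.hasDerivAt_orbitMass hs hmem hq L).deriv]
  have hw := h.spacelike s hs.le
  -- Tangent vectors depend on the base point, so the point is made a variable and replaced by
  -- `e.symm y`.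
  generalize velocity γ s = w at *
  generalize γ s = q at *
  clear he
  clear_value e
  obtain ⟨y, hy, rfl⟩ : ∃ y ∈ e.target, q = e.symm y :=
    ⟨e q, e.map_source hq, (e.left_inv hq).symm⟩
  rw [e.right_inv hy]
  obtain ⟨l, m, hlm⟩ := S.exists_isNullFrame _ hw
  rw [S.gradSq_eq_neg_mul_div hlm hw, div_pos_iff_of_pos_right hw] at hN
  rw [hlm.apply_eq] at hr
  -- `l(r) m(r) < 0` together with `l(r) > m(r)` determines both signs.
  have hl : 0 ≤ S.radiusForm (e.symm y) l := by
    by_contra hneg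
    nlinarith
  have hm : S.radiusForm (e.symm y) m ≤ 0 := by
    by_contra hneg
    nlinarith
  exact S.orbitMass_deriv_nonneg hG hEinstein hDEC hmem hy hlm hw hl hm

/-- The Misner-Sharp mass of the inner end of the slice is at most its limit at the boundary. -/
theorem orbitMass_le_of_tendsto {G : ℝ} (hG : 0 < G)
    {T : ∀ q : Q, (Fin (p + 2 - 1) → ℝ) → SpacetimeVec (p + 2) q →ₗ[ℝ]
      SpacetimeVec (p + 2) q →ₗ[ℝ] ℝ}
    (hEinstein : S.EinsteinEquations L G T) (hDEC : S.DominantEnergyCondition T)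
    (h : S.IsSpacelikeSlice B σ t₀ γ) (hL : 0 < L)
    (hnot : ∀ s, 0 < s → ¬ S.IsMarginallyTrapped (γ s) (velocity γ s) ∧
      ¬ S.IsPastMarginallyTrapped (γ s) (velocity γ s))
    (hr : Tendsto (fun s => S.r (γ s)) atTop atTop) {μ : ℝ}
    (hμ : Tendsto (fun s => S.orbitMass L (γ s)) atTop (𝓝 μ)) : S.orbitMass L σ ≤ μ := by
  have hγc : ContinuousOn γ (Ici 0) := h.contMDiffOn.continuousOn
  have hNc : ContinuousOn (fun s => S.gradSq (γ s)) (Ioi 0) :=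
    S.continuous_gradSq.comp_continuousOn (hγc.mono Ioi_subset_Ici_self)
  have hr1 := h.contDiffOn_radius
  have hdc : ContinuousOn (deriv fun s => S.r (γ s)) (Ioi 0) :=
    (hr1.mono Ioi_subset_Ici_self).continuousOn_deriv_of_isOpen isOpen_Ioi le_rfl
  have hdiff : ∀ s, 0 < s → DifferentiableAt ℝ (fun s => S.r (γ s)) s := fun s hs =>
    (hr1.contDiffAt (Ici_mem_nhds hs)).differentiableAt (by simp)
  -- If `|∇r|² ≤ 0` far out, the mass would be at least `r^p (k + r²/L²)`, which exceeds any bound;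
  -- but it converges to `μ`.
  have hNev : ∀ᶠ s in atTop, 0 < S.gradSq (γ s) := by
    have hsq : Tendsto (fun s => k + S.r (γ s) ^ 2 / L ^ 2) atTop atTop :=
      tendsto_atTop_add_const_left _ _
        (((tendsto_pow_atTop two_ne_zero).comp hr).atTop_div_const (by positivity))
    filter_upwards [hsq.eventually_gt_atTop (max (μ + 1) 0), hr.eventually_ge_atTop 1,
      hμ.eventually_lt_const (show μ < μ + 1 by linarith)] with s hs1 hs2 hs3
    by_contra hneg
    have h1 : 1 ≤ S.r (γ s) ^ p := one_le_pow₀ hs2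
    have h2 : S.orbitMass L (γ s)
      = S.r (γ s) ^ p * (k + S.r (γ s) ^ 2 / L ^ 2 - S.gradSq (γ s)) := rfl
    have h3 := le_max_left (μ + 1) 0
    have h4 := le_max_right (μ + 1) 0
    nlinarith
  have hdne : ∀ s, 0 < s → 0 < S.gradSq (γ s) → deriv (fun s => S.r (γ s)) s ≠ 0 :=
    fun s hs hN => by
      rw [h.deriv_radius hs]
      exact S.radiusForm_ne_zero_of_gradSq_pos (h.spacelike s hs.le) hN
  have hdev : ∀ᶠ s in atTop, 0 < deriv (fun s => S.r (γ s)) s :=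
    eventually_deriv_pos_of_tendsto_atTop hdiff hdc
      (by filter_upwards [hNev, eventually_gt_atTop 0] with s h1 h2 using hdne s h2 h1) hr
  have hpos : ∀ s, 0 < s → 0 < S.gradSq (γ s) ∧ 0 < deriv (fun s => S.r (γ s)) s := by
    intro s hs
    refine pos_of_continuousOn_of_eventually_pos hNc hdc (hNev.and hdev) (fun s hs h1 h2 => ?_) hs
    have hN : 0 < S.gradSq (γ s) := by
      refine lt_of_le_of_ne h1 fun h0 => ?_
      rw [h.deriv_radius hs] at h2
      rcases S.isMarginallyTrapped_or_of_gradSq_eq_zero (h.spacelike s hs.le) h0.symm h2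
        with h3 | h3
      · exact (hnot s hs).1 h3
      · exact (hnot s hs).2 h3
    exact ⟨hN, lt_of_le_of_ne h2 (hdne s hs hN).symm⟩
  -- The signs are known only for `s > 0`, since `|∇r|²` may vanish at `σ`; continuity includes the
  -- endpoint.
  have hmono : MonotoneOn (fun s => S.orbitMass L (γ s)) (Ici 0) := by
    refine monotoneOn_of_deriv_nonneg (convex_Ici 0)
      ((S.continuous_orbitMass L).comp_continuousOn hγc) ?_ ?_
    · rw [interior_Ici]
      intro s hs
      exact (h.hasDerivAt_orbitMass hs (IsManifold.chart_mem_maximalAtlas (γ s))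
        (mem_chart_source _ (γ s)) L).differentiableAt.differentiableWithinAt
    · rw [interior_Ici]
      intro s hs
      obtain ⟨h1, h2⟩ := hpos s hs
      rw [h.deriv_radius hs] at h2
      exact deriv_orbitMass_nonneg hG hEinstein hDEC h hs h1 h2
  rw [← h.starts]
  refine ge_of_tendsto hμ ?_
  filter_upwards [eventually_ge_atTop 0] with s hs
  exact hmono (mem_Ici.mpr le_rfl) hs hs

end IsSpacelikeSlice

end SymmetricSpacetime

/-! ### The energy density of a rotationally symmetric metric -/

theorem partialD_unit {f : ℝ → ℝ} {y : Unit → ℝ} {f' : ℝ} (hf : HasDerivAt f f' (y ())) (a : Unit) :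
    partialD a (fun u : Unit → ℝ => f (u ())) y = f' := by
  rw [partialD_comp_deriv (f := fun u : Unit → ℝ => u ()) hf (by fun_prop)]
  have h : HasFDerivAt (fun u : Unit → ℝ => u ())
      (ContinuousLinearMap.proj (R := ℝ) (φ := fun _ : Unit => ℝ) ()) y := hasFDerivAt_apply _ _
  rw [h.partialD_eq]
  simp

/-- The metric `A dρ² + R dΩ_k²`. -/
def sphericalMetric (k : ℝ) {n : ℕ} (A R : ℝ → ℝ) (x : Unit ⊕ Fin n → ℝ) :
    Matrix (Unit ⊕ Fin n) (Unit ⊕ Fin n) ℝ :=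
  warpedMetric k (fun u => Matrix.of fun _ _ => A (u ())) (fun u => R (u ())) x

section Spherical

variable {k : ℝ} {n : ℕ} {A R : ℝ → ℝ} {ρ : ℝ} {z : Fin n → ℝ}

theorem inv_unit_of (a : ℝ) (ha : a ≠ 0) :
    (Matrix.of fun _ _ => a : Matrix Unit Unit ℝ)⁻¹ = Matrix.of fun _ _ => a⁻¹ := by
  refine Matrix.inv_eq_right_inv ?_
  ext i j
  simp [Matrix.mul_apply, ha]

theorem det_unit_of (a : ℝ) : (Matrix.of fun _ _ => a : Matrix Unit Unit ℝ).det = a := by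
  simp [Matrix.det_unique]

theorem sqrt_det_sphericalMetric (hA : 0 < A ρ) (hR : 0 < R ρ) (z : Fin n → ℝ) :
    √(sphericalMetric k A R (Sum.elim (fun _ => ρ) z)).det
      = √(A ρ) * √(R ρ ^ n) * fiberDensity k z := by
  rw [sphericalMetric, warpedMetric, Matrix.det_fromBlocks_zero₂₁, det_unit_of, Matrix.det_smul,
    Fintype.card_fin]
  change √(A ρ * (R ρ ^ n * (fiberMetric k z).det)) = _
  rw [Real.sqrt_mul hA.le, Real.sqrt_mul (by positivity), fiberDensity, mul_assoc]

/-- The purely radial terms cancel in both antisymmetrized brackets, so `A'` and `A₀'` do not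
appear. What remains is a sum over the fibre directions of `D_j g_{ρj}` and `D_ρ g_{jj}`, computed
in `c1` and `c2`. -/
theorem energyDensity_sphericalMetric {A₀ R₀ V : ℝ → ℝ} {A' R' A₀' R₀' V' : ℝ}
    (hz : z ∈ fiberDomain k n)
    (hA : HasDerivAt A A' ρ) (hR : HasDerivAt R R' ρ) (hA₀ : HasDerivAt A₀ A₀' ρ)
    (hR₀ : HasDerivAt R₀ R₀' ρ) (hV : HasDerivAt V V' ρ)
    (hApos : 0 < A ρ) (hRpos : 0 < R ρ) (hA₀pos : 0 < A₀ ρ) (hR₀pos : 0 < R₀ ρ) :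
    energyDensity (sphericalMetric k A₀ R₀) (sphericalMetric k A R) (fun x => V (x (Sum.inl ())))
      (Sum.inl ()) (Sum.elim (fun _ => ρ) z)
      = √(A ρ) * √(R ρ ^ n) * fiberDensity k z * (n / (A ρ * R ρ)
        * (V ρ * (R₀' / R₀ ρ * R ρ / 2 + R₀' * A ρ / (2 * A₀ ρ) - R') + V' * (R ρ - R₀ ρ))) := by
  have hf : fiberFactor k z ≠ 0 := ne_of_gt hz
  set H : (Unit → ℝ) → Matrix Unit Unit ℝ := fun u => Matrix.of fun _ _ => A (u ()) with hH
  set H₀ : (Unit → ℝ) → Matrix Unit Unit ℝ := fun u => Matrix.of fun _ _ => A₀ (u ()) with hH₀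
  set Rf : (Unit → ℝ) → ℝ := fun u => R (u ()) with hRf
  set R₀f : (Unit → ℝ) → ℝ := fun u => R₀ (u ()) with hR₀f
  set y : Unit → ℝ := fun _ => ρ with hy
  have hg : sphericalMetric (n := n) k A R = warpedMetric k H Rf := rfl
  have hb : sphericalMetric (n := n) k A₀ R₀ = warpedMetric k H₀ R₀f := rfl
  have hdet : IsUnit (H y).det := by
    rw [hH, det_unit_of]
    exact isUnit_iff_ne_zero.mpr hApos.ne'
  have hdet₀ : IsUnit (H₀ y).det := by
    rw [hH₀, det_unit_of]
    exact isUnit_iff_ne_zero.mpr hA₀pos.ne'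
  have hproj : DifferentiableAt ℝ (fun u : Unit → ℝ => u ()) y := by fun_prop
  have hHd : ∀ a b, DifferentiableAt ℝ (fun u => H u a b) y := fun a b =>
    DifferentiableAt.comp (f := fun u : Unit → ℝ => u ()) y hA.differentiableAt hproj
  have hHd₀ : ∀ a b, DifferentiableAt ℝ (fun u => H₀ u a b) y := fun a b =>
    DifferentiableAt.comp (f := fun u : Unit → ℝ => u ()) y hA₀.differentiableAt hproj
  have hRd : DifferentiableAt ℝ Rf y :=
    DifferentiableAt.comp (f := fun u : Unit → ℝ => u ()) y hR.differentiableAt hproj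
  have hRd₀ : DifferentiableAt ℝ R₀f y :=
    DifferentiableAt.comp (f := fun u : Unit → ℝ => u ()) y hR₀.differentiableAt hproj
  have hRne : Rf y ≠ 0 := hRpos.ne'
  have hRne₀ : R₀f y ≠ 0 := hR₀pos.ne'
  have dR : ∀ a, partialD a Rf y = R' := fun a => partialD_unit hR a
  have dR₀ : ∀ a, partialD a R₀f y = R₀' := fun a => partialD_unit hR₀ a
  have dV : ∀ m : Unit ⊕ Fin n, partialD m (fun x => V (x (Sum.inl ()))) (Sum.elim y z)
      = Sum.elim (fun _ => V') (fun _ => 0) m := by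
    have hVd : DifferentiableAt ℝ (fun u : Unit → ℝ => V (u ())) y :=
      DifferentiableAt.comp (f := fun u : Unit → ℝ => u ()) y hV.differentiableAt hproj
    intro m
    rcases m with m | m
    · exact (partialD_inl_left z hVd m).trans (partialD_unit hV m)
    · exact partialD_inr_left z hVd m
  have iH : (H y)⁻¹ = Matrix.of fun _ _ => (A ρ)⁻¹ := inv_unit_of _ hApos.ne'
  have iH₀ : (H₀ y)⁻¹ = Matrix.of fun _ _ => (A₀ ρ)⁻¹ := inv_unit_of _ hA₀pos.ne'
  have hinv := warpedMetric_inv (k := k) (R := Rf) (z := z) hdet hRne hz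
  rw [energyDensity, sqrt_det_sphericalMetric hApos hRpos]
  congr 1
  rw [hg, hb]
  have c1 : ∀ j : Fin n, covDeriv (warpedMetric k H₀ R₀f) (warpedMetric k H Rf) (Sum.inr j)
      (Sum.inl ()) (Sum.inr j) (Sum.elim y z)
      = (R₀' * A ρ / (2 * A₀ ρ) - R₀' / R₀ ρ * R ρ / 2) * (fiberFactor k z ^ 2)⁻¹ := by
    intro j
    simp only [covDeriv, partialD_warpedMetric_inl_inr, Fintype.sum_sum_type,
      christoffel_warpedMetric_inl_inr_inr hRd₀ hdet₀ hRne₀ hz,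
      christoffel_warpedMetric_inr_inr_inl hRd₀ hdet₀ hRne₀ hz, dR₀, iH₀]
    simp [warpedMetric, fiberMetric_apply, hH, hRf, hR₀f, hy]
    field_simp
    ring
  have c2 : ∀ j : Fin n, covDeriv (warpedMetric k H₀ R₀f) (warpedMetric k H Rf) (Sum.inl ())
      (Sum.inr j) (Sum.inr j) (Sum.elim y z)
      = (R' - R₀' / R₀ ρ * R ρ) * (fiberFactor k z ^ 2)⁻¹ := by
    intro j
    simp only [covDeriv, partialD_warpedMetric_fiber hRd hz, Fintype.sum_sum_type,
      christoffel_warpedMetric_inl_inl_inr hHd₀ hdet₀ hRne₀ hz,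
      christoffel_warpedMetric_inr_inl_inr hRd₀ hdet₀ hRne₀ hz, dR₀, dR]
    simp [warpedMetric, fiberMetric_apply, hRf, hR₀f, hy]
    field_simp
    ring
  simp only [hinv, iH, Fintype.sum_sum_type, dV]
  simp [Matrix.one_apply, c1, c2]
  simp [warpedMetric, fiberMetric_apply, hRf, hR₀f, hy]
  field_simp
  ring

end Spherical

/-! ### Asymptotics of the Misner-Sharp mass -/

section Order

variable {ι : Type*} {l : Filter ι} {ρ : ι → ℝ} {f g : ι → ℝ} {a b : ℤ}

theorem isBigO_zpow_mul (hρ : Tendsto ρ l atTop) (hf : f =O[l] fun q => ρ q ^ a)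
    (hg : g =O[l] fun q => ρ q ^ b) : (fun q => f q * g q) =O[l] fun q => ρ q ^ (a + b) := by
  refine (hf.mul hg).trans_eventuallyEq ?_
  filter_upwards [hρ.eventually_gt_atTop 0] with q hq
  rw [zpow_add₀ hq.ne']

theorem isBigO_zpow_mono (hρ : Tendsto ρ l atTop) (hab : a ≤ b) (hf : f =O[l] fun q => ρ q ^ a) :
    f =O[l] fun q => ρ q ^ b := by
  refine hf.trans (IsBigO.of_bound 1 ?_)
  filter_upwards [hρ.eventually_ge_atTop 1] with q hq
  have h0 : 0 < ρ q := by linarith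
  rw [one_mul, Real.norm_of_nonneg (by positivity), Real.norm_of_nonneg (by positivity)]
  exact zpow_le_zpow_right₀ hq hab

theorem tendsto_zero_of_isBigO_zpow (hρ : Tendsto ρ l atTop) (ha : a < 0)
    (hf : f =O[l] fun q => ρ q ^ a) : Tendsto f l (𝓝 0) :=
  hf.trans_tendsto ((tendsto_zpow_atTop_zero ha).comp hρ)

theorem isBigO_zpow_zero_of_tendsto {c : ℝ} (hf : Tendsto f l (𝓝 c)) :
    f =O[l] fun q => ρ q ^ (0 : ℤ) := by
  simpa using hf.isBigO_one ℝ

theorem isBigO_zpow_self : ρ =O[l] fun q => ρ q ^ (1 : ℤ) := by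
  simpa using isBigO_refl ρ l

theorem isBigO_zpow_inv_self : (fun q => (ρ q)⁻¹) =O[l] fun q => ρ q ^ (-1 : ℤ) := by
  simpa using isBigO_refl (fun q => (ρ q)⁻¹) l

theorem isBigO_zpow_of_tendsto_mul_inv {c : ℝ} (hρ : Tendsto ρ l atTop)
    (hf : Tendsto (fun q => f q * ρ q ^ (-a)) l (𝓝 c)) : f =O[l] fun q => ρ q ^ a := by
  have h1 := isBigO_zpow_mul hρ (isBigO_zpow_zero_of_tendsto (ρ := ρ) hf)
    (isBigO_refl (fun q => ρ q ^ a) l)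
  rw [zero_add] at h1
  refine h1.congr' ?_ EventuallyEq.rfl
  filter_upwards [hρ.eventually_gt_atTop 0] with q hq
  rw [mul_assoc, ← zpow_add₀ hq.ne']
  simp

/-- A function differentiable at `1` preserves the order of a deviation from `1`; used for `u⁻¹` and
`(√u)⁻¹`. -/
theorem isBigO_comp_sub_one {φ : ℝ → ℝ} {φ' : ℝ} (hφ : HasDerivAt φ φ' 1)
    (hf : Tendsto f l (𝓝 1)) (hfa : (fun q => f q - 1) =O[l] fun q => ρ q ^ a) :
    (fun q => φ (f q) - φ 1) =O[l] fun q => ρ q ^ a :=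
  (hφ.isBigO_sub.comp_tendsto hf).trans hfa

end Order

/-- With `α`, `y`, `x` the relative deviations of the radial component, of `r²` and of `∂_ρ(r²)`
from AdS, the charge density is linear in them up to the prefactors. Writing everything in the roots
of `W`, `1 + α` and `1 + y` makes the identity rational. -/
theorem energy_algebra {p : ℕ} {L W ρ A r x y α R' : ℝ} (hL : 0 < L) (hW : 0 < W) (hρ : 0 < ρ)
    (hA : A * W = 1 + α) (hα : 0 < 1 + α) (hr : 0 < r) (hry : r ^ 2 = ρ ^ 2 * (1 + y))
    (hy : 0 < 1 + y) (hR' : R' = 2 * ρ * (1 + x)) :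
    √A * √((r ^ 2) ^ (p + 1)) * ((p + 1) / (A * r ^ 2)
        * (√W * (r ^ 2 / ρ + ρ * A * W - R') + ρ / (L ^ 2 * √W) * (r ^ 2 - ρ ^ 2)))
      = (p + 1) * (r ^ p * ((√((1 + y) * (1 + α)))⁻¹
        * (W * (y + α - 2 * x) + ρ ^ 2 * y / L ^ 2))) := by
  set a := √(1 + α) with ha
  set b := √(1 + y) with hb
  set v := √W with hv
  have ha0 : 0 < a := Real.sqrt_pos.mpr hα
  have hb0 : 0 < b := Real.sqrt_pos.mpr hy
  have hv0 : 0 < v := Real.sqrt_pos.mpr hW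
  have ha2 : a ^ 2 = 1 + α := Real.sq_sqrt hα.le
  have hb2 : b ^ 2 = 1 + y := Real.sq_sqrt hy.le
  have hv2 : v ^ 2 = W := Real.sq_sqrt hW.le
  have hrb : r = ρ * b := by
    have h1 : r ^ 2 = (ρ * b) ^ 2 := by rw [hry, mul_pow, hb2]
    exact (pow_left_inj₀ hr.le (by positivity) two_ne_zero).mp h1
  have hAa : A = (a / v) ^ 2 := by
    rw [div_pow, ha2, hv2, ← hA]
    field_simp
  have hsA : √A = a / v := by rw [hAa, Real.sqrt_sq (by positivity)]
  have hsr : √((r ^ 2) ^ (p + 1)) = r ^ p * r := by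
    rw [← pow_mul, mul_comm 2, pow_mul, Real.sqrt_sq (by positivity), pow_succ]
  have hsP : √((1 + y) * (1 + α)) = b * a := by rw [Real.sqrt_mul hy.le]
  have hα' : α = a ^ 2 - 1 := by linarith
  have hy' : y = b ^ 2 - 1 := by linarith
  rw [hsA, hsr, hsP, hR', hAa, ← hv2, hα', hy']
  generalize r ^ p = c
  rw [hrb]
  field_simp
  ring

/-- Exact form of the cancellation: the first-order parts of mass and charge coincide, and each term
on the right is a product of two small quantities times known powers. The last one comes from
completing the square in `|∇r|²`, which splits off `rρ² / A`. -/
theorem mass_algebra {k L W ρ A r rt rρ h₀ h₁ x y α c : ℝ} (hW : W = k + ρ ^ 2 / L ^ 2)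
    (hW0 : W ≠ 0) (hρ : 0 < ρ) (hL : 0 < L)
    (hA : A * W = 1 + α) (hα : 0 < 1 + α) (hry : r ^ 2 = ρ ^ 2 * (1 + y))
    (hy : 0 < 1 + y) (hR' : 2 * r * rρ = 2 * ρ * (1 + x)) (hdet : h₀ * A - h₁ ^ 2 ≠ 0) :
    c * (k + r ^ 2 / L ^ 2 - (A * rt ^ 2 - 2 * h₁ * rt * rρ + h₀ * rρ ^ 2) / (h₀ * A - h₁ ^ 2))
      - c * ((√((1 + y) * (1 + α)))⁻¹ * (W * (y + α - 2 * x) + ρ ^ 2 * y / L ^ 2))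
      = c * (W * ((y + α - 2 * x) * ((((1 + y) * (1 + α))⁻¹ - (√((1 + y) * (1 + α)))⁻¹))
            + (y * α - x * x) * ((1 + y) * (1 + α))⁻¹)
          - ρ * ρ * y * (L ^ 2)⁻¹ * ((√((1 + y) * (1 + α)))⁻¹ - 1)
          - (A * rt - h₁ * rρ) * (A * rt - h₁ * rρ) * A⁻¹ * (h₀ * A - h₁ ^ 2)⁻¹) := by
  have hA0 : A ≠ 0 := by
    rintro rfl
    linarith
  have hrr : rρ ^ 2 * A⁻¹ = W * (1 + x) ^ 2 * ((1 + y) * (1 + α))⁻¹ := by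
    have h1 : r ^ 2 * rρ ^ 2 = ρ ^ 2 * (1 + x) ^ 2 := by
      have : r * rρ = ρ * (1 + x) := by linarith
      rw [← mul_pow, this, mul_pow]
    rw [hry] at h1
    have h2 : (1 + y) * rρ ^ 2 = (1 + x) ^ 2 := by
      have := pow_pos hρ 2
      refine mul_left_cancel₀ this.ne' ?_
      linarith
    have hWA : W = (1 + α) / A := by rw [← hA]; field_simp
    rw [hWA, ← h2]
    field_simp
  have hN : (A * rt ^ 2 - 2 * h₁ * rt * rρ + h₀ * rρ ^ 2) / (h₀ * A - h₁ ^ 2)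
      = rρ ^ 2 * A⁻¹ + (A * rt - h₁ * rρ) * (A * rt - h₁ * rρ) * A⁻¹ * (h₀ * A - h₁ ^ 2)⁻¹ := by
    generalize hD : h₀ * A - h₁ ^ 2 = D at hdet ⊢
    have hh₀ : h₀ = (D + h₁ ^ 2) / A := by
      field_simp
      linarith
    rw [hh₀]
    field_simp
    ring
  rw [hN, hrr, hry]
  have hk : k = W - ρ ^ 2 / L ^ 2 := by rw [hW]; ring
  rw [hk]
  set s := (√((1 + y) * (1 + α)))⁻¹
  clear_value s
  field_simp
  ring

/-- The Misner-Sharp mass is asymptotic to the energy density, for a metric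
`h₀ dt² + 2 h₁ dt dρ + A dρ² + r² dΩ_k²` that approaches the AdS metric. Here `rt` and `rρ` are
the partial derivatives of `r`. -/
theorem tendsto_mass_sub_energy {ι : Type*} {l : Filter ι} {ρ h₀ h₁ A r rt rρ : ι → ℝ}
    (p : ℕ) {k L : ℝ} (hL : 0 < L) (hρ : Tendsto ρ l atTop) (hr : ∀ q, 0 < r q)
    (h_tt : (fun q => h₀ q + (k + ρ q ^ 2 / L ^ 2)) =O[l] fun q => ρ q ^ (-(p : ℤ)))
    (h_tρ : h₁ =O[l] fun q => ρ q ^ (-(p : ℤ) - 3))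
    (h_ρρ : (fun q => A q - (k + ρ q ^ 2 / L ^ 2)⁻¹) =O[l] fun q => ρ q ^ (-(p : ℤ) - 4))
    (h_r : (fun q => r q ^ 2 - ρ q ^ 2) =O[l] fun q => ρ q ^ (-(p : ℤ)))
    (h_rt : (fun q => 2 * r q * rt q) =O[l] fun q => ρ q ^ (-(p : ℤ)))
    (h_rρ : (fun q => 2 * r q * rρ q - 2 * ρ q) =O[l] fun q => ρ q ^ (-(p : ℤ) - 1)) :
    Tendsto (fun q => r q ^ p * (k + r q ^ 2 / L ^ 2
        - (A q * rt q ^ 2 - 2 * h₁ q * rt q * rρ q + h₀ q * rρ q ^ 2) / (h₀ q * A q - h₁ q ^ 2))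
      - (p + 1 : ℝ)⁻¹ * (√(A q) * √((r q ^ 2) ^ (p + 1)) * ((p + 1) / (A q * r q ^ 2)
        * (√(k + ρ q ^ 2 / L ^ 2) * (r q ^ 2 / ρ q + ρ q * A q * (k + ρ q ^ 2 / L ^ 2)
            - 2 * r q * rρ q)
          + ρ q / (L ^ 2 * √(k + ρ q ^ 2 / L ^ 2)) * (r q ^ 2 - ρ q ^ 2))))) l (𝓝 0)
      ∧ Tendsto r l atTop ∧ ∀ᶠ q in l, 0 < A q := by
  set W : ι → ℝ := fun q => k + ρ q ^ 2 / L ^ 2 with hW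
  have hρpos : ∀ᶠ q in l, 0 < ρ q := hρ.eventually_gt_atTop 0
  have hWtop : Tendsto W l atTop := tendsto_atTop_add_const_left _ _
    (((tendsto_pow_atTop two_ne_zero).comp hρ).atTop_div_const (by positivity))
  have hWpos : ∀ᶠ q in l, 0 < W q := hWtop.eventually_gt_atTop 0
  have hρinv : Tendsto (fun q => (ρ q)⁻¹) l (𝓝 0) := tendsto_inv_atTop_zero.comp hρ
  have hWlim : Tendsto (fun q => W q * ρ q ^ (-2 : ℤ)) l (𝓝 (1 / L ^ 2)) := by
    have h1 : Tendsto (fun q => k * (ρ q)⁻¹ ^ 2 + 1 / L ^ 2) l (𝓝 (k * 0 ^ 2 + 1 / L ^ 2)) :=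
      ((hρinv.pow 2).const_mul k).add_const _
    rw [show k * 0 ^ 2 + 1 / L ^ 2 = 1 / L ^ 2 by ring] at h1
    refine h1.congr' ?_
    filter_upwards [hρpos] with q hq
    rw [zpow_neg, hW]
    norm_cast
    field_simp
  have oW : W =O[l] fun q => ρ q ^ (2 : ℤ) := isBigO_zpow_of_tendsto_mul_inv hρ hWlim
  have oWinv : (fun q => (W q)⁻¹) =O[l] fun q => ρ q ^ (-2 : ℤ) := by
    refine isBigO_zpow_of_tendsto_mul_inv hρ ((hWlim.inv₀ (by positivity)).congr' ?_)
    filter_upwards [hρpos] with q hq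
    rw [mul_inv, ← zpow_neg]
  set α : ι → ℝ := fun q => (A q - (W q)⁻¹) * W q with hα
  set y : ι → ℝ := fun q => (r q ^ 2 - ρ q ^ 2) * ((ρ q)⁻¹ * (ρ q)⁻¹) with hy
  set x : ι → ℝ := fun q => (2 * r q * rρ q - 2 * ρ q) * (ρ q)⁻¹ * (1 / 2) with hx
  have oinv := isBigO_zpow_inv_self (l := l) (ρ := ρ)
  have oconst : ∀ c : ℝ, (fun _ : ι => c) =O[l] fun q => ρ q ^ (0 : ℤ) := fun c =>
    isBigO_zpow_zero_of_tendsto tendsto_const_nhds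
  have oα : α =O[l] fun q => ρ q ^ (-(p : ℤ) - 2) := by
    exact isBigO_zpow_mono hρ (by omega) (isBigO_zpow_mul hρ h_ρρ oW)
  have oy : y =O[l] fun q => ρ q ^ (-(p : ℤ) - 2) := by
    exact isBigO_zpow_mono hρ (by omega) (isBigO_zpow_mul hρ h_r (isBigO_zpow_mul hρ oinv oinv))
  have ox : x =O[l] fun q => ρ q ^ (-(p : ℤ) - 2) := by
    exact isBigO_zpow_mono hρ (by omega)
      (isBigO_zpow_mul hρ (isBigO_zpow_mul hρ h_rρ oinv) (oconst (1 / 2)))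
  have hneg : -(p : ℤ) - 2 < 0 := by omega
  have tα := tendsto_zero_of_isBigO_zpow hρ hneg oα
  have ty := tendsto_zero_of_isBigO_zpow hρ hneg oy
  have tα1 : Tendsto (fun q => 1 + α q) l (𝓝 1) := by simpa using tα.const_add 1
  have ty1 : Tendsto (fun q => 1 + y q) l (𝓝 1) := by simpa using ty.const_add 1
  have hα1 : ∀ᶠ q in l, 0 < 1 + α q := tα1.eventually_const_lt one_pos
  have hy1 : ∀ᶠ q in l, 0 < 1 + y q := ty1.eventually_const_lt one_pos
  have hAW : ∀ᶠ q in l, A q * W q = 1 + α q := by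
    filter_upwards [hWpos] with q hq
    simp only [hα]
    field_simp
    ring
  have hApos : ∀ᶠ q in l, 0 < A q := by
    filter_upwards [hAW, hα1, hWpos] with q h1 h2 h3
    rw [← h1] at h2
    exact pos_of_mul_pos_left h2 h3.le
  have hry : ∀ᶠ q in l, r q ^ 2 = ρ q ^ 2 * (1 + y q) := by
    filter_upwards [hρpos] with q hq
    simp only [hy]
    field_simp
    ring
  have hrx : ∀ᶠ q in l, 2 * r q * rρ q = 2 * ρ q * (1 + x q) := by
    filter_upwards [hρpos] with q hq
    simp only [hx]
    field_simp
    ring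
  have hreq : ∀ᶠ q in l, r q = ρ q * √(1 + y q) := by
    filter_upwards [hry, hy1, hρpos] with q h1 h2 h3
    rw [← Real.sqrt_sq (hr q).le, h1, Real.sqrt_mul (by positivity), Real.sqrt_sq h3.le]
  have ts : Tendsto (fun q => √(1 + y q)) l (𝓝 1) := by simpa using ty1.sqrt
  have hrtop : Tendsto r l atTop := by
    refine (hρ.atTop_mul_pos one_pos ts).congr' ?_
    filter_upwards [hreq] with q hq using hq.symm
  have orinv : (fun q => (r q)⁻¹) =O[l] fun q => ρ q ^ (-1 : ℤ) := by
    have h1 := isBigO_zpow_mul hρ oinv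
      (isBigO_zpow_zero_of_tendsto (ρ := ρ) (ts.inv₀ one_ne_zero))
    refine h1.congr' ?_ EventuallyEq.rfl
    filter_upwards [hreq] with q hq
    rw [hq, mul_inv]
  have orp : (fun q => r q ^ p) =O[l] fun q => ρ q ^ (p : ℤ) := by
    have h1 := isBigO_zpow_mul hρ (isBigO_refl (fun q => ρ q ^ (p : ℤ)) l)
      (isBigO_zpow_zero_of_tendsto (ρ := ρ) (ts.pow p))
    rw [add_zero] at h1
    refine h1.congr' ?_ EventuallyEq.rfl
    filter_upwards [hreq] with q hq
    rw [hq, mul_pow, zpow_natCast]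
  have ort : rt =O[l] fun q => ρ q ^ (-(p : ℤ) - 1) := by
    have h1 := isBigO_zpow_mul hρ (isBigO_zpow_mul hρ h_rt orinv) (oconst (1 / 2))
    refine (isBigO_zpow_mono hρ (by omega) h1).congr_left fun q => ?_
    have := (hr q).ne'
    field_simp
  have orρ : rρ =O[l] fun q => ρ q ^ (0 : ℤ) := by
    have ox1 : (fun q => 1 + x q) =O[l] fun q => ρ q ^ (0 : ℤ) :=
      (oconst 1).add (isBigO_zpow_mono hρ hneg.le ox)
    have h1 := isBigO_zpow_mul hρ (isBigO_zpow_mul hρ ox1 isBigO_zpow_self) orinv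
    refine h1.congr' ?_ EventuallyEq.rfl
    filter_upwards [hrx] with q hq
    have := (hr q).ne'
    field_simp
    linarith
  have oA : A =O[l] fun q => ρ q ^ (-2 : ℤ) := by
    have h1 := isBigO_zpow_mul hρ (isBigO_zpow_zero_of_tendsto (ρ := ρ) tα1) oWinv
    refine h1.congr' ?_ EventuallyEq.rfl
    filter_upwards [hAW, hWpos] with q h1 h2
    rw [← h1]
    field_simp
  have oAinv : (fun q => (A q)⁻¹) =O[l] fun q => ρ q ^ (2 : ℤ) := by
    have h1 := isBigO_zpow_mul hρ oW
      (isBigO_zpow_zero_of_tendsto (ρ := ρ) (tα1.inv₀ one_ne_zero))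
    refine h1.congr' ?_ EventuallyEq.rfl
    filter_upwards [hAW, hWpos, hApos] with q h1 h2 h3
    rw [← h1]
    field_simp
  -- In AdS the `tt` and `ρρ` components are negative reciprocals of each other.
  have tdet : Tendsto (fun q => h₀ q * A q - h₁ q ^ 2) l (𝓝 (-1)) := by
    have t1 := tendsto_zero_of_isBigO_zpow hρ (by omega) (isBigO_zpow_mul hρ h_tt oA)
    have t2 := tendsto_zero_of_isBigO_zpow hρ (by omega) (isBigO_zpow_mul hρ h_tρ h_tρ)
    have t3 := (t1.sub tα1).sub t2
    rw [show (0 : ℝ) - 1 - 0 = -1 by ring] at t3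
    refine t3.congr' ?_
    filter_upwards [hAW] with q hq
    rw [← hq]
    simp only [hW]
    ring
  have hdet : ∀ᶠ q in l, h₀ q * A q - h₁ q ^ 2 ≠ 0 := tdet.eventually_ne (by norm_num)
  have odet := isBigO_zpow_zero_of_tendsto (ρ := ρ) (tdet.inv₀ (by norm_num))
  set P : ι → ℝ := fun q => (1 + y q) * (1 + α q) with hP
  have tP : Tendsto P l (𝓝 1) := by simpa using ty1.mul tα1
  have oP : (fun q => P q - 1) =O[l] fun q => ρ q ^ (-(p : ℤ) - 2) := by
    have h1 := isBigO_zpow_mono hρ (show -(p : ℤ) - 2 + (-(p : ℤ) - 2) ≤ -(p : ℤ) - 2 by omega)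
      (isBigO_zpow_mul hρ oy oα)
    refine ((oy.add oα).add h1).congr_left fun q => ?_
    simp only [hP]
    ring
  have oPinv := isBigO_zpow_zero_of_tendsto (ρ := ρ) (tP.inv₀ one_ne_zero)
  have dsqrt : HasDerivAt (fun u : ℝ => (√u)⁻¹) (-(1 / (2 * √1)) / √1 ^ 2) 1 :=
    (Real.hasDerivAt_sqrt one_ne_zero).fun_inv (by simp)
  have os : (fun q => (√(P q))⁻¹ - 1) =O[l] fun q => ρ q ^ (-(p : ℤ) - 2) := by
    simpa using isBigO_comp_sub_one dsqrt tP oP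
  have ois : (fun q => (P q)⁻¹ - (√(P q))⁻¹) =O[l] fun q => ρ q ^ (-(p : ℤ) - 2) := by
    have h1 := isBigO_comp_sub_one (hasDerivAt_inv (one_ne_zero (α := ℝ))) tP oP
    refine (h1.sub os).congr_left fun q => ?_
    simp
  have o1 : (fun q => y q + α q - 2 * x q) =O[l] fun q => ρ q ^ (-(p : ℤ) - 2) :=
    (oy.add oα).sub (ox.const_mul_left 2)
  have o2 := isBigO_zpow_mul hρ o1 ois
  have o3 := (isBigO_zpow_mul hρ oy oα).sub (isBigO_zpow_mul hρ ox ox)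
  have o4 := isBigO_zpow_mul hρ o3 oPinv
  rw [add_zero] at o4
  have o5 := isBigO_zpow_mul hρ oW (o2.add o4)
  have oself := isBigO_zpow_self (l := l) (ρ := ρ)
  have o6 := isBigO_zpow_mul hρ (isBigO_zpow_mul hρ (isBigO_zpow_mul hρ
    (isBigO_zpow_mul hρ oself oself) oy) (oconst (L ^ 2)⁻¹)) os
  have o7 : (fun q => A q * rt q - h₁ q * rρ q) =O[l] fun q => ρ q ^ (-(p : ℤ) - 3) := by
    refine IsBigO.sub ?_ ?_
    · exact isBigO_zpow_mono hρ (by omega) (isBigO_zpow_mul hρ oA ort)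
    · exact isBigO_zpow_mono hρ (by omega) (isBigO_zpow_mul hρ h_tρ orρ)
  have o8 := isBigO_zpow_mul hρ (isBigO_zpow_mul hρ (isBigO_zpow_mul hρ o7 o7) oAinv) odet
  -- Two deviations of order `-p-2` times a factor of order `2`. The factor `r^p` then leaves
  -- `ρ^(-p-2)`, which tends to zero.
  set z : ℤ := -(p : ℤ) * 2 - 2 with hz
  have o9 := ((isBigO_zpow_mono hρ (b := z) (by omega) o5).sub
    (isBigO_zpow_mono hρ (b := z) (by omega) o6)).sub (isBigO_zpow_mono hρ (b := z) (by omega) o8)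
  have o10 := tendsto_zero_of_isBigO_zpow hρ (by omega) (isBigO_zpow_mul hρ orp o9)
  refine ⟨o10.congr' ?_, hrtop, hApos⟩
  filter_upwards [hρpos, hWpos, hAW, hα1, hy1, hry, hrx, hdet] with q g1 g2 g3 g4 g5 g6 g7 g8
  have hp : (p : ℝ) + 1 ≠ 0 := by positivity
  change _ = r q ^ p * (k + r q ^ 2 / L ^ 2
        - (A q * rt q ^ 2 - 2 * h₁ q * rt q * rρ q + h₀ q * rρ q ^ 2) / (h₀ q * A q - h₁ q ^ 2))
      - (p + 1 : ℝ)⁻¹ * (√(A q) * √((r q ^ 2) ^ (p + 1)) * ((p + 1) / (A q * r q ^ 2)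
        * (√(W q) * (r q ^ 2 / ρ q + ρ q * A q * W q - 2 * r q * rρ q)
          + ρ q / (L ^ 2 * √(W q)) * (r q ^ 2 - ρ q ^ 2))))
  rw [energy_algebra hL g2 g1 g3 g4 (hr q) g6 g5 g7, inv_mul_cancel_left₀ hp,
    mass_algebra (show W q = k + ρ q ^ 2 / L ^ 2 from rfl) g2.ne' g1 hL g3 g4 g6 g5 g7 g8]

/-! ### The surface charge and the mass at the boundary -/

theorem hasDerivAt_partialD_zero {f : (Fin 2 → ℝ) → ℝ} {t ρ : ℝ}
    (hf : DifferentiableAt ℝ f ![t, ρ]) :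
    HasDerivAt (fun s => f ![s, ρ]) (partialD 0 f ![t, ρ]) t := by
  have hc : HasDerivAt (fun s : ℝ => (![s, ρ] : Fin 2 → ℝ)) (Pi.single 0 1) t := by
    rw [hasDerivAt_pi]
    intro i
    fin_cases i
    · simpa using hasDerivAt_id' t
    · simpa using hasDerivAt_const t ρ
  exact hf.hasFDerivAt.comp_hasDerivAt (f := fun s : ℝ => (![s, ρ] : Fin 2 → ℝ)) t hc

theorem hasDerivAt_partialD_one {f : (Fin 2 → ℝ) → ℝ} {t ρ : ℝ}
    (hf : DifferentiableAt ℝ f ![t, ρ]) :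
    HasDerivAt (fun s => f ![t, s]) (partialD 1 f ![t, ρ]) ρ := by
  have hc : HasDerivAt (fun s : ℝ => (![t, s] : Fin 2 → ℝ)) (Pi.single 1 1) ρ := by
    rw [hasDerivAt_pi]
    intro i
    fin_cases i
    · simpa using hasDerivAt_const ρ t
    · simpa using hasDerivAt_id' ρ
  exact hf.hasFDerivAt.comp_hasDerivAt (f := fun s : ℝ => (![t, s] : Fin 2 → ℝ)) ρ hc

namespace SymmetricSpacetime

section Volume

variable {d : ℕ} {k : ℝ} {Q : Type*} [TopologicalSpace Q] [ChartedSpace (Fin 2 → ℝ) Q]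
  (S : SymmetricSpacetime d k Q)

theorem sliceMetric_eq_sphericalMetric (e : OpenPartialHomeomorph Q (Fin 2 → ℝ)) (t : ℝ) :
    S.sliceMetric e t = sphericalMetric k (fun ρ => S.hCoord e 1 1 (t, ρ))
      (fun ρ => S.r (e.symm ![t, ρ]) ^ 2) := by
  ext x a b
  rw [sliceMetric, S.metricCoord_eq_warpedMetric e]
  rcases a with a | a <;> rcases b with b | b <;> rfl

theorem area_eq (q : Q) (D : Set (Fin (d - 1) → ℝ)) :
    S.area q D = S.r q ^ (d - 1) * fiberVolume k D := by
  have h : ∀ z, √(Matrix.of fun i j : Fin (d - 1) =>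
      S.metric q z (0, Pi.single i 1) (0, Pi.single j 1)).det
      = S.r q ^ (d - 1) * fiberDensity k z := by
    intro z
    have hm : (Matrix.of fun i j : Fin (d - 1) =>
        S.metric q z (0, Pi.single i 1) (0, Pi.single j 1)) = S.r q ^ 2 • fiberMetric k z := by
      ext i j
      simp [metric, Pi.single_apply]
    have hr := (S.r_pos q).le
    rw [hm, Matrix.det_smul, Fintype.card_fin, Real.sqrt_mul (by positivity), ← pow_mul,
      mul_comm 2, pow_mul, Real.sqrt_sq (by positivity), fiberDensity]
  simp only [area, h, fiberVolume]
  rw [integral_const_mul]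

end Volume

variable {p : ℕ} {k : ℝ} {Q : Type*} [TopologicalSpace Q] [ChartedSpace (Fin 2 → ℝ) Q]
  {S : SymmetricSpacetime (p + 2) k Q} {L : ℝ}

namespace AdSBoundary

variable (B : S.AdSBoundary L)

theorem eventually_mem_target {t₀ : ℝ} (ht₀ : t₀ ∈ B.times) :
    ∀ᶠ q : ℝ × ℝ in 𝓝 t₀ ×ˢ atTop, ![q.1, q.2] ∈ B.chart.target := by
  have h₀ : ∀ᶠ t in 𝓝 t₀, t ∈ B.times := B.times_open.mem_nhds ht₀
  have h := h₀.prod_mk (eventually_gt_atTop B.rho₀)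
  filter_upwards [h] with q hq using B.collar q.1 hq.1 q.2 hq.2

/-- The energy density of a slice of constant time, divided by the volume density of the orbit. -/
def energy (q : ℝ × ℝ) : ℝ :=
  √(S.hCoord B.chart 1 1 q) * √((S.r (B.chart.symm ![q.1, q.2]) ^ 2) ^ (p + 1))
    * ((p + 1) / (S.hCoord B.chart 1 1 q * S.r (B.chart.symm ![q.1, q.2]) ^ 2)
      * (√(k + q.2 ^ 2 / L ^ 2) * (S.r (B.chart.symm ![q.1, q.2]) ^ 2 / q.2
          + q.2 * S.hCoord B.chart 1 1 q * (k + q.2 ^ 2 / L ^ 2)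
          - 2 * S.r (B.chart.symm ![q.1, q.2])
            * partialD 1 (fun y => S.r (B.chart.symm y)) ![q.1, q.2])
        + q.2 / (L ^ 2 * √(k + q.2 ^ 2 / L ^ 2))
          * (S.r (B.chart.symm ![q.1, q.2]) ^ 2 - q.2 ^ 2)))

theorem differentiableAt_hCoord {y : Fin 2 → ℝ} (hy : y ∈ B.chart.target) (i j : Fin 2) :
    DifferentiableAt ℝ (fun y => S.h (B.chart.symm y) (coordVec B.chart y i)
      (coordVec B.chart y j)) y :=
  (S.h_smooth B.chart B.chart_mem i j).differentiableAt_of_isOpen B.chart.open_target hy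

theorem differentiableAt_radius {y : Fin 2 → ℝ} (hy : y ∈ B.chart.target) :
    DifferentiableAt ℝ (fun y => S.r (B.chart.symm y)) y :=
  (S.isRadialModel B.chart_mem).differentiableAt_radius hy

/-- By symmetry the integrand depends on `z` only through the volume density of the fibre. The
background data are `A₀ = W⁻¹`, `R₀ = ρ²`, `V = √W` with `W = k + ρ²/L²`. -/
theorem integral_energyDensity {q : ℝ × ℝ} (hq : ![q.1, q.2] ∈ B.chart.target) (hρ : 0 < q.2)
    (hL : 0 < L) (hA : 0 < S.hCoord B.chart 1 1 q) (hW : 0 < k + q.2 ^ 2 / L ^ 2)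
    {D : Set (Fin (p + 2 - 1) → ℝ)} (hD : MeasurableSet D) (hDsub : D ⊆ fiberDomain k (p + 2 - 1)) :
    ∫ z in D, energyDensity (adsSliceMetric k L) (S.sliceMetric B.chart q.1) (adsLapse k L)
        (Sum.inl ()) (Sum.elim (fun _ => q.2) z) = B.energy q * fiberVolume k D := by
  obtain ⟨t, ρ⟩ := q
  dsimp only at *
  have hr := S.r_pos (B.chart.symm ![t, ρ])
  have dW : HasDerivAt (fun ρ : ℝ => k + ρ ^ 2 / L ^ 2) (2 * ρ / L ^ 2) ρ := by
    simpa using ((hasDerivAt_pow 2 ρ).div_const (L ^ 2)).const_add k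
  have dV : HasDerivAt (fun ρ : ℝ => √(k + ρ ^ 2 / L ^ 2))
      (2 * ρ / L ^ 2 / (2 * √(k + ρ ^ 2 / L ^ 2))) ρ := dW.sqrt hW.ne'
  have dR₀ : HasDerivAt (fun ρ : ℝ => ρ ^ 2) (2 * ρ) ρ := by simpa using hasDerivAt_pow 2 ρ
  have dA := hasDerivAt_partialD_one (B.differentiableAt_hCoord hq 1 1)
  have dr := hasDerivAt_partialD_one (B.differentiableAt_radius hq)
  have dR := dr.fun_pow 2
  have hsV : 0 < √(k + ρ ^ 2 / L ^ 2) := Real.sqrt_pos.mpr hW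
  have hsV2 : √(k + ρ ^ 2 / L ^ 2) ^ 2 = k + ρ ^ 2 / L ^ 2 := Real.sq_sqrt hW.le
  have key : ∀ z ∈ D, energyDensity (adsSliceMetric k L) (S.sliceMetric B.chart t) (adsLapse k L)
        (Sum.inl ()) (Sum.elim (fun _ => ρ) z) = B.energy (t, ρ) * fiberDensity k z := by
    intro z hz
    have h := energyDensity_sphericalMetric (V := fun ρ => √(k + ρ ^ 2 / L ^ 2)) (hDsub hz)
      (A := fun ρ => S.hCoord B.chart 1 1 (t, ρ)) dA dR (dW.fun_inv hW.ne') dR₀ dV hA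
      (pow_pos hr 2) (inv_pos.mpr hW) (pow_pos hρ 2)
    rw [sliceMetric_eq_sphericalMetric]
    refine h.trans ?_
    have hn : ((p + 2 - 1 : ℕ) : ℝ) = p + 1 := by
      rw [show p + 2 - 1 = p + 1 from rfl]
      push_cast
      ring
    have hpow : (S.r (B.chart.symm ![t, ρ]) ^ 2) ^ (p + 2 - 1)
        = (S.r (B.chart.symm ![t, ρ]) ^ 2) ^ (p + 1) := rfl
    rw [energy, hn, mul_right_comm, hpow]
    congr 2
    field_simp
    norm_num
    ring
  rw [setIntegral_congr_fun hD key, integral_const_mul, fiberVolume]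

theorem tendsto_orbitMass_sub_energy {t₀ : ℝ} (ht₀ : t₀ ∈ B.times) (hL : 0 < L) :
    Tendsto (fun q : ℝ × ℝ => S.orbitMass L (B.chart.symm ![q.1, q.2])
        - (p + 1 : ℝ)⁻¹ * B.energy q) (𝓝 t₀ ×ˢ atTop) (𝓝 0)
      ∧ Tendsto (fun q : ℝ × ℝ => S.r (B.chart.symm ![q.1, q.2])) (𝓝 t₀ ×ˢ atTop) atTop
      ∧ ∀ᶠ q in 𝓝 t₀ ×ˢ atTop, 0 < S.hCoord B.chart 1 1 q := by
  have hmem := B.eventually_mem_target ht₀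
  have hρ : Tendsto (fun q : ℝ × ℝ => q.2) (𝓝 t₀ ×ˢ atTop) atTop := tendsto_snd
  have e1 : (2 - ((p + 2 : ℕ) : ℤ)) = -(p : ℤ) := by push_cast; ring
  have e2 : (-1 - ((p + 2 : ℕ) : ℤ)) = -(p : ℤ) - 3 := by push_cast; ring
  have e3 : (-2 - ((p + 2 : ℕ) : ℤ)) = -(p : ℤ) - 4 := by push_cast; ring
  have e4 : (1 - ((p + 2 : ℕ) : ℤ)) = -(p : ℤ) - 1 := by push_cast; ring
  have h1 := B.decay_tt t₀ ht₀
  have h2 := B.decay_tρ t₀ ht₀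
  have h3 := B.decay_ρρ t₀ ht₀
  have h4 := B.decay_r t₀ ht₀
  have h5 := B.decay_dt_r t₀ ht₀
  have h6 := B.decay_dρ_r t₀ ht₀
  rw [e1] at h1 h4 h5
  rw [e2] at h2
  rw [e3] at h3
  rw [e4] at h6
  have h5' : (fun q : ℝ × ℝ => 2 * S.r (B.chart.symm ![q.1, q.2])
      * partialD 0 (fun y => S.r (B.chart.symm y)) ![q.1, q.2])
      =O[𝓝 t₀ ×ˢ atTop] fun q => q.2 ^ (-(p : ℤ)) := by
    refine h5.congr' ?_ EventuallyEq.rfl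
    filter_upwards [hmem] with q hq
    have := ((hasDerivAt_partialD_zero (B.differentiableAt_radius hq)).fun_pow 2).sub_const
      (q.2 ^ 2)
    refine this.deriv.trans ?_
    simp
  have h6' : (fun q : ℝ × ℝ => 2 * S.r (B.chart.symm ![q.1, q.2])
      * partialD 1 (fun y => S.r (B.chart.symm y)) ![q.1, q.2] - 2 * q.2)
      =O[𝓝 t₀ ×ˢ atTop] fun q => q.2 ^ (-(p : ℤ) - 1) := by
    refine h6.congr' ?_ EventuallyEq.rfl
    filter_upwards [hmem] with q hq
    have := ((hasDerivAt_partialD_one (B.differentiableAt_radius hq)).fun_pow 2).sub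
      (hasDerivAt_pow 2 q.2)
    refine this.deriv.trans ?_
    simp
  obtain ⟨g1, g2, g3⟩ := tendsto_mass_sub_energy p hL hρ (fun q => S.r_pos _) h1 h2 h3 h4 h5' h6'
  refine ⟨g1.congr' ?_, g2, g3⟩
  filter_upwards [hmem] with q hq
  have hgram := S.gram_ne_zero (span_coordVec B.chart_mem hq)
  rw [orbitMass, S.gradSq_eq_dualNormSq hgram, dualNormSq, ← S.partialD_radius B.chart_mem hq,
    ← S.partialD_radius B.chart_mem hq]
  rfl

end AdSBoundary

end SymmetricSpacetime

/-! ### Conclusion -/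

theorem rpow_area_ratio {p : ℕ} {r : ℝ} (hr : 0 ≤ r) (m : ℕ) :
    (r ^ (p + 1)) ^ ((m : ℝ) / ((p : ℝ) + 1)) = r ^ m := by
  have hp : (p : ℝ) + 1 ≠ 0 := by positivity
  rw [← Real.rpow_natCast, ← Real.rpow_mul hr, Nat.cast_add, Nat.cast_one, mul_div_cancel₀ _ hp,
    Real.rpow_natCast]

end

theorem theorem1 {d : ℕ} (hd : 2 ≤ d) {k : ℝ} (hk : k = 1 ∨ k = 0 ∨ k = -1) {L G : ℝ}
    (hL : 0 < L) (hG : 0 < G)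
    {Q : Type*} [TopologicalSpace Q] [ChartedSpace (Fin 2 → ℝ) Q]
    [IsManifold 𝓘(ℝ, Fin 2 → ℝ) ∞ Q]
    (S : SymmetricSpacetime d k Q)
    (T : ∀ q : Q, (Fin (d - 1) → ℝ) → SpacetimeVec d q →ₗ[ℝ] SpacetimeVec d q →ₗ[ℝ] ℝ)
    (hEinstein : S.EinsteinEquations L G T) (hDEC : S.DominantEnergyCondition T)
    (B : S.AdSBoundary L) (t₀ : ℝ) (ht₀ : t₀ ∈ B.times)
    (D : Set (Fin (d - 1) → ℝ)) (hD : MeasurableSet D) (hDsub : D ⊆ fiberDomain k (d - 1))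
    (hDfin : IntegrableOn (fiberDensity k) D) (hDpos : 0 < fiberVolume k D)
    (M : ℝ) (hM : B.HasMassAt G D t₀ M)
    (σ : Q) (hσ : S.IsOutermostMarginallyTrapped B σ t₀) :
    16 * Real.pi * G / (((d : ℝ) - 1) * fiberVolume k D) * M ≥
      k * (S.area σ D / fiberVolume k D) ^ (((d : ℝ) - 2) / ((d : ℝ) - 1))
        + 1 / L ^ 2 * (S.area σ D / fiberVolume k D) ^ ((d : ℝ) / ((d : ℝ) - 1)) := by
  obtain ⟨p, rfl⟩ : ∃ p, d = p + 2 := ⟨d - 2, by omega⟩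
  obtain ⟨γ, hγ, hMT, hnot⟩ := hσ
  obtain ⟨hsub, hr, hA⟩ := B.tendsto_orbitMass_sub_energy ht₀ hL
  have hΩ := hDpos.ne'
  have hGpi : 16 * Real.pi * G ≠ 0 := by positivity
  -- The normalization removes the fibre volume and the factor `p + 1 = d - 1`, which the charge
  -- density carries relative to the Misner-Sharp mass.
  set μ := 16 * Real.pi * G / (((p : ℝ) + 1) * fiberVolume k D) * M with hμ
  have hmass : Tendsto (fun q : ℝ × ℝ => S.orbitMass L (B.chart.symm ![q.1, q.2]))
      (𝓝 t₀ ×ˢ atTop) (𝓝 μ) := by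
    have hE : Tendsto (fun q : ℝ × ℝ => ((p : ℝ) + 1)⁻¹ * B.energy q) (𝓝 t₀ ×ˢ atTop) (𝓝 μ) := by
      refine (hM.const_mul (16 * Real.pi * G / (((p : ℝ) + 1) * fiberVolume k D))).congr' ?_
      have hρ : Tendsto (fun q : ℝ × ℝ => q.2) (𝓝 t₀ ×ˢ atTop) atTop := tendsto_snd
      have hW : Tendsto (fun q : ℝ × ℝ => k + q.2 ^ 2 / L ^ 2) (𝓝 t₀ ×ˢ atTop) atTop :=
        tendsto_atTop_add_const_left _ _
          (((tendsto_pow_atTop two_ne_zero).comp hρ).atTop_div_const (by positivity))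
      filter_upwards [hA, B.eventually_mem_target ht₀, hρ.eventually_gt_atTop 0,
        hW.eventually_gt_atTop 0] with q h1 h2 h3 h4
      rw [B.integral_energyDensity h2 h3 hL h1 h4 hD hDsub]
      have hp : (p : ℝ) + 1 ≠ 0 := by positivity
      field_simp
    simpa using hsub.add hE
  -- Along the slice `t` may vary; only the joint limit at the cut matters.
  have hend : Tendsto (fun s => (B.chart (γ s) 0, B.chart (γ s) 1)) atTop (𝓝 t₀ ×ˢ atTop) :=
    hγ.tendsto_time.prodMk hγ.tendsto_rho
  have hback : ∀ᶠ s in atTop,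
      B.chart.symm ![(B.chart (γ s) 0, B.chart (γ s) 1).1, (B.chart (γ s) 0, B.chart (γ s) 1).2]
        = γ s := by
    filter_upwards [hγ.eventually_mem] with s hs
    have h : ![B.chart (γ s) 0, B.chart (γ s) 1] = B.chart (γ s) := by
      ext i
      fin_cases i <;> rfl
    rw [h, B.chart.left_inv hs]
  have hle := hγ.orbitMass_le_of_tendsto hG hEinstein hDEC hL hnot
    ((hr.comp hend).congr' (by filter_upwards [hback] with s hs using congrArg S.r hs))
    ((hmass.comp hend).congr' (by
      filter_upwards [hback] with s hs using congrArg (S.orbitMass L) hs))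
  have hN : S.gradSq (γ 0) = 0 :=
    S.gradSq_eq_zero_of_isMarginallyTrapped (hγ.spacelike 0 le_rfl) hMT
  rw [hγ.starts] at hN
  have hrσ := (S.r_pos σ).le
  have h1 : ((p + 2 : ℕ) : ℝ) - 1 = p + 1 := by push_cast; ring
  have h2 : ((p + 2 : ℕ) : ℝ) - 2 = p := by push_cast; ring
  rw [h1, h2, ← hμ, S.area_eq, mul_div_cancel_right₀ _ hΩ, show p + 2 - 1 = p + 1 from rfl,
    rpow_area_ratio hrσ, rpow_area_ratio hrσ, ge_iff_le]
  refine le_trans (le_of_eq ?_) hle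
  rw [SymmetricSpacetime.orbitMass, hN]
  ring
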